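/- **Definitions.** A *graph* $G$ is a directed weighted multigraph with a finite set $V_G$ of vertices, a finite or countable set $E_G$ of edges, source and target maps $E_G\to V_G$ and weights $\omega_G:E_G\to\,]0,1]$. For graphs $G,H$, the union $G\cup H$ has vertices $V_G\cup V_H$ and edges $E_G\uplus E_H$. A *path* is a non-empty finite sequence of consecutive edges; its weight is the product of the weights of its edges; a *cycle* is a path that ends where it begins. A path in $G\cup H$ is *alternating* if consecutive edges come from different summands; an *alternating cycle* is a cycle that is alternating and whose first and last edges come from different summands; it is a *$1$-cycle* if it is not the $k$-th power of a cycle for any $k\ge 2$; *$1$-circuits* are $1$-cycles up to cyclic permutation. Put $\langle G,H\rangle=\sum_{\pi}-\log(1-\omega(\pi))\in[0,\infty]$, over all alternating $1$-circuits $\pi$ between $G$ and $H$ (with $\log 0=-\infty$). The *reduction* $G\mathbin{::}H$ has vertices $V_G\,\Delta\,V_H$ and, as edges, the alternating paths that begin and end in $V_G\,\Delta\,V_H$. A *project* is a pair $\mathfrak a=(a,A)$ with $a\in\mathbb R_{\ge 0}$ and $A$ a graph; its *carrier* is $V_A$. Let $\langle\!\langle\mathfrak a,\mathfrak b\rangle\!\rangle=a+b+\langle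 A,B\rangle$. Projects of the same carrier are *orthogonal* if $\langle\!\langle\mathfrak a,\mathfrak b\rangle\!\rangle\notin\{0,\infty\}$, and $S^\perp$ is the set of projects orthogonal to all elements of $S$. A *conduct* is a non-empty set $\mathbf A$ of projects of a common carrier with $\mathbf A=\mathbf A^{\perp\perp}$. The cut $\mathfrak f\mathbin{::}\mathfrak a=(\langle\!\langle\mathfrak f,\mathfrak a\rangle\!\rangle,F\mathbin{::}A)$ is defined when $\langle\!\langle\mathfrak f,\mathfrak a\rangle\!\rangle\neq\infty$. For disjoint carriers, $\mathfrak a\otimes\mathfrak b=(a+b,A\cup B)$; for conducts of disjoint carriers, $\mathbf A\otimes\mathbf B=\{\mathfrak a\otimes\mathfrak b\mid\mathfrak a\in\mathbf A,\mathfrak b\in\mathbf B\}^{\perp\perp}$ and $\mathbf A\multimap\mathbf B=\{\mathfrak f\mid\forall\mathfrak a\in\mathbf A,\ \mathfrak f\mathbin{::}\mathfrak a\text{ is defined and lies in }\mathbf B\}$. A map $\theta$ injective on the carrier acts on projects by moving the vertices and keeping everything else, and on sets of projects elementwise. Let $\psi_i(x)=(x,i)$ and $\phi(x,i)=2x+i$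 for $x\in\mathbb N$, $i\in\{0,1\}$; let $\mu(x,i)=(x,i+1)$; let $\nu(x,0)=(x,0)$ and $\nu(x,2)=(x,1)$; let $\tau$ be the involution of $\mathbb N\times\{0,1\}$ that exchanges $(2x+1,0)$ with $(2x,1)$ for all $x$ and fixes the other points. **Theorem.** The following is a well-defined category (in particular all the cuts used are defined): the objects are the conducts of carrier $X\subset\mathbb N$; the morphisms $\mathbf A\to\mathbf B$ are the projects in $\psi_0(\mathbf A)\multimap\psi_1(\mathbf B)$, where graphs with the same vertices that differ only by a renaming of edges are identified; the composite of $\mathfrak f:\mathbf A\to\mathbf B$ and $\mathfrak g:\mathbf B\to\mathbf C$ is $\mathfrak g\circ\mathfrak f=\nu(\mathfrak f\mathbin{::}\mu(\mathfrak g))$; the identity of an object of carrier $S$ is the project with wager $0$ whose graph has one edge of weight $1$ in each direction between $(x,0)$ and $(x,1)$, for every $x\in S$. This category is $*$-autonomous. More precisely, it carries a symmetric monoidal closed structure with unit $1=\{(0,\varnothing)\}^{\perp\perp}$ ($\varnothing$ the empty graph), with tensor product $\mathbf A\mathbin{\bar\otimes}\mathbf B=\phi(\psi_0(\mathbf A)\otimes\psi_1(\mathbf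 B))$ on objects and $\mathfrak f\mathbin{\bar\otimes}\mathfrak g=\tau(\psi_0(\phi(\mathfrak f))\otimes\psi_1(\phi(\mathfrak g)))$ on morphisms, and with internal hom $\mathbf A\mathbin{\bar\multimap}\mathbf B=\phi(\psi_0(\mathbf A)\multimap\psi_1(\mathbf B))$. The object $\bot=1^\perp$ is dualizing: for every object $\mathbf A$ the canonical morphism $\mathbf A\to(\mathbf A\mathbin{\bar\multimap}\bot)\mathbin{\bar\multimap}\bot$ is an isomorphism. The objects $1$ and $\bot$ are distinct. -/

import Mathlib

open scoped ENNReal NNReal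
open CategoryTheory MonoidalCategory

namespace GoI

/-! ## Directed weighted graphs -/

/-- A directed weighted graph whose vertices are locations in `V`: finitely many vertices,
finitely or countably many edges, weights in `]0,1]`. -/
structure WGraph (V : Type) where
  verts : Finset V
  E : Type
  countable : Countable E
  src : E → V
  tgt : E → V
  weight : E → ℝ
  src_mem : ∀ e, src e ∈ verts
  tgt_mem : ∀ e, tgt e ∈ verts
  weight_pos : ∀ e, 0 < weight e
  weight_le : ∀ e, weight e ≤ 1

namespace WGraph

variable {V W : Type}

/-- Equality of graphs up to renaming of the edges (the vertices, being locations, are fixed). -/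
def Iso (G H : WGraph V) : Prop :=
  G.verts = H.verts ∧ ∃ e : G.E ≃ H.E, ∀ x,
    H.src (e x) = G.src x ∧ H.tgt (e x) = G.tgt x ∧ H.weight (e x) = G.weight x

theorem Iso.refl (G : WGraph V) : G.Iso G :=
  ⟨rfl, Equiv.refl _, fun _ => ⟨rfl, rfl, rfl⟩⟩

theorem Iso.symm {G H : WGraph V} : G.Iso H → H.Iso G := by
  rintro ⟨hv, e, he⟩
  refine ⟨hv.symm, e.symm, fun x => ?_⟩
  have := he (e.symm x)
  simp only [Equiv.apply_symm_apply] at this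
  exact ⟨this.1.symm, this.2.1.symm, this.2.2.symm⟩

theorem Iso.trans {G H K : WGraph V} : G.Iso H → H.Iso K → G.Iso K := by
  rintro ⟨hv, e, he⟩ ⟨hv', e', he'⟩
  refine ⟨hv.trans hv', e.trans e', fun x => ?_⟩
  exact ⟨(he' (e x)).1.trans (he x).1, (he' (e x)).2.1.trans (he x).2.1,
    (he' (e x)).2.2.trans (he x).2.2⟩

/-- The empty graph. -/
def empty (V : Type) : WGraph V where
  verts := ∅
  E := Empty
  countable := inferInstance
  src := Empty.elim
  tgt := Empty.elim
  weight := Empty.elim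
  src_mem := fun e => e.elim
  tgt_mem := fun e => e.elim
  weight_pos := fun e => e.elim
  weight_le := fun e => e.elim

/-- The same graph, with its vertices moved along `θ` (used for `θ` injective on the vertices). -/
def deloc [DecidableEq W] (θ : V → W) (G : WGraph V) : WGraph W where
  verts := G.verts.image θ
  E := G.E
  countable := G.countable
  src := fun e => θ (G.src e)
  tgt := fun e => θ (G.tgt e)
  weight := G.weight
  src_mem := fun e => Finset.mem_image_of_mem _ (G.src_mem e)
  tgt_mem := fun e => Finset.mem_image_of_mem _ (G.tgt_mem e)
  weight_pos := G.weight_pos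
  weight_le := G.weight_le

theorem Iso.deloc [DecidableEq W] (θ : V → W) {G H : WGraph V} :
    G.Iso H → (G.deloc θ).Iso (H.deloc θ) := by
  rintro ⟨hv, e, he⟩
  refine ⟨congrArg (Finset.image θ) hv, e, fun x => ⟨?_, ?_, (he x).2.2⟩⟩
  · exact congrArg θ (he x).1
  · exact congrArg θ (he x).2.1

/-- The weight of a path. -/
def pathWeight (G : WGraph V) (p : List G.E) : ℝ := (p.map G.weight).prod

theorem pathWeight_pos (G : WGraph V) (p : List G.E) : 0 < G.pathWeight p := by
  unfold pathWeight
  induction p with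
  | nil => simp
  | cons a l ih => simpa using mul_pos (G.weight_pos a) ih

theorem pathWeight_le (G : WGraph V) (p : List G.E) : G.pathWeight p ≤ 1 := by
  unfold pathWeight
  induction p with
  | nil => simp
  | cons a l ih =>
    have h : 0 < (l.map G.weight).prod := G.pathWeight_pos l
    simpa using mul_le_one₀ (G.weight_le a) h.le ih

variable [DecidableEq V]

/-- The union of two graphs: union of the vertices, disjoint union of the edges. An edge is
coloured by the summand of `G.E ⊕ H.E` it comes from, so this is also the plugging of `G`
and `H`. -/
def union (G H : WGraph V) : WGraph V where
  verts := G.verts ∪ H.verts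
  E := G.E ⊕ H.E
  countable := by
    have := G.countable
    have := H.countable
    infer_instance
  src := Sum.elim G.src H.src
  tgt := Sum.elim G.tgt H.tgt
  weight := Sum.elim G.weight H.weight
  src_mem := by
    rintro (e | e)
    · exact Finset.mem_union_left _ (G.src_mem e)
    · exact Finset.mem_union_right _ (H.src_mem e)
  tgt_mem := by
    rintro (e | e)
    · exact Finset.mem_union_left _ (G.tgt_mem e)
    · exact Finset.mem_union_right _ (H.tgt_mem e)
  weight_pos := by
    rintro (e | e)
    · exact G.weight_pos e
    · exact H.weight_pos e
  weight_le := by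
    rintro (e | e)
    · exact G.weight_le e
    · exact H.weight_le e

/-- A path: a non-empty list of consecutive edges. -/
def IsPath (G : WGraph V) (p : List G.E) : Prop :=
  p ≠ [] ∧ p.IsChain (fun e e' => G.src e' = G.tgt e)

/-- A cycle: a path that ends where it begins. -/
def IsCycle (G : WGraph V) (p : List G.E) : Prop :=
  G.IsPath p ∧ ∃ h : p ≠ [], G.src (p.head h) = G.tgt (p.getLast h)

/-- A `k`-cycle: `k` is the greatest integer such that the cycle is the `k`-th power of a cycle. -/
def IsKCycle (G : WGraph V) (k : ℕ) (p : List G.E) : Prop :=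
  G.IsCycle p ∧
    IsGreatest {n : ℕ | ∃ r : List G.E, G.IsCycle r ∧ (List.replicate n r).flatten = p} k

/-- Alternating paths between `G` and `H`. -/
def IsAltPath (G H : WGraph V) (p : List (G.union H).E) : Prop :=
  (G.union H).IsPath p ∧ List.IsChain (α := G.E ⊕ H.E) (fun e e' => e.isLeft ≠ e'.isLeft) p

/-- Alternating 1-cycles between `G` and `H`; the first and the last edge have different
colours. -/
def IsAltOneCycle (G H : WGraph V) (p : List (G.union H).E) : Prop :=
  G.IsAltPath H p ∧ (G.union H).IsKCycle 1 p ∧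
    ∃ h : p ≠ [], Sum.isLeft (α := G.E) (β := H.E) (p.getLast h) ≠
      Sum.isLeft (α := G.E) (β := H.E) (p.head h)

/-- Alternating 1-circuits: alternating 1-cycles up to cyclic permutation. -/
def circuits (G H : WGraph V) : Set (Cycle (G.union H).E) :=
  {c | ∃ p : List (G.union H).E, G.IsAltOneCycle H p ∧ (p : Cycle (G.union H).E) = c}

/-- The weight of a circuit. -/
def circuitWeight (G : WGraph V) (c : Cycle G.E) : ℝ := (c.toMultiset.map G.weight).prod

/-- `-log (1 - x)` for `x ≤ 1`, with `log 0 = -∞`. -/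
noncomputable def cost (x : ℝ) : ℝ≥0∞ :=
  if x < 1 then ENNReal.ofReal (-Real.log (1 - x)) else ⊤

/-- The measurement of the interaction of two graphs. -/
noncomputable def interaction (G H : WGraph V) : ℝ≥0∞ :=
  ∑' c : G.circuits H, cost ((G.union H).circuitWeight c.1)

/-- The reduction of `G` and `H`: its vertices are in the symmetric difference, its edges are the
alternating paths between such vertices. -/
def plug (G H : WGraph V) : WGraph V where
  verts := symmDiff G.verts H.verts
  E := {p : List (G.union H).E // G.IsAltPath H p ∧ ∃ h : p ≠ [],
    (G.union H).src (p.head h) ∈ symmDiff G.verts H.verts ∧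
    (G.union H).tgt (p.getLast h) ∈ symmDiff G.verts H.verts}
  countable := by
    have := (G.union H).countable
    infer_instance
  src := fun p => (G.union H).src (p.1.head p.2.2.1)
  tgt := fun p => (G.union H).tgt (p.1.getLast p.2.2.1)
  weight := fun p => (G.union H).pathWeight p.1
  src_mem := fun p => p.2.2.2.1
  tgt_mem := fun p => p.2.2.2.2
  weight_pos := fun p => (G.union H).pathWeight_pos p.1
  weight_le := fun p => (G.union H).pathWeight_le p.1

/-- The graph of the project `Fax_θ`: for every `v ∈ S`, an edge from `v` to `θ v` and an edge
from `θ v` to `v`, all of weight `1`. -/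
def fax (S : Finset V) (θ : V → V) : WGraph V where
  verts := S ∪ S.image θ
  E := S ⊕ S
  countable := inferInstance
  src := Sum.elim (fun v => v.1) (fun v => θ v.1)
  tgt := Sum.elim (fun v => θ v.1) (fun v => v.1)
  weight := fun _ => 1
  src_mem := by
    rintro (v | v)
    · exact Finset.mem_union_left _ v.2
    · exact Finset.mem_union_right _ (Finset.mem_image_of_mem _ v.2)
  tgt_mem := by
    rintro (v | v)
    · exact Finset.mem_union_right _ (Finset.mem_image_of_mem _ v.2)
    · exact Finset.mem_union_left _ v.2
  weight_pos := fun _ => one_pos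
  weight_le := fun _ => le_rfl

/-! ### The operations do not depend on the names of the edges -/

/-- A renaming of the edges of a plugging that respects colours. -/
structure PlugIso (G H G' H' : WGraph V) where
  e : (G.union H).E ≃ (G'.union H').E
  src : ∀ x, (G'.union H').src (e x) = (G.union H).src x
  tgt : ∀ x, (G'.union H').tgt (e x) = (G.union H).tgt x
  weight : ∀ x, (G'.union H').weight (e x) = (G.union H).weight x
  color : ∀ x, Sum.isLeft (α := G'.E) (β := H'.E) (e x) = Sum.isLeft (α := G.E) (β := H.E) x

variable {G H G' H' : WGraph V}

theorem Iso.plugIso (h₁ : G.Iso G') (h₂ : H.Iso H') : Nonempty (PlugIso G H G' H') := by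
  obtain ⟨-, e₁, he₁⟩ := h₁
  obtain ⟨-, e₂, he₂⟩ := h₂
  refine ⟨⟨Equiv.sumCongr e₁ e₂, ?_, ?_, ?_, ?_⟩⟩
  · rintro (x | x)
    · exact (he₁ x).1
    · exact (he₂ x).1
  · rintro (x | x)
    · exact (he₁ x).2.1
    · exact (he₂ x).2.1
  · rintro (x | x)
    · exact (he₁ x).2.2
    · exact (he₂ x).2.2
  · rintro (x | x) <;> rfl

namespace PlugIso

def symm (φ : PlugIso G H G' H') : PlugIso G' H' G H where
  e := φ.e.symm
  src x := by simpa using (φ.src (φ.e.symm x)).symm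
  tgt x := by simpa using (φ.tgt (φ.e.symm x)).symm
  weight x := by simpa using (φ.weight (φ.e.symm x)).symm
  color x := by simpa using (φ.color (φ.e.symm x)).symm

theorem isPath (φ : PlugIso G H G' H') {p : List (G.union H).E} (h : (G.union H).IsPath p) :
    (G'.union H').IsPath (p.map φ.e) := by
  refine ⟨by simpa using h.1, ?_⟩
  rw [List.isChain_map]
  exact h.2.imp fun a b hab => by rw [φ.src, φ.tgt, hab]

theorem isCycle (φ : PlugIso G H G' H') {p : List (G.union H).E} (h : (G.union H).IsCycle p) :
    (G'.union H').IsCycle (p.map φ.e) := by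
  obtain ⟨hp, hne, hc⟩ := h
  refine ⟨φ.isPath hp, by simpa using hne, ?_⟩
  rw [List.head_map, List.getLast_map, φ.src, φ.tgt, hc]

theorem isAltPath (φ : PlugIso G H G' H') {p : List (G.union H).E} (h : G.IsAltPath H p) :
    G'.IsAltPath H' (p.map φ.e) := by
  refine ⟨φ.isPath h.1, ?_⟩
  refine (List.isChain_map (β := (G.union H).E) (α := G'.E ⊕ H'.E) φ.e).2 ?_
  exact h.2.imp fun a b hab => by rw [φ.color, φ.color]; exact hab

theorem isKCycle (φ : PlugIso G H G' H') {k : ℕ} {p : List (G.union H).E}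
    (h : (G.union H).IsKCycle k p) : (G'.union H').IsKCycle k (p.map φ.e) := by
  obtain ⟨hc, ⟨r, hr, hrp⟩, hmax⟩ := h
  refine ⟨φ.isCycle hc, ⟨r.map φ.e, φ.isCycle hr, ?_⟩, ?_⟩
  · rw [← hrp, List.map_flatten, List.map_replicate]
  · rintro n ⟨s, hs, hsp⟩
    refine hmax ⟨s.map φ.symm.e, φ.symm.isCycle hs, ?_⟩
    have := congrArg (List.map φ.symm.e) hsp
    rw [List.map_flatten, List.map_replicate, List.map_map] at this
    rw [this]
    simp [symm]

theorem isAltOneCycle (φ : PlugIso G H G' H') {p : List (G.union H).E}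
    (h : G.IsAltOneCycle H p) : G'.IsAltOneCycle H' (p.map φ.e) := by
  obtain ⟨ha, hk, hne, hc⟩ := h
  refine ⟨φ.isAltPath ha, φ.isKCycle hk, by simpa using hne, ?_⟩
  rw [List.head_map, List.getLast_map, φ.color, φ.color]
  exact hc

theorem map_mem_circuits (φ : PlugIso G H G' H') {c : Cycle (G.union H).E}
    (h : c ∈ G.circuits H) : c.map φ.e ∈ G'.circuits H' := by
  obtain ⟨p, hp, rfl⟩ := h
  exact ⟨p.map φ.e, φ.isAltOneCycle hp, (Cycle.map_coe _ _).symm⟩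

theorem map_symm_map (φ : PlugIso G H G' H') (c : Cycle (G.union H).E) :
    (c.map φ.e).map φ.symm.e = c := by
  induction c using Quotient.inductionOn' with
  | h p =>
    change Cycle.map _ (Cycle.map _ (p : Cycle (G.union H).E)) = (p : Cycle (G.union H).E)
    simp [symm]

theorem circuitWeight_map (φ : PlugIso G H G' H') (c : Cycle (G.union H).E) :
    (G'.union H').circuitWeight (c.map φ.e) = (G.union H).circuitWeight c := by
  induction c using Quotient.inductionOn' with
  | h p =>
    change circuitWeight _ (Cycle.map _ (p : Cycle (G.union H).E)) =
      circuitWeight _ (p : Cycle (G.union H).E)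
    simp [circuitWeight, Function.comp_def, φ.weight]

theorem interaction_eq (φ : PlugIso G H G' H') : G.interaction H = G'.interaction H' := by
  let ε : G.circuits H ≃ G'.circuits H' :=
    { toFun := fun c => ⟨c.1.map φ.e, φ.map_mem_circuits c.2⟩
      invFun := fun c => ⟨c.1.map φ.symm.e, φ.symm.map_mem_circuits c.2⟩
      left_inv := fun c => Subtype.ext (φ.map_symm_map c.1)
      right_inv := fun c => Subtype.ext (φ.symm.map_symm_map c.1) }
  unfold interaction
  rw [← ε.tsum_eq]
  exact tsum_congr fun c => by
    change cost _ = cost (circuitWeight _ (Cycle.map φ.e c.1))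
    rw [φ.circuitWeight_map]

end PlugIso

theorem Iso.interaction_eq (h₁ : G.Iso G') (h₂ : H.Iso H') :
    G.interaction H = G'.interaction H' :=
  (h₁.plugIso h₂).elim fun φ => φ.interaction_eq

theorem Iso.union (h₁ : G.Iso G') (h₂ : H.Iso H') : (G.union H).Iso (G'.union H') := by
  obtain ⟨φ⟩ := h₁.plugIso h₂
  refine ⟨?_, φ.e, fun x => ⟨φ.src x, φ.tgt x, φ.weight x⟩⟩
  change G.verts ∪ H.verts = G'.verts ∪ H'.verts
  rw [h₁.1, h₂.1]

theorem Iso.plug (h₁ : G.Iso G') (h₂ : H.Iso H') : (G.plug H).Iso (G'.plug H') := by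
  obtain ⟨φ⟩ := h₁.plugIso h₂
  have hv : symmDiff G.verts H.verts = symmDiff G'.verts H'.verts := by rw [h₁.1, h₂.1]
  refine ⟨hv, ⟨fun p => ⟨p.1.map φ.e, φ.isAltPath p.2.1, ?_⟩,
    fun p => ⟨p.1.map φ.symm.e, φ.symm.isAltPath p.2.1, ?_⟩, ?_, ?_⟩, ?_⟩
  · obtain ⟨p, ha, hne, hs, ht⟩ := p
    refine ⟨by simpa using hne, ?_, ?_⟩
    · rw [List.head_map, φ.src, ← hv]; exact hs
    · rw [List.getLast_map, φ.tgt, ← hv]; exact ht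
  · obtain ⟨p, ha, hne, hs, ht⟩ := p
    refine ⟨by simpa using hne, ?_, ?_⟩
    · rw [List.head_map, φ.symm.src, hv]; exact hs
    · rw [List.getLast_map, φ.symm.tgt, hv]; exact ht
  · intro p
    exact Subtype.ext (by simp [PlugIso.symm])
  · intro p
    exact Subtype.ext (by simp [PlugIso.symm])
  · rintro ⟨p, ha, hne, hs, ht⟩
    refine ⟨?_, ?_, ?_⟩
    · change (G'.union H').src ((p.map φ.e).head _) = (G.union H).src (p.head _)
      rw [List.head_map, φ.src]
    · change (G'.union H').tgt ((p.map φ.e).getLast _) = (G.union H).tgt (p.getLast _)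
      rw [List.getLast_map, φ.tgt]
    · change pathWeight (G'.union H') (p.map φ.e) = pathWeight (G.union H) p
      simp [pathWeight, Function.comp_def, φ.weight]

end WGraph

/-! ## Projects -/

/-- A project: a wager and a directed weighted graph. -/
structure Project (V : Type) where
  wager : ℝ≥0
  graph : WGraph V

namespace Project

variable {V W : Type}

/-- The carrier of a project. -/
def carrier (a : Project V) : Finset V := a.graph.verts

/-- Equality of projects up to renaming of the edges. -/
instance setoid (V : Type) : Setoid (Project V) where
  r a b := a.wager = b.wager ∧ a.graph.Iso b.graph
  iseqv :=
    { refl := fun _ => ⟨rfl, .refl _⟩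
      symm := fun h => ⟨h.1.symm, h.2.symm⟩
      trans := fun h h' => ⟨h.1.trans h'.1, h.2.trans h'.2⟩ }

/-- The delocation of a project. -/
def deloc [DecidableEq W] (θ : V → W) (a : Project V) : Project W := ⟨a.wager, a.graph.deloc θ⟩

variable [DecidableEq V]

/-- The measurement of the interaction of two projects. -/
noncomputable def measure (a b : Project V) : ℝ≥0∞ :=
  a.wager + b.wager + a.graph.interaction b.graph

/-- Orthogonality of projects of the same carrier. -/
def Orthogonal (a b : Project V) : Prop :=
  a.carrier = b.carrier ∧ a.measure b ≠ 0 ∧ a.measure b ≠ ⊤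

/-- The tensor product of projects; only used for disjoint carriers, where there are no alternating
cycles, so that the wager is the measurement of the interaction. -/
def tensor (a b : Project V) : Project V := ⟨a.wager + b.wager, a.graph.union b.graph⟩

/-- The cut of two projects; it is defined when the measurement `f.measure g` is finite. -/
noncomputable def cut (f g : Project V) : Project V :=
  ⟨(f.measure g).toNNReal, f.graph.plug g.graph⟩

/-- The project `Fax_θ` on `S ∪ θ(S)`. -/
def fax (S : Finset V) (θ : V → V) : Project V := ⟨0, WGraph.fax S θ⟩

/-- The project with wager `0` and the empty graph. -/
def unit (V : Type) : Project V := ⟨0, WGraph.empty V⟩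

theorem measure_congr {a a' b b' : Project V} (ha : a ≈ a') (hb : b ≈ b') :
    a.measure b = a'.measure b' := by
  unfold measure
  rw [ha.1, hb.1, ha.2.interaction_eq hb.2]

end Project

/-! ## Conducts -/

section Conducts

variable {V : Type} [DecidableEq V]

/-- The orthogonal of a set of projects. -/
def orth (S : Set (Project V)) : Set (Project V) := {b | ∀ a ∈ S, a.Orthogonal b}

/-- A conduct: a non-empty set of projects, all of the same carrier, equal to its biorthogonal. -/
@[ext]
structure Conduct (V : Type) [DecidableEq V] where
  carrier : Finset V
  projects : Set (Project V)
  nonempty : projects.Nonempty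
  carrier_eq : ∀ a ∈ projects, a.carrier = carrier
  biorth : projects = orth (orth projects)

/-- The tensor product of two sets of projects, of disjoint carriers. -/
def tensorSet (A B : Set (Project V)) : Set (Project V) :=
  orth (orth {c | ∃ a ∈ A, ∃ b ∈ B, c = a.tensor b})

/-- The linear implication of two sets of projects, of disjoint carriers: the projects `f` such that
for all `a ∈ A` the cut of `f` and `a` is defined and in `B`. -/
def lolli (A B : Set (Project V)) : Set (Project V) :=
  {f | ∀ a ∈ A, f.measure a ≠ ⊤ ∧ f.cut a ∈ B}

end Conducts

/-! ## The relocations -/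

/-- The map `ψ_i`. The locations `ℕ × {0,1}`, `ℕ × {1,2}`, `ℕ × {0,2}` are taken inside `ℕ × ℕ`. -/
def psi (i : ℕ) (x : ℕ) : ℕ × ℕ := (x, i)

/-- The bijection `μ` from `ℕ × {0,1}` to `ℕ × {1,2}`. -/
def mu (p : ℕ × ℕ) : ℕ × ℕ := (p.1, p.2 + 1)

/-- The bijection `ν` from `ℕ × {0,2}` to `ℕ × {0,1}`. -/
def nu (p : ℕ × ℕ) : ℕ × ℕ := if p.2 = 2 then (p.1, 1) else p

/-- The bijection `φ` from `ℕ × {0,1}` to `ℕ`. -/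
def phi (p : ℕ × ℕ) : ℕ := 2 * p.1 + p.2

/-- The involution `τ` of `ℕ × {0,1}`: it exchanges `(2x+1, 0)` and `(2x, 1)`. -/
def tau (p : ℕ × ℕ) : ℕ × ℕ :=
  if p.2 = 0 ∧ p.1 % 2 = 1 then (p.1 - 1, 1)
  else if p.2 = 1 ∧ p.1 % 2 = 0 then (p.1 + 1, 0)
  else p

/-! ## The category of conducts -/

/-- Objects: the conducts with carrier a (finite) subset of `ℕ`. -/
abbrev Obj := Conduct ℕ

/-- The projects that are morphisms from `A` to `B`: the elements of `ψ₀(A) ⊸ ψ₁(B)`. -/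
def morphisms (A B : Obj) : Set (Project (ℕ × ℕ)) :=
  lolli (Project.deloc (psi 0) '' A.projects) (Project.deloc (psi 1) '' B.projects)

/-- The tensor product of objects, as a set of projects: `φ(ψ₀(A) ⊗ ψ₁(B))`. -/
def tensorObjSet (A B : Obj) : Set (Project ℕ) :=
  Project.deloc phi ''
    tensorSet (Project.deloc (psi 0) '' A.projects) (Project.deloc (psi 1) '' B.projects)

/-- The internal hom, as a set of projects: `φ(ψ₀(A) ⊸ ψ₁(B))`. -/
def internalHomSet (A B : Obj) : Set (Project ℕ) := Project.deloc phi '' morphisms A B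

/-- Projects up to renaming of the edges. -/
abbrev ProjectClass (V : Type) := Quotient (Project.setoid V)

/-- The identity on a carrier `S`: the class of `Fax_{1_S}`, with `1_S (x, 0) = (x, 1)`. -/
def idClass (S : Finset ℕ) : ProjectClass (ℕ × ℕ) :=
  ⟦Project.fax (S.image (psi 0)) (fun p => (p.1, 1))⟧

/-- The composition `ν(f ∷ μ(g))` of classes of projects. -/
noncomputable def compClass :
    ProjectClass (ℕ × ℕ) → ProjectClass (ℕ × ℕ) → ProjectClass (ℕ × ℕ) :=
  Quotient.map₂ (fun f g => (f.cut (g.deloc mu)).deloc nu) (by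
    intro f f' hf g g' hg
    have hg' : g.deloc mu ≈ g'.deloc mu := ⟨hg.1, hg.2.deloc mu⟩
    refine ⟨?_, (hf.2.plug hg'.2).deloc nu⟩
    change (f.measure (g.deloc mu)).toNNReal = (f'.measure (g'.deloc mu)).toNNReal
    rw [Project.measure_congr hf hg'])

/-- The tensor product `τ(ψ₀(φ(f)) ⊗ ψ₁(φ(g)))` of classes of projects. -/
def tensorHomClass :
    ProjectClass (ℕ × ℕ) → ProjectClass (ℕ × ℕ) → ProjectClass (ℕ × ℕ) :=
  Quotient.map₂
    (fun f g => (((f.deloc phi).deloc (psi 0)).tensor ((g.deloc phi).deloc (psi 1))).deloc tau) (by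
    intro f f' hf g g' hg
    refine ⟨?_, WGraph.Iso.deloc tau (WGraph.Iso.union ((hf.2.deloc phi).deloc (psi 0))
      ((hg.2.deloc phi).deloc (psi 1)))⟩
    change f.wager + g.wager = f'.wager + g'.wager
    rw [hf.1, hg.1])

/-- Morphisms from `A` to `B`: the elements of `ψ₀(A) ⊸ ψ₁(B)`, up to renaming of the edges. -/
@[ext]
structure Hom (A B : Obj) where
  cls : ProjectClass (ℕ × ℕ)
  mem : ∃ f ∈ morphisms A B, ⟦f⟧ = cls

/-- The objects, morphisms, identities and composition form a category: composition is everywhere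
defined, identities and composites are morphisms, and the laws of a category hold. -/
structure FormCategory : Prop where
  id_mem : ∀ A : Obj, ∃ f ∈ morphisms A A, ⟦f⟧ = idClass A.carrier
  comp_defined : ∀ {A B C : Obj}, ∀ f ∈ morphisms A B, ∀ g ∈ morphisms B C,
    f.measure (g.deloc mu) ≠ ⊤
  comp_mem : ∀ {A B C : Obj} (f : Hom A B) (g : Hom B C),
    ∃ k ∈ morphisms A C, ⟦k⟧ = compClass f.cls g.cls
  id_comp : ∀ {A B : Obj} (f : Hom A B), compClass (idClass A.carrier) f.cls = f.cls
  comp_id : ∀ {A B : Obj} (f : Hom A B), compClass f.cls (idClass B.carrier) = f.cls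
  assoc : ∀ {A B C D : Obj} (f : Hom A B) (g : Hom B C) (k : Hom C D),
    compClass (compClass f.cls g.cls) k.cls = compClass f.cls (compClass g.cls k.cls)

/-- The category of conducts. -/
@[reducible]
noncomputable def conductCategory (h : FormCategory) : Category.{1} Obj where
  Hom A B := Hom A B
  id A := ⟨idClass A.carrier, h.id_mem A⟩
  comp f g := ⟨compClass f.cls g.cls, h.comp_mem f g⟩
  id_comp f := Hom.ext (h.id_comp f)
  comp_id f := Hom.ext (h.comp_id f)
  assoc f g k := Hom.ext (h.assoc f g k)

/-! ## Dualizing objects -/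

section Dualizing

universe v u

variable {C : Type u} [Category.{v} C] [MonoidalCategory C] [SymmetricCategory C] [MonoidalClosed C]

/-- The canonical morphism from `A` to `(A ⊸ D) ⊸ D`: the transpose of the evaluation. -/
def doubleDual (D A : C) : A ⟶ (ihom ((ihom A).obj D)).obj D :=
  MonoidalClosed.curry ((β_ ((ihom A).obj D) A).hom ≫ (ihom.ev A).app D)

/-- `D` is dualizing: all the canonical morphisms to the double duals are isomorphisms. A symmetric
monoidal closed category with a dualizing object is a `*`-autonomous category. -/
def IsDualizing (D : C) : Prop := ∀ A : C, IsIso (doubleDual D A)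

end Dualizing

end GoI

/-! Everything rests on two facts about the cut.

The cut is associative: if no vertex lies in all three of F, G, H, then ⟨F,G⟩ + ⟨F∷G,H⟩ = ⟨G,H⟩ +
⟨F,G∷H⟩, and (F∷G)∷H and F∷(G∷H) agree up to renaming of edges. To see this, colour F ∪ G ∪ H with
three colours and ask that consecutive edges have different colours. Grouping the maximal runs
inside F ∪ G into single letters turns the paths of the coloured graph into the alternating paths
between F∷G and H. Its circuits are of two kinds: those that avoid H are counted by ⟨F,G⟩, those
that meet H are counted by ⟨F∷G,H⟩. The coloured graph does not depend on the order of F, G, H. The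
counting is done on words over abstract alphabets (`CycCode`, `IsRuns.cycSum_eq`) and yields
`interaction_trefoil` and `plug_assoc`.

A cut with a link, that is with edges of weight 1 between old locations and new ones, only relocates
(`map_mul_link`).

Wagers are allowed to be infinite in `EProject`, where the cut is a total commutative product,
associative in the absence of triple vertices. The wagers in a conduct are finite, so every cut that
lands in a conduct is defined. Associativity gives the adjunction `mem_perp_prods_iff`, hence A ⊸ B
= (A ⊗ B^⊥)^⊥ (`impl_eq`), the associativity of ⊗ and the currying identity `impl_tens`.

Arrows are compared after being placed at disjoint locations (`rel`), where composition becomes a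
product (`rel_compE`). Identities, associators, braidings and inverse unitors are links along
injections of ℕ (`IsReloc`), so coherence becomes an equality of functions, checked by parity.
Currying is itself a relocation. Finally A ⊸ ⊥ is a relocated A^⊥, so the double dual is A^⊥⊥ = A
moved along `ev ∘ ev`, and the canonical morphism is that relocation. The objects 1 and ⊥ differ
because (0, ∅) belongs to 1 and has measure 0 against itself. -/

set_option linter.unusedSectionVars false

attribute [reducible] GoI.WGraph.union GoI.WGraph.plug

namespace GoI

/-! ## Words and circuits -/

section Words

variable {α β γ : Type}

/-- A word is primitive if it is not a proper power. -/
def IsPrimitive (p : List α) : Prop :=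
  ∀ (n : ℕ) (r : List α), (List.replicate n r).flatten = p → n ≤ 1

/-- The empty word is its own square. -/
theorem IsPrimitive.ne_nil {p : List α} (h : IsPrimitive p) : p ≠ [] := by
  rintro rfl
  have := h 2 [] (by simp)
  omega

theorem flatten_replicate_cons_append (a : α) (t : List α) (n : ℕ) :
    t ++ (List.replicate n (a :: t)).flatten ++ [a] =
      (List.replicate (n + 1) (t ++ [a])).flatten := by
  induction n with
  | zero => simp
  | succ n ih =>
    rw [List.replicate_succ, List.flatten_cons, List.replicate_succ, List.flatten_cons, ← ih]
    simp

theorem rotate_one_flatten_replicate (n : ℕ) (r : List α) :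
    (List.replicate n r).flatten.rotate 1 = (List.replicate n (r.rotate 1)).flatten := by
  cases n with
  | zero => simp
  | succ n =>
    cases r with
    | nil => simp
    | cons a t =>
      rw [List.rotate_cons_succ, List.rotate_zero, ← flatten_replicate_cons_append,
        List.replicate_succ, List.flatten_cons, List.cons_append, List.rotate_cons_succ,
        List.rotate_zero]

/-- This makes primitivity a property of the circuit, independent of the word that represents it. -/
theorem rotate_flatten_replicate (n : ℕ) (r : List α) (k : ℕ) :
    (List.replicate n r).flatten.rotate k = (List.replicate n (r.rotate k)).flatten := by
  induction k with
  | zero => simp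
  | succ k ih =>
    rw [← List.rotate_rotate, ih, rotate_one_flatten_replicate, List.rotate_rotate]

theorem IsPrimitive.rotated {p q : List α} (h : IsPrimitive p) (hpq : p ~r q) :
    IsPrimitive q := by
  intro n r hr
  obtain ⟨k, hk⟩ := hpq.symm
  refine h n (r.rotate k) ?_
  rw [← rotate_flatten_replicate, hr, hk]

/-- The successive letters of the word, read cyclically, are related. -/
def CycChain (R : α → α → Prop) (p : List α) : Prop := (p ++ p).IsChain R

theorem CycChain.isChain {R : α → α → Prop} {p : List α} (h : CycChain R p) : p.IsChain R :=
  (List.isChain_append.1 h).1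

theorem CycChain.triple {R : α → α → Prop} {p : List α} (h : CycChain R p) :
    (p ++ p ++ p).IsChain R := by
  rcases eq_or_ne p [] with rfl | hp
  · simp
  · have h' := List.isChain_append.1 h
    refine List.isChain_append.2 ⟨h, h'.1, ?_⟩
    rw [List.getLast?_append_of_ne_nil _ hp]
    exact h'.2.2

theorem CycChain.swap {R : α → α → Prop} {u v : List α} (h : CycChain R (u ++ v)) :
    CycChain R (v ++ u) := by
  -- The square of `v ++ u` is a factor of the cube of `u ++ v`.
  have h3 := h.triple
  refine h3.infix ⟨u, v, ?_⟩
  simp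

theorem CycChain.rotated {R : α → α → Prop} {p q : List α} (h : CycChain R p) (hpq : p ~r q) :
    CycChain R q := by
  obtain ⟨k, hk, rfl⟩ := List.isRotated_iff_mod.1 hpq
  rw [List.rotate_eq_drop_append_take hk]
  refine CycChain.swap ?_
  rwa [List.take_append_drop]

/-- On a circuit every letter has a successor and a predecessor, a lone letter being its own. This
rules out circuits through dead ends. -/
theorem CycChain.exists_rel {R : α → α → Prop} {p : List α} (h : CycChain R p) {a : α}
    (ha : a ∈ p) : (∃ b ∈ p, R a b) ∧ ∃ b ∈ p, R b a := by
  obtain ⟨u, v, rfl⟩ := List.append_of_mem ha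
  -- Two rotations, one with `a` in front and one with `a` at the end.
  have h1 : CycChain R (a :: v ++ u) := h.swap
  have h2 : CycChain R (v ++ u ++ [a]) := by
    have : u ++ a :: v = (u ++ [a]) ++ v := by simp
    rw [this] at h
    simpa using h.swap
  constructor
  · unfold CycChain at h1
    cases hw : v ++ u with
    | nil =>
      rw [List.cons_append, hw] at h1
      exact ⟨a, by simp, by simpa using h1⟩
    | cons b w =>
      rw [List.cons_append, hw] at h1
      have hb : b ∈ v ++ u := by rw [hw]; simp
      refine ⟨b, ?_, (List.isChain_cons_cons.1 h1).1⟩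
      simp only [List.mem_append, List.mem_cons] at hb ⊢
      tauto
  · unfold CycChain at h2
    rcases List.eq_nil_or_concat (v ++ u) with hw | ⟨w, b, hw⟩
    · rw [hw] at h2
      exact ⟨a, by simp, by simpa using h2⟩
    · have hb : b ∈ v ++ u := by rw [hw]; simp
      refine ⟨b, ?_, ?_⟩
      · simp only [List.mem_append, List.mem_cons] at hb ⊢
        tauto
      · have h3 := (List.isChain_append.1 h2).1
        rw [hw] at h3
        have h4 : ([b] ++ [a]).IsChain R := h3.infix ⟨w, [], by simp⟩
        simpa using h4

/-- The circuits of a relation: the primitive closed words up to rotation. -/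
def circuitSet (R : α → α → Prop) : Set (Cycle α) :=
  {c | ∃ p : List α, CycChain R p ∧ IsPrimitive p ∧ (p : Cycle α) = c}

theorem coe_mem_circuitSet {R : α → α → Prop} {p : List α} :
    (p : Cycle α) ∈ circuitSet R ↔ CycChain R p ∧ IsPrimitive p := by
  constructor
  · rintro ⟨q, hq, hq', hqp⟩
    have hr : q ~r p := Cycle.coe_eq_coe.1 hqp
    exact ⟨hq.rotated hr, hq'.rotated hr⟩
  · exact fun h => ⟨p, h.1, h.2, rfl⟩

/-- The weight of a cycle. -/
def cycWeight (w : α → ℝ) (c : Cycle α) : ℝ := (c.toMultiset.map w).prod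

/-- The sum of the costs of the circuits. -/
noncomputable def cycSum (R : α → α → Prop) (w : α → ℝ) : ℝ≥0∞ :=
  ∑' c : circuitSet R, WGraph.cost (cycWeight w c.1)

theorem cycSum_eq_zero {R : α → α → Prop} (w : α → ℝ)
    (h : ∀ p : List α, p ≠ [] → ¬ CycChain R p) : cycSum R w = 0 := by
  have : IsEmpty (circuitSet R) := by
    refine ⟨?_⟩
    rintro ⟨c, p, hp, hp', -⟩
    exact h p hp'.ne_nil hp
  unfold cycSum
  simp

/-! ### Substitutions of words for letters, and their effect on circuits -/

/-- Substitution of words for the letters of a cycle. -/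
def cycFlatMap (f : β → List α) : Cycle β → Cycle α :=
  Quotient.map' (List.flatMap f) (by
    rintro p q h
    obtain ⟨k, hk, rfl⟩ := List.isRotated_iff_mod.1 h
    rw [List.rotate_eq_drop_append_take hk, List.flatMap_append]
    conv_lhs => rw [← List.take_append_drop k p, List.flatMap_append]
    exact List.isRotated_append)

theorem cycFlatMap_coe (f : β → List α) (p : List β) :
    cycFlatMap f (p : Cycle β) = ((p.flatMap f : List α) : Cycle α) := rfl

theorem flatMap_flatten_replicate (f : β → List α) (n : ℕ) (s : List β) :
    (List.replicate n s).flatten.flatMap f = (List.replicate n (s.flatMap f)).flatten := by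
  induction n with
  | zero => simp
  | succ n ih => simp [List.replicate_succ, ih]

theorem cycWeight_cycFlatMap (f : β → List α) (w : α → ℝ) (c : Cycle β) :
    cycWeight w (cycFlatMap f c) = cycWeight (fun b => ((f b).map w).prod) c := by
  induction c using Quotient.inductionOn' with
  | h p =>
    change (Multiset.map w (p.flatMap f : List α)).prod = (Multiset.map _ (p : Multiset β)).prod
    induction p with
    | nil => simp
    | cons a p ih =>
      simp only [Multiset.map_coe, Multiset.prod_coe] at ih ⊢
      simp only [List.flatMap_cons, List.map_append, List.prod_append, List.map_cons,
        List.prod_cons, ih]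

/-- A substitution that codes the closed words for `R'` by closed words for `R`: it is injective on
a set `D` of words, stable by concatenation, that meets all the conjugacy classes of closed words,
and for which the factors of code words at which one may rotate are code words. -/
structure CycCode (R' : β → β → Prop) (R : α → α → Prop) (f : β → List α)
    (D : List β → Prop) : Prop where
  append : ∀ {s t}, D s → D t → D (s ++ t)
  inj : ∀ {s t}, D s → D t → s.flatMap f = t.flatMap f → s = t
  nil : D []
  ne_nil : ∀ b, f b ≠ []
  decode : ∀ {w w' x y}, D w → D w' → w.flatMap f = x ++ y → w'.flatMap f = y ++ x →
    CycChain R (x ++ y) → x ≠ [] → y ≠ [] → ∃ s, D s ∧ s.flatMap f = x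
  chain : ∀ {s}, D s → (CycChain R' s ↔ CycChain R (s.flatMap f))
  rep : ∀ {p}, CycChain R' p → p ≠ [] → ∃ q, p ~r q ∧ D q

namespace CycCode

variable {R' : β → β → Prop} {R : α → α → Prop} {f : β → List α} {D : List β → Prop}

theorem replicate (h : CycCode R' R f D) {s : List β} (hs : D s) (n : ℕ) :
    D (List.replicate n s).flatten := by
  induction n with
  | zero => simpa using h.nil
  | succ n ih =>
    rw [List.replicate_succ, List.flatten_cons]
    exact h.append hs ih

theorem isPrimitive_iff (h : CycCode R' R f D) {w : List β} (hw : D w) (hc : CycChain R' w) :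
    IsPrimitive (w.flatMap f) ↔ IsPrimitive w := by
  constructor
  · intro hp n s hs
    refine hp n (s.flatMap f) ?_
    rw [← hs, flatMap_flatten_replicate]
  · intro hp n r hr
    by_contra hn
    obtain ⟨m, rfl⟩ : ∃ m, n = m + 1 + 1 := ⟨n - 2, by omega⟩
    rcases eq_or_ne r [] with rfl | hr0
    · have h0 : w.flatMap f = [] := by rw [← hr]; simp
      have : w = [] := h.inj hw h.nil (by simpa using h0)
      exact hp.ne_nil this
    -- The image both starts and ends with `r`, so rotating it by `r` gives it back: `decode`
    -- applies with `w' = w`, and the root `r` is itself the image of a code word.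
    · have hr1 : w.flatMap f = r ++ (List.replicate (m + 1) r).flatten := by
        rw [← hr, List.replicate_succ, List.flatten_cons]
      have hr2 : w.flatMap f = (List.replicate (m + 1) r).flatten ++ r := by
        rw [← hr, List.replicate_succ', List.flatten_append]; simp
      obtain ⟨s, hs, rfl⟩ := h.decode hw hw hr1 hr2 (by rw [← hr1]; exact (h.chain hw).1 hc) hr0
        (by rw [List.replicate_succ, List.flatten_cons]; simp [hr0])
      have := hp (m + 1 + 1) s (h.inj (h.replicate hs _) hw
        (by rw [flatMap_flatten_replicate, hr]))
      omega

/-- The rotation cuts the image of `w` into `x ++ y`, and `y ++ x` is the image of `w'`. Both pieces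
decode, and by injectivity they reassemble into `w` in one order and into `w'` in the other. -/
theorem isRotated (h : CycCode R' R f D) {w w' : List β} (hw : D w) (hw' : D w')
    (hc : CycChain R' w) (hr : w.flatMap f ~r w'.flatMap f) : w ~r w' := by
  obtain ⟨k, hk, hk'⟩ := List.isRotated_iff_mod.1 hr
  rw [List.rotate_eq_drop_append_take hk] at hk'
  have hx := (List.take_append_drop k (w.flatMap f)).symm
  generalize List.take k (w.flatMap f) = x at *
  generalize List.drop k (w.flatMap f) = y at *
  rcases eq_or_ne x [] with rfl | hx0
  · rw [h.inj hw hw' (by rw [hx, ← hk']; simp)]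
  rcases eq_or_ne y [] with rfl | hy0
  · rw [h.inj hw hw' (by rw [hx, ← hk']; simp)]
  have hcx : CycChain R (x ++ y) := by rw [← hx]; exact (h.chain hw).1 hc
  obtain ⟨s, hs, rfl⟩ := h.decode hw hw' hx hk'.symm hcx hx0 hy0
  obtain ⟨t, ht, rfl⟩ := h.decode hw' hw hk'.symm hx hcx.swap hy0 hx0
  have e1 : w = s ++ t := h.inj hw (h.append hs ht) (by rw [hx, List.flatMap_append])
  have e2 : t ++ s = w' := h.inj (h.append ht hs) hw' (by rw [← hk', List.flatMap_append])
  rw [e1, ← e2]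
  exact List.isRotated_append

theorem exists_rep (h : CycCode R' R f D) {c : Cycle β} (hc : c ∈ circuitSet R') :
    ∃ p, D p ∧ (p : Cycle β) = c := by
  obtain ⟨p, hp, hp', rfl⟩ := hc
  obtain ⟨q, hq, hD⟩ := h.rep hp hp'.ne_nil
  exact ⟨q, hD, (Cycle.coe_eq_coe.2 hq).symm⟩

theorem coe_mem_iff (h : CycCode R' R f D) {p : List β} (hp : D p) :
    (p : Cycle β) ∈ circuitSet R' ↔ ((p.flatMap f : List α) : Cycle α) ∈ circuitSet R := by
  rw [coe_mem_circuitSet, coe_mem_circuitSet, ← h.chain hp]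
  exact and_congr_right fun hc => (h.isPrimitive_iff hp hc).symm

theorem injOn (h : CycCode R' R f D) : Set.InjOn (cycFlatMap f) (circuitSet R') := by
  intro c hc c' hc' he
  obtain ⟨p, hp, rfl⟩ := h.exists_rep hc
  obtain ⟨q, hq, rfl⟩ := h.exists_rep hc'
  rw [cycFlatMap_coe, cycFlatMap_coe, Cycle.coe_eq_coe] at he
  exact Cycle.coe_eq_coe.2 (h.isRotated hp hq (coe_mem_circuitSet.1 hc).1 he)

theorem image_eq (h : CycCode R' R f D) : cycFlatMap f '' circuitSet R' =
    {c ∈ circuitSet R | ∃ s, D s ∧ ((s.flatMap f : List α) : Cycle α) = c} := by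
  ext c
  constructor
  · rintro ⟨c, hc, rfl⟩
    obtain ⟨p, hp, rfl⟩ := h.exists_rep hc
    exact ⟨(h.coe_mem_iff hp).1 hc, p, hp, rfl⟩
  · rintro ⟨hc, p, hp, rfl⟩
    exact ⟨p, (h.coe_mem_iff hp).2 hc, rfl⟩

theorem tsum_image (h : CycCode R' R f D) (w : α → ℝ) :
    ∑' c : (cycFlatMap f '' circuitSet R' : Set (Cycle α)), WGraph.cost (cycWeight w c.1) =
      cycSum R' (fun b => ((f b).map w).prod) := by
  rw [_root_.tsum_image (fun c => WGraph.cost (cycWeight w c)) h.injOn]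
  unfold cycSum
  exact tsum_congr fun c => by rw [cycWeight_cycFlatMap]

end CycCode

theorem flatMap_singleton_eq_map (f : β → α) (s : List β) :
    s.flatMap (fun b => [f b]) = s.map f := by
  induction s with
  | nil => rfl
  | cons a s ih => simp [List.flatMap_cons, ih]

/-- Used both for bijections of alphabets and for the inclusion of a smaller alphabet. -/
theorem cycCode_singleton {R' : β → β → Prop} {R : α → α → Prop} {f : β → α}
    (hf : Function.Injective f) (hR : ∀ a b, R' a b ↔ R (f a) (f b)) :
    CycCode R' R (fun b => [f b]) (fun _ => True) := by
  have key := flatMap_singleton_eq_map f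
  refine ⟨fun _ _ => trivial, ?_, trivial, by simp, ?_, ?_, fun _ _ => ⟨_, .refl _, trivial⟩⟩
  · intro s t _ _ hst
    rw [key, key] at hst
    exact hf.list_map hst
  · intro w w' x y _ _ hw _ _ _ _
    rw [key] at hw
    obtain ⟨u, v, -, hu, -⟩ := List.map_eq_append_iff.1 hw
    exact ⟨u, trivial, by rw [key, hu]⟩
  · intro s _
    rw [key]
    unfold CycChain
    rw [← List.map_append, List.isChain_map, show R' = fun a b => R (f a) (f b) from
      funext₂ fun a b => propext (hR a b)]

theorem cycSum_equiv {R' : β → β → Prop} {R : α → α → Prop} (e : β ≃ α)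
    (hR : ∀ a b, R' a b ↔ R (e a) (e b)) {w' : β → ℝ} {w : α → ℝ} (hw : ∀ b, w (e b) = w' b) :
    cycSum R' w' = cycSum R w := by
  have h := cycCode_singleton e.injective hR
  have hi : cycFlatMap (fun b => [e b]) '' circuitSet R' = circuitSet R := by
    rw [h.image_eq]
    ext c
    refine ⟨fun hc => hc.1, fun hc => ⟨hc, ?_⟩⟩
    obtain ⟨p, -, -, rfl⟩ := hc
    exact ⟨p.map e.symm, trivial, by simp [flatMap_singleton_eq_map]⟩
  have ht := h.tsum_image w
  rw [hi] at ht
  have hw' : (fun b => (List.map w [e b]).prod) = w' := by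
    funext b
    simp [hw]
  rw [hw'] at ht
  exact ht.symm

end Words

end GoI

namespace GoI

/-! ## Grouping the letters of a word -/

section Grouping

variable {β η : Type}

/-- The word that corresponds to a letter: a run of letters of `β`, or a letter of `η`. -/
def ungroup (Q : List β → Prop) : {p // Q p} ⊕ η → List (β ⊕ η) :=
  Sum.elim (fun p => p.1.map Sum.inl) (fun h => [Sum.inr h])

/-- The relation between runs and letters induced by a relation between letters. -/
def groupRel (R : β ⊕ η → β ⊕ η → Prop) (Q : List β → Prop) (a b : {p // Q p} ⊕ η) : Prop :=
  (a.isLeft ≠ b.isLeft) ∧ ∀ x ∈ (ungroup Q a).getLast?, ∀ y ∈ (ungroup Q b).head?, R x y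

/-- The words that alternate between runs and letters. -/
def SideAlt {A B : Type} (s : List (A ⊕ B)) : Prop := s.IsChain (fun a b => a.isLeft ≠ b.isLeft)

/-- The runs are the words, with constraints on the first and last letters that are implied by the
adjacency with a letter of `η`; two letters of `η` are not adjacent. -/
structure IsRuns (R : β ⊕ η → β ⊕ η → Prop) (Q : List β → Prop) (st en : β → Prop) : Prop where
  iff : ∀ p, Q p ↔ p ≠ [] ∧ p.IsChain (fun a b => R (Sum.inl a) (Sum.inl b)) ∧
    (∀ a ∈ p.head?, st a) ∧ ∀ a ∈ p.getLast?, en a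
  inr_inr : ∀ h h', ¬ R (Sum.inr h) (Sum.inr h')
  start : ∀ h b, R (Sum.inr h) (Sum.inl b) → st b
  finish : ∀ b h, R (Sum.inl b) (Sum.inr h) → en b

/-- A run stops at the first letter of `η`, so it can be read off the word. -/
theorem map_inl_append_inj {p q : List β} {x y : List (β ⊕ η)}
    (hx : ∀ a ∈ x.head?, a.isRight) (hy : ∀ a ∈ y.head?, a.isRight)
    (h : p.map Sum.inl ++ x = q.map Sum.inl ++ y) : p = q ∧ x = y := by
  induction p generalizing q with
  | nil =>
    cases q with
    | nil => exact ⟨rfl, by simpa using h⟩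
    | cons b q =>
      have : x = Sum.inl b :: (q.map Sum.inl ++ y) := by simpa using h
      rw [this] at hx
      simp at hx
  | cons a p ih =>
    cases q with
    | nil =>
      have : y = Sum.inl a :: (p.map Sum.inl ++ x) := by simpa using h.symm
      rw [this] at hy
      simp at hy
    | cons b q =>
      simp only [List.map_cons, List.cons_append, List.cons.injEq, Sum.inl.injEq] at h
      obtain ⟨rfl, h⟩ := h
      obtain ⟨rfl, rfl⟩ := ih h
      exact ⟨rfl, rfl⟩

namespace IsRuns

variable {R : β ⊕ η → β ⊕ η → Prop} {Q : List β → Prop} {st en : β → Prop}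

theorem ungroup_ne_nil (H : IsRuns R Q st en) (a : {p // Q p} ⊕ η) : ungroup Q a ≠ [] := by
  rcases a with p | h
  · simpa [ungroup] using ((H.iff p.1).1 p.2).1
  · simp [ungroup]

theorem head_ungroup (H : IsRuns R Q st en) (a : {p // Q p} ⊕ η) :
    ∃ x l, ungroup Q a = x :: l ∧ x.isLeft = a.isLeft := by
  rcases a with ⟨p, hp⟩ | h
  · have := ((H.iff p).1 hp).1
    cases p with
    | nil => exact absurd rfl this
    | cons b p => exact ⟨Sum.inl b, p.map Sum.inl, rfl, rfl⟩
  · exact ⟨Sum.inr h, [], rfl, rfl⟩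

theorem last_ungroup (H : IsRuns R Q st en) (a : {p // Q p} ⊕ η) :
    ∃ x l, ungroup Q a = l ++ [x] ∧ x.isLeft = a.isLeft := by
  rcases a with ⟨p, hp⟩ | h
  · have := ((H.iff p).1 hp).1
    rcases List.eq_nil_or_concat p with rfl | ⟨l, b, rfl⟩
    · exact absurd rfl this
    · exact ⟨Sum.inl b, l.map Sum.inl, by simp [ungroup], rfl⟩
  · exact ⟨Sum.inr h, [], rfl, rfl⟩

theorem isRight_head (H : IsRuns R Q st en) {s : List ({p // Q p} ⊕ η)} :
    (∀ a ∈ (s.flatMap (ungroup Q)).head?, a.isRight) ↔ ∀ a ∈ s.head?, a.isRight := by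
  cases s with
  | nil => simp
  | cons a s =>
    obtain ⟨x, l, hx, hxa⟩ := H.head_ungroup a
    rw [List.flatMap_cons, hx]
    simp only [List.cons_append, List.head?_cons, Option.mem_def, Option.some.injEq,
      forall_eq']
    rw [← Sum.not_isLeft, ← Sum.not_isLeft, hxa]

theorem isLeft_last (H : IsRuns R Q st en) {s : List ({p // Q p} ⊕ η)} :
    (∀ a ∈ (s.flatMap (ungroup Q)).getLast?, a.isLeft) ↔ ∀ a ∈ s.getLast?, a.isLeft := by
  rcases List.eq_nil_or_concat s with rfl | ⟨s, a, rfl⟩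
  · simp
  · obtain ⟨x, l, hx, hxa⟩ := H.last_ungroup a
    simp [List.flatMap_append, hx, hxa]

theorem inj (H : IsRuns R Q st en) {s t : List ({p // Q p} ⊕ η)} (hs : SideAlt s)
    (ht : SideAlt t) (h : s.flatMap (ungroup Q) = t.flatMap (ungroup Q)) : s = t := by
  -- By alternation a run is followed by a letter of `η` or by nothing.
  have right : ∀ {p : {p // Q p}} {s : List ({p // Q p} ⊕ η)}, SideAlt (Sum.inl p :: s) →
      ∀ a ∈ (s.flatMap (ungroup Q)).head?, a.isRight := by
    intro p s hs
    refine H.isRight_head.2 fun a ha => ?_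
    have := (List.isChain_cons.1 hs).1 a ha
    simpa using this
  induction s generalizing t with
  | nil =>
    cases t with
    | nil => rfl
    | cons b t => exact absurd (by simpa using h.symm) (fun h' => H.ungroup_ne_nil b (And.left h'))
  | cons a s ih =>
    cases t with
    | nil => exact absurd (by simpa using h) (fun h' => H.ungroup_ne_nil a (And.left h'))
    | cons b t =>
      have ih' := @ih t (List.IsChain.tail hs) (List.IsChain.tail ht)
      obtain ⟨x, l, hx, hxa⟩ := H.head_ungroup a
      obtain ⟨y, m, hy, hyb⟩ := H.head_ungroup b
      have hxy : x = y := by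
        rw [List.flatMap_cons, List.flatMap_cons, hx, hy] at h
        exact (List.cons.inj h).1
      rw [List.flatMap_cons, List.flatMap_cons] at h
      rcases a with p | a <;> rcases b with q | b
      · obtain ⟨h1, h2⟩ := map_inl_append_inj (right hs) (right ht) h
        rw [ih' h2, Subtype.ext h1]
      · rw [hxy, hyb] at hxa
        simp at hxa
      · rw [hxy, hyb] at hxa
        simp at hxa
      · simp only [ungroup, Sum.elim_inr, List.cons_append, List.nil_append, List.cons.injEq,
          Sum.inr.injEq] at h
        rw [ih' h.2, h.1]

/-- Induction from the right end of the word. The list `t` is a run still open on its left: whether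
it may start there is decided only when the preceding letter is read. -/
theorem decode_aux (H : IsRuns R Q st en) {x : List (β ⊕ η)} (hx : x.IsChain R)
    (hen : ∀ b, Sum.inl b ∈ x.getLast? → en b) :
    ∃ (t : List β) (s : List ({p // Q p} ⊕ η)), x = t.map Sum.inl ++ s.flatMap (ungroup Q) ∧
      SideAlt s ∧ ∀ a ∈ s.head?, a.isRight := by
  induction x with
  | nil => exact ⟨[], [], by simp, List.isChain_nil, by simp⟩
  | cons a x ih =>
    obtain ⟨t, s, hts, hs, hs'⟩ := ih (List.IsChain.tail hx) (by
      intro b hb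
      refine hen b ?_
      cases x with
      | nil => simp at hb
      | cons c x => simpa using hb)
    rcases a with b | h
    · exact ⟨b :: t, s, by simp [hts], hs, hs'⟩
    refine ⟨[], ?_⟩
    cases t with
    | nil =>
      cases s with
      | nil => exact ⟨[Sum.inr h], by simp [ungroup, hts], by simp [SideAlt], by simp⟩
      | cons c s =>
        rcases c with c | c
        · simp at hs'
        · subst hts
          simp only [List.map_nil, List.nil_append, List.flatMap_cons, ungroup, Sum.elim_inr,
            List.cons_append, List.isChain_cons_cons] at hx
          exact absurd hx.1 (H.inr_inr h c)
    | cons c t =>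
      subst hts
      have hx1 := List.isChain_cons.1 hx
      have hx2 := List.isChain_append.1 hx1.2
      -- The letter `h` closes the open run: its first letter follows `h`, and its last letter
      -- either precedes a letter of `η` or ends the word.
      have hQ : Q (c :: t) := by
        refine (H.iff _).2 ⟨by simp, ?_, ?_, ?_⟩
        · have := hx2.1
          rwa [List.isChain_map] at this
        · intro a ha
          simp only [List.head?_cons, Option.mem_def, Option.some.injEq] at ha
          subst ha
          exact H.start h c (hx1.1 _ (by simp))
        · intro a ha
          cases s with
          | nil =>
            refine hen a ?_
            rw [List.flatMap_nil, List.append_nil, List.map_cons, List.getLast?_cons_cons,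
              ← List.map_cons, List.getLast?_map, Option.mem_def.1 ha]
            rfl
          | cons d s =>
            rcases d with d | d
            · simp at hs'
            · refine H.finish a d (hx2.2.2 _ ?_ _ (by simp [ungroup]))
              rw [List.getLast?_map, Option.mem_def.1 ha]
              rfl
      refine ⟨Sum.inr h :: Sum.inl ⟨c :: t, hQ⟩ :: s, by simp [ungroup], ?_, by simp⟩
      refine List.isChain_cons_cons.2 ⟨by simp, List.isChain_cons.2 ⟨?_, hs⟩⟩
      intro y hy
      have := hs' y hy
      rcases y with y | y <;> simp at this ⊢

theorem decode (H : IsRuns R Q st en) {x : List (β ⊕ η)} (hx : x.IsChain R)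
    (hst : ∀ b, Sum.inl b ∈ x.head? → st b) (hen : ∀ b, Sum.inl b ∈ x.getLast? → en b) :
    ∃ s : List ({p // Q p} ⊕ η), SideAlt s ∧ s.flatMap (ungroup Q) = x := by
  obtain ⟨t, s, rfl, hs, hs'⟩ := H.decode_aux hx hen
  cases t with
  | nil => exact ⟨s, hs, by simp⟩
  | cons c t =>
    have hx2 := List.isChain_append.1 hx
    have hQ : Q (c :: t) := by
      refine (H.iff _).2 ⟨by simp, ?_, ?_, ?_⟩
      · have := hx2.1
        rwa [List.isChain_map] at this
      · intro a ha
        simp only [List.head?_cons, Option.mem_def, Option.some.injEq] at ha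
        subst ha
        exact hst c (by simp)
      · intro a ha
        cases s with
        | nil =>
          refine hen a ?_
          rw [List.flatMap_nil, List.append_nil, List.getLast?_map, Option.mem_def.1 ha]
          rfl
        | cons d s =>
          rcases d with d | d
          · simp at hs'
          · refine H.finish a d (hx2.2.2 _ ?_ _ (by simp [ungroup]))
            rw [List.getLast?_map, Option.mem_def.1 ha]
            rfl
    refine ⟨Sum.inl ⟨c :: t, hQ⟩ :: s, List.isChain_cons.2 ⟨?_, hs⟩, by simp [ungroup]⟩
    intro y hy
    have := hs' y hy
    rcases y with y | y <;> simp at this ⊢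

/-- Inside a run the relation holds because it is a run, so only the junctions carry information. -/
theorem isChain_iff (H : IsRuns R Q st en) {s : List ({p // Q p} ⊕ η)} :
    s.IsChain (groupRel R Q) ↔ SideAlt s ∧ (s.flatMap (ungroup Q)).IsChain R := by
  have h1 : s.IsChain (groupRel R Q) ↔ SideAlt s ∧ s.IsChain (fun a b =>
      ∀ x ∈ (ungroup Q a).getLast?, ∀ y ∈ (ungroup Q b).head?, R x y) := by
    constructor
    · exact fun h => ⟨h.imp fun _ _ h => h.1, h.imp fun _ _ h => h.2⟩
    · rintro ⟨h, h'⟩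
      induction s with
      | nil => exact List.isChain_nil
      | cons a s ih =>
        refine List.isChain_cons.2 ⟨fun y hy => ⟨(List.isChain_cons.1 h).1 y hy,
          (List.isChain_cons.1 h').1 y hy⟩, ih (List.IsChain.tail h) (List.IsChain.tail h')⟩
  rw [h1, List.flatMap_def, List.isChain_flatten, List.isChain_map]
  · refine and_congr_right fun _ => ⟨fun h => ⟨?_, h⟩, fun h => h.2⟩
    intro l hl
    obtain ⟨a, -, rfl⟩ := List.mem_map.1 hl
    rcases a with ⟨p, hp⟩ | a
    · refine (List.isChain_map (l := p) Sum.inl).2 ((H.iff p).1 hp).2.1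
    · simp [ungroup]
  · intro h
    obtain ⟨a, -, ha⟩ := List.mem_map.1 h
    exact H.ungroup_ne_nil a ha

/-- Code words start with a letter of `η` and end with a run. Such words can be concatenated, and
every closed word has a rotation of this form. -/
theorem cycCode (H : IsRuns R Q st en) : CycCode (groupRel R Q) R (ungroup Q)
    (fun s => SideAlt s ∧ (∀ a ∈ s.head?, a.isRight) ∧ ∀ a ∈ s.getLast?, a.isLeft) := by
  have happ : ∀ {s t : List ({p // Q p} ⊕ η)},
      (SideAlt s ∧ (∀ a ∈ s.head?, a.isRight) ∧ ∀ a ∈ s.getLast?, a.isLeft) →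
      (SideAlt t ∧ (∀ a ∈ t.head?, a.isRight) ∧ ∀ a ∈ t.getLast?, a.isLeft) →
      (SideAlt (s ++ t) ∧ (∀ a ∈ (s ++ t).head?, a.isRight) ∧
        ∀ a ∈ (s ++ t).getLast?, a.isLeft) := by
    rintro s t ⟨hs, hs1, hs2⟩ ⟨ht, ht1, ht2⟩
    refine ⟨List.isChain_append.2 ⟨hs, ht, ?_⟩, ?_, ?_⟩
    · intro a ha b hb
      have h1 := hs2 a ha
      have h2 := ht1 b hb
      rw [← Sum.not_isLeft] at h2
      rw [h1]
      intro h
      rw [← h] at h2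
      simp at h2
    · rcases eq_or_ne s [] with rfl | h
      · simpa using ht1
      · rwa [List.head?_append_of_ne_nil _ h]
    · rcases eq_or_ne t [] with rfl | h
      · simpa using hs2
      · rwa [List.getLast?_append_of_ne_nil _ h]
  refine ⟨happ, fun hs ht h => H.inj hs.1 ht.1 h, ⟨List.isChain_nil, by simp, by simp⟩,
    H.ungroup_ne_nil, ?_, ?_, ?_⟩
  · intro w w' x y hw hw' hx hy hc hx0 hy0
    have hxh : ∀ a ∈ x.head?, a.isRight := by
      have := H.isRight_head.2 hw.2.1
      rwa [hx, List.head?_append_of_ne_nil _ hx0] at this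
    have hyh : ∀ a ∈ y.head?, a.isRight := by
      have := H.isRight_head.2 hw'.2.1
      rwa [hy, List.head?_append_of_ne_nil _ hy0] at this
    have hxc := List.isChain_append.1 hc.isChain
    obtain ⟨c, y, rfl⟩ := List.exists_cons_of_ne_nil hy0
    rcases c with c | c
    · simp at hyh
    -- The word `x` is followed by a letter of `η`, and two of these are never adjacent.
    have hxl : ∀ a ∈ x.getLast?, a.isLeft := by
      intro a ha
      rcases a with a | a
      · rfl
      · exact absurd (hxc.2.2 _ ha (Sum.inr c) (by simp)) (H.inr_inr _ _)
    obtain ⟨s, hs, rfl⟩ := H.decode hxc.1 (fun b hb => by simpa using hxh _ hb)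
      (fun b hb => H.finish b c (hxc.2.2 _ hb _ (by simp)))
    exact ⟨s, ⟨hs, H.isRight_head.1 hxh, H.isLeft_last.1 hxl⟩, rfl⟩
  · intro s hs
    unfold CycChain
    rw [← List.flatMap_append, H.isChain_iff]
    exact and_iff_right (happ hs hs).1
  · intro p hp hp0
    -- A run cannot follow a run, so a closed word contains some letter of `η`.
    obtain ⟨h, hh⟩ : ∃ h : η, Sum.inr h ∈ p := by
      obtain ⟨a, p, rfl⟩ := List.exists_cons_of_ne_nil hp0
      rcases a with a | a
      · obtain ⟨⟨b, hb, hab⟩, -⟩ := hp.exists_rel List.mem_cons_self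
        rcases b with b | b
        · exact absurd rfl hab.1
        · exact ⟨b, hb⟩
      · exact ⟨a, by simp⟩
    obtain ⟨u, v, rfl⟩ := List.append_of_mem hh
    refine ⟨Sum.inr h :: v ++ u, List.isRotated_append, ?_, by simp, ?_⟩
    · exact hp.swap.isChain.imp fun _ _ h => h.1
    · intro a ha
      have := (List.isChain_append.1 hp.swap).2.2 a ha (Sum.inr h) (by simp)
      rcases a with a | a
      · rfl
      · exact absurd rfl this.1

/-- A circuit either has no letter of `η`, or can be rotated to start with one and then be grouped
into runs. -/
theorem cycSum_eq (H : IsRuns R Q st en) (w : β ⊕ η → ℝ) :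
    cycSum R w = cycSum (fun a b => R (Sum.inl a) (Sum.inl b)) (fun a => w (Sum.inl a)) +
      cycSum (groupRel R Q) (fun a => ((ungroup Q a).map w).prod) := by
  have h1 : CycCode (fun a b => R (Sum.inl a) (Sum.inl b)) R (fun b => [Sum.inl b])
      (fun _ => True) := cycCode_singleton Sum.inl_injective fun _ _ => Iff.rfl
  have h2 := H.cycCode
  have ht1 := h1.tsum_image w
  have ht2 := h2.tsum_image w
  simp only [List.map_cons, List.map_nil, List.prod_cons, List.prod_nil, mul_one] at ht1
  rw [← ht1, ← ht2, ← ENNReal.summable.tsum_union_disjoint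
    (f := fun c => WGraph.cost (cycWeight w c)) _ ENNReal.summable]
  · suffices hset : circuitSet R = (cycFlatMap (fun b => [Sum.inl b]) ''
        circuitSet fun a b => R (Sum.inl a) (Sum.inl b)) ∪
        cycFlatMap (ungroup Q) '' circuitSet (groupRel R Q) by
      rw [← hset]
      rfl
    rw [h1.image_eq, h2.image_eq]
    ext c
    constructor
    · intro hc
      obtain ⟨p, hp, hp', rfl⟩ := id hc
      by_cases hr : ∃ h : η, Sum.inr h ∈ p
      · right
        refine ⟨hc, ?_⟩
        obtain ⟨h, hh⟩ := hr
        obtain ⟨u, v, rfl⟩ := List.append_of_mem hh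
        have hq := hp.swap
        have hlast : ∀ a ∈ (Sum.inr h :: v ++ u).getLast?, R a (Sum.inr h) := fun a ha =>
          (List.isChain_append.1 hq).2.2 a ha (Sum.inr h) (by simp)
        obtain ⟨s, hs, hsx⟩ := H.decode hq.isChain (by simp) fun b hb => H.finish b h (hlast _ hb)
        refine ⟨s, ⟨hs, ?_, ?_⟩, ?_⟩
        · rw [← H.isRight_head, hsx]
          simp
        · rw [← H.isLeft_last, hsx]
          intro a ha
          rcases a with a | a
          · rfl
          · exact absurd (hlast _ ha) (H.inr_inr _ _)
        · rw [hsx, Cycle.coe_eq_coe]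
          exact List.isRotated_append
      · left
        refine ⟨hc, ?_⟩
        push Not at hr
        have : ∀ p : List (β ⊕ η), (∀ h, Sum.inr h ∉ p) → ∃ s : List β, s.map Sum.inl = p := by
          intro p
          induction p with
          | nil => exact fun _ => ⟨[], rfl⟩
          | cons a p ih =>
            intro h
            obtain ⟨s, rfl⟩ := ih fun b hb => h b (by simp [hb])
            rcases a with a | a
            · exact ⟨a :: s, rfl⟩
            · exact absurd (by simp) (h a)
        obtain ⟨s, rfl⟩ := this p hr
        exact ⟨s, trivial, by rw [flatMap_singleton_eq_map]⟩
    · rintro (hc | hc)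
      · exact hc.1
      · exact hc.1
  · rw [h1.image_eq, h2.image_eq, Set.disjoint_left]
    rintro c ⟨hc, s, -, rfl⟩ ⟨hc', t, ⟨-, ht, -⟩, hts⟩
    rw [Cycle.coe_eq_coe] at hts
    have ht0 : t.flatMap (ungroup Q) ≠ [] := by
      intro h0
      rw [h0] at hts
      exact (coe_mem_circuitSet.1 hc).2.ne_nil (by simpa using hts.symm)
    obtain ⟨a, l, hal⟩ := List.exists_cons_of_ne_nil ht0
    have ha := H.isRight_head.2 ht a (by rw [hal]; simp)
    have ha' : a ∈ s.flatMap fun b => [(Sum.inl b : β ⊕ η)] := hts.mem_iff.1 (by rw [hal]; simp)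
    rw [flatMap_singleton_eq_map, List.mem_map] at ha'
    obtain ⟨b, -, rfl⟩ := ha'
    simp at ha

end IsRuns

end Grouping

end GoI

namespace GoI

/-! ## Coloured graphs -/

namespace WGraph

variable {V W κ κ' : Type}

/-- Adjacency of edges of different colours. -/
def adj (K : WGraph V) (c : K.E → κ) (a b : K.E) : Prop := K.src b = K.tgt a ∧ c a ≠ c b

/-- The colour of an edge of a union. -/
def color (G H : WGraph V) (a : G.E ⊕ H.E) : Bool := a.isLeft

section

variable [DecidableEq V] {G H : WGraph V}

theorem isAltPath_iff {p : List (G.union H).E} :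
    G.IsAltPath H p ↔ p ≠ [] ∧ p.IsChain ((G.union H).adj (color G H)) := by
  constructor
  · rintro ⟨⟨h0, h1⟩, h2⟩
    refine ⟨h0, ?_⟩
    clear h0
    induction p with
    | nil => exact List.isChain_nil
    | cons a p ih =>
      have h1' := List.isChain_cons.1 h1
      have h2' := List.isChain_cons.1 h2
      exact List.isChain_cons.2 ⟨fun y hy => ⟨h1'.1 y hy, h2'.1 y hy⟩, ih h2'.2 h1'.2⟩
  · rintro ⟨h0, h⟩
    exact ⟨⟨h0, h.imp fun _ _ h => h.1⟩, h.imp fun _ _ h => h.2⟩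

theorem cycChain_iff {p : List (G.union H).E} (h0 : p ≠ []) :
    CycChain ((G.union H).adj (color G H)) p ↔ G.IsAltPath H p ∧
      (G.union H).src (p.head h0) = (G.union H).tgt (p.getLast h0) ∧
      color G H (p.getLast h0) ≠ color G H (p.head h0) := by
  unfold CycChain
  rw [List.isChain_append, isAltPath_iff, List.head?_eq_some_head h0,
    List.getLast?_eq_some_getLast h0]
  simp only [Option.mem_def, Option.some.injEq, forall_eq']
  unfold adj
  tauto

/-- The definition of a 1-cycle tests powers of cycles, primitivity tests powers of arbitrary words.
The two agree because r r is a factor of rⁿ for n ≥ 2, which makes a root of a closed word closed.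
-/
theorem isAltOneCycle_iff {p : List (G.union H).E} :
    G.IsAltOneCycle H p ↔ CycChain ((G.union H).adj (color G H)) p ∧ IsPrimitive p := by
  constructor
  · rintro ⟨ha, ⟨⟨hp, hne, hc⟩, hk⟩, h', hcol⟩
    have hcyc := (cycChain_iff hne).2 ⟨ha, hc, hcol⟩
    refine ⟨hcyc, fun n r hr => ?_⟩
    by_contra hn
    obtain ⟨m, rfl⟩ : ∃ m, n = m + 1 + 1 := ⟨n - 2, by omega⟩
    have hr0 : r ≠ [] := by
      rintro rfl
      exact hne (by rw [← hr]; simp)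
    have hrr : CycChain ((G.union H).adj (color G H)) r := by
      refine hcyc.isChain.infix ⟨[], (List.replicate m r).flatten, ?_⟩
      rw [← hr, List.replicate_succ, List.replicate_succ]
      simp
    have h := (cycChain_iff hr0).1 hrr
    have := hk.2 ⟨r, ⟨h.1.1, hr0, h.2.1⟩, hr⟩
    omega
  · rintro ⟨hc, hp⟩
    have h := (cycChain_iff hp.ne_nil).1 hc
    have hcyc : (G.union H).IsCycle p := ⟨h.1.1, hp.ne_nil, h.2.1⟩
    exact ⟨h.1, ⟨hcyc, ⟨p, hcyc, by simp⟩, fun n ⟨r, _, hr⟩ => hp n r hr⟩, hp.ne_nil, h.2.2⟩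

theorem interaction_eq_cycSum (G H : WGraph V) :
    G.interaction H = cycSum ((G.union H).adj (color G H)) (G.union H).weight := by
  have : G.circuits H = circuitSet ((G.union H).adj (color G H)) := by
    ext c
    simp only [circuits, circuitSet, isAltOneCycle_iff, Set.mem_ofPred_eq, and_assoc]
  unfold interaction cycSum
  rw [this]
  rfl

end

/-- The reduction of a coloured graph to a set of vertices. -/
def reduct (K : WGraph V) (c : K.E → κ) (S : Finset V) : WGraph V where
  verts := S
  E := {p : List K.E // (p ≠ [] ∧ p.IsChain (K.adj c)) ∧ ∃ h : p ≠ [],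
    K.src (p.head h) ∈ S ∧ K.tgt (p.getLast h) ∈ S}
  countable := by
    have := K.countable
    infer_instance
  src := fun p => K.src (p.1.head p.2.2.1)
  tgt := fun p => K.tgt (p.1.getLast p.2.2.1)
  weight := fun p => K.pathWeight p.1
  src_mem := fun p => p.2.2.2.1
  tgt_mem := fun p => p.2.2.2.2
  weight_pos := fun p => K.pathWeight_pos p.1
  weight_le := fun p => K.pathWeight_le p.1

theorem plug_iso_reduct [DecidableEq V] (G H : WGraph V) :
    (G.plug H).Iso ((G.union H).reduct (color G H) (symmDiff G.verts H.verts)) :=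
  ⟨rfl, Equiv.subtypeEquivRight fun _ => and_congr_left' isAltPath_iff,
    fun _ => ⟨rfl, rfl, rfl⟩⟩

theorem deloc_id [DecidableEq V] (G : WGraph V) : (G.deloc id).Iso G :=
  ⟨Finset.image_id, Equiv.refl _, fun _ => ⟨rfl, rfl, rfl⟩⟩

/-- An isomorphism of coloured graphs over an injective map of vertices. -/
structure ColorIso (θ : V → W) (K : WGraph V) (c : K.E → κ) (K' : WGraph W) (c' : K'.E → κ')
    where
  e : K.E ≃ K'.E
  inj : Set.InjOn θ K.verts
  src : ∀ x, K'.src (e x) = θ (K.src x)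
  tgt : ∀ x, K'.tgt (e x) = θ (K.tgt x)
  weight : ∀ x, K'.weight (e x) = K.weight x
  -- Only the partition into colours matters, so the two sets of colours may differ.
  color : ∀ x y, c' (e x) = c' (e y) ↔ c x = c y

namespace ColorIso

variable {θ : V → W} {K : WGraph V} {c : K.E → κ} {K' : WGraph W} {c' : K'.E → κ'}

theorem adj_iff (φ : ColorIso θ K c K' c') (a b : K.E) :
    K.adj c a b ↔ K'.adj c' (φ.e a) (φ.e b) := by
  unfold adj
  rw [φ.src, φ.tgt, φ.inj.eq_iff (K.src_mem b) (K.tgt_mem a), ne_eq, ne_eq, φ.color]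

theorem cycSum_eq (φ : ColorIso θ K c K' c') :
    cycSum (K.adj c) K.weight = cycSum (K'.adj c') K'.weight :=
  cycSum_equiv φ.e φ.adj_iff φ.weight

theorem reduct_iso [DecidableEq W] (φ : ColorIso θ K c K' c') {S : Finset V} {S' : Finset W}
    (hS : S ⊆ K.verts) (hS' : S.image θ = S') :
    ((K.reduct c S).deloc θ).Iso (K'.reduct c' S') := by
  have hmem : ∀ x ∈ K.verts, θ x ∈ S' ↔ x ∈ S := by
    intro x hx
    rw [← hS', Finset.mem_image]
    constructor
    · rintro ⟨y, hy, hxy⟩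
      rwa [← φ.inj (hS hy) hx hxy]
    · exact fun h => ⟨x, h, rfl⟩
  have key : ∀ p : List K.E,
      ((p ≠ [] ∧ p.IsChain (K.adj c)) ∧ ∃ h : p ≠ [],
        K.src (p.head h) ∈ S ∧ K.tgt (p.getLast h) ∈ S) ↔
      ((p.map φ.e ≠ [] ∧ (p.map φ.e).IsChain (K'.adj c')) ∧ ∃ h : p.map φ.e ≠ [],
        K'.src ((p.map φ.e).head h) ∈ S' ∧ K'.tgt ((p.map φ.e).getLast h) ∈ S') := by
    intro p
    have h1 : p.map φ.e ≠ [] ↔ p ≠ [] := by simp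
    have h2 : (p.map φ.e).IsChain (K'.adj c') ↔ p.IsChain (K.adj c) := by
      rw [List.isChain_map, show K.adj c = fun a b => K'.adj c' (φ.e a) (φ.e b) from
        funext₂ fun a b => propext (φ.adj_iff a b)]
    refine and_congr (and_congr h1.symm h2.symm) ?_
    constructor
    · rintro ⟨h, hs, ht⟩
      refine ⟨h1.2 h, ?_, ?_⟩
      · rwa [List.head_map, φ.src, hmem _ (K.src_mem _)]
      · rwa [List.getLast_map, φ.tgt, hmem _ (K.tgt_mem _)]
    · rintro ⟨h, hs, ht⟩
      refine ⟨h1.1 h, ?_, ?_⟩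
      · rwa [List.head_map, φ.src, hmem _ (K.src_mem _)] at hs
      · rwa [List.getLast_map, φ.tgt, hmem _ (K.tgt_mem _)] at ht
  refine ⟨hS', (Equiv.listEquivOfEquiv φ.e).subtypeEquiv key, ?_⟩
  rintro ⟨p, hp, h0, hs, ht⟩
  refine ⟨?_, ?_, ?_⟩
  · exact (congrArg K'.src (List.head_map (f := φ.e) (w := by simpa using h0))).trans (φ.src _)
  · exact (congrArg K'.tgt (List.getLast_map (f := φ.e) (h := by simpa using h0))).trans (φ.tgt _)
  · change K'.pathWeight (p.map φ.e) = K.pathWeight p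
    simp [pathWeight, Function.comp_def, φ.weight]

end ColorIso

section Plug

variable [DecidableEq V] [DecidableEq W]

/-- The symmetry of the union. -/
def unionComm (G H : WGraph V) :
    ColorIso id (G.union H) (color G H) (H.union G) (color H G) where
  e := Equiv.sumComm G.E H.E
  inj := Function.injective_id.injOn
  src := by rintro (x | x) <;> rfl
  tgt := by rintro (x | x) <;> rfl
  weight := by rintro (x | x) <;> rfl
  color := by rintro (x | x) (y | y) <;> simp [WGraph.color]

theorem symmDiff_subset_union (S T : Finset V) : symmDiff S T ⊆ S ∪ T := by
  intro x hx
  rw [Finset.mem_symmDiff] at hx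
  rw [Finset.mem_union]
  tauto

theorem interaction_comm (G H : WGraph V) : G.interaction H = H.interaction G := by
  rw [interaction_eq_cycSum, interaction_eq_cycSum, (unionComm G H).cycSum_eq]

theorem plug_comm (G H : WGraph V) : (G.plug H).Iso (H.plug G) := by
  refine (plug_iso_reduct G H).trans (Iso.trans ?_ (plug_iso_reduct H G).symm)
  refine (deloc_id _).symm.trans ((unionComm G H).reduct_iso (symmDiff_subset_union _ _) ?_)
  rw [Finset.image_id, symmDiff_comm]

/-- The delocation of a union. -/
def unionDeloc (θ : V → W) (G H : WGraph V) (hθ : Set.InjOn θ (G.verts ∪ H.verts : Finset V)) :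
    ColorIso θ (G.union H) (color G H) ((G.deloc θ).union (H.deloc θ))
      (color (G.deloc θ) (H.deloc θ)) where
  e := Equiv.refl _
  inj := hθ
  src := by rintro (x | x) <;> rfl
  tgt := by rintro (x | x) <;> rfl
  weight := by rintro (x | x) <;> rfl
  color := by rintro (x | x) (y | y) <;> exact Iff.rfl

theorem image_symmDiff {θ : V → W} {S T : Finset V} (hθ : Set.InjOn θ (S ∪ T : Finset V)) :
    (symmDiff S T).image θ = symmDiff (S.image θ) (T.image θ) := by
  ext w
  simp only [Finset.mem_image, Finset.mem_symmDiff]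
  have hi : ∀ x y, x ∈ S ∪ T → y ∈ S ∪ T → θ x = θ y → x = y := fun x y hx hy h => hθ hx hy h
  constructor
  · rintro ⟨v, (⟨h, h'⟩ | ⟨h, h'⟩), rfl⟩
    · refine Or.inl ⟨⟨v, h, rfl⟩, ?_⟩
      rintro ⟨u, hu, huv⟩
      exact h' (hi u v (by simp [hu]) (by simp [h]) huv ▸ hu)
    · refine Or.inr ⟨⟨v, h, rfl⟩, ?_⟩
      rintro ⟨u, hu, huv⟩
      exact h' (hi u v (by simp [hu]) (by simp [h]) huv ▸ hu)
  · rintro (⟨⟨v, hv, rfl⟩, h⟩ | ⟨⟨v, hv, rfl⟩, h⟩)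
    · exact ⟨v, Or.inl ⟨hv, fun h' => h ⟨v, h', rfl⟩⟩, rfl⟩
    · exact ⟨v, Or.inr ⟨hv, fun h' => h ⟨v, h', rfl⟩⟩, rfl⟩

theorem interaction_deloc {θ : V → W} {G H : WGraph V}
    (hθ : Set.InjOn θ (G.verts ∪ H.verts : Finset V)) :
    (G.deloc θ).interaction (H.deloc θ) = G.interaction H := by
  rw [interaction_eq_cycSum, interaction_eq_cycSum, (unionDeloc θ G H hθ).cycSum_eq]

theorem plug_deloc {θ : V → W} {G H : WGraph V}
    (hθ : Set.InjOn θ (G.verts ∪ H.verts : Finset V)) :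
    ((G.plug H).deloc θ).Iso ((G.deloc θ).plug (H.deloc θ)) :=
  ((plug_iso_reduct G H).deloc θ).trans (((unionDeloc θ G H hθ).reduct_iso
    (symmDiff_subset_union _ _) (image_symmDiff hθ)).trans (plug_iso_reduct _ _).symm)

/-! ### Associativity -/

/-- The colours of a union of three graphs. -/
def color₃ (F G H : WGraph V) : (F.E ⊕ G.E) ⊕ H.E → Fin 3 :=
  Sum.elim (Sum.elim (fun _ => 0) (fun _ => 1)) (fun _ => 2)

/-- No vertex belongs to three graphs. -/
def Tri (S T U : Finset V) : Prop := ∀ v, v ∈ S → v ∈ T → v ∉ U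

variable {F G H : WGraph V}

/-- This is where `Tri` enters: an end of an edge of F ∪ G that is also a vertex of H lies in only
one of F and G, so a run may start or stop there. -/
theorem isRuns (hT : Tri F.verts G.verts H.verts) :
    IsRuns (((F.union G).union H).adj (color₃ F G H))
      (fun p : List (F.union G).E => F.IsAltPath G p ∧ ∃ h : p ≠ [],
        (F.union G).src (p.head h) ∈ symmDiff F.verts G.verts ∧
        (F.union G).tgt (p.getLast h) ∈ symmDiff F.verts G.verts)
      (fun b => (F.union G).src b ∈ symmDiff F.verts G.verts)
      (fun b => (F.union G).tgt b ∈ symmDiff F.verts G.verts) where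
  iff := by
    intro p
    have hadj : (fun a b => ((F.union G).union H).adj (color₃ F G H) (Sum.inl a) (Sum.inl b)) =
        (F.union G).adj (color F G) := by
      funext a b
      refine propext (and_congr Iff.rfl ?_)
      rcases a with a | a <;> rcases b with b | b <;> simp [color₃, color]
    rw [hadj, isAltPath_iff]
    constructor
    · rintro ⟨⟨h0, hp⟩, h', hs, ht⟩
      refine ⟨h0, hp, ?_, ?_⟩
      · rw [List.head?_eq_some_head h0]
        rintro a ⟨⟩
        exact hs
      · rw [List.getLast?_eq_some_getLast h0]
        rintro a ⟨⟩
        exact ht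
    · rintro ⟨h0, hp, hs, ht⟩
      exact ⟨⟨h0, hp⟩, h0, hs _ (List.head?_eq_some_head h0),
        ht _ (List.getLast?_eq_some_getLast h0)⟩
  inr_inr := fun h h' hh => hh.2 rfl
  start := by
    rintro h b ⟨hb, -⟩
    have h1 : (F.union G).src b ∈ H.verts := by
      have : (F.union G).src b = H.tgt h := hb
      rw [this]
      exact H.tgt_mem h
    have h2 : (F.union G).src b ∈ F.verts ∪ G.verts := (F.union G).src_mem b
    have := hT ((F.union G).src b)
    rw [Finset.mem_union] at h2
    rw [Finset.mem_symmDiff]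
    tauto
  finish := by
    rintro b h ⟨hb, -⟩
    have h1 : (F.union G).tgt b ∈ H.verts := by
      have : H.src h = (F.union G).tgt b := hb
      rw [← this]
      exact H.src_mem h
    have h2 : (F.union G).tgt b ∈ F.verts ∪ G.verts := (F.union G).tgt_mem b
    have := hT ((F.union G).tgt b)
    rw [Finset.mem_union] at h2
    rw [Finset.mem_symmDiff]
    tauto

/-- The paths that a letter of the alphabet of `(F ∷ G) ∪ H` stands for. -/
abbrev plugLetter (F G H : WGraph V) (a : ((F.plug G).union H).E) :
    List ((F.union G).union H).E :=
  ungroup (fun p : List (F.union G).E => F.IsAltPath G p ∧ ∃ h : p ≠ [],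
        (F.union G).src (p.head h) ∈ symmDiff F.verts G.verts ∧
        (F.union G).tgt (p.getLast h) ∈ symmDiff F.verts G.verts) (η := H.E) a

theorem plugLetter_head (a : ((F.plug G).union H).E) : ∃ x l, plugLetter F G H a = x :: l ∧
    ((F.union G).union H).src x = ((F.plug G).union H).src a ∧
    color (F.union G) H x = color (F.plug G) H a := by
  rcases a with ⟨p, hp, h0, hp'⟩ | h
  · cases p with
    | nil => exact absurd rfl h0
    | cons b p => exact ⟨Sum.inl b, p.map Sum.inl, rfl, rfl, rfl⟩
  · exact ⟨Sum.inr h, [], rfl, rfl, rfl⟩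

theorem plugLetter_last (a : ((F.plug G).union H).E) : ∃ x l, plugLetter F G H a = l ++ [x] ∧
    ((F.union G).union H).tgt x = ((F.plug G).union H).tgt a ∧
    color (F.union G) H x = color (F.plug G) H a := by
  rcases a with ⟨p, hp, h0, hp'⟩ | h
  · rcases List.eq_nil_or_concat p with rfl | ⟨l, b, rfl⟩
    · exact absurd rfl h0
    · refine ⟨Sum.inl b, l.map Sum.inl, by simp [plugLetter, ungroup], ?_, rfl⟩
      change (F.union G).tgt b = (F.union G).tgt ((l.concat b).getLast _)
      simp
  · exact ⟨Sum.inr h, [], rfl, rfl, rfl⟩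

theorem plugLetter_weight (a : ((F.plug G).union H).E) :
    ((plugLetter F G H a).map ((F.union G).union H).weight).prod =
      ((F.plug G).union H).weight a := by
  rcases a with p | h
  · change ((p.1.map Sum.inl).map ((F.union G).union H).weight).prod = (F.union G).pathWeight p.1
    rw [List.map_map]
    rfl
  · simp [plugLetter, ungroup]

theorem color₃_ne {x y : ((F.union G).union H).E}
    (h : color (F.union G) H x ≠ color (F.union G) H y) :
    color₃ F G H x ≠ color₃ F G H y := by
  rcases x with (x | x) | x <;> rcases y with (y | y) | y <;> simp [color₃, color] at h ⊢

/-- Alternation of runs and letters is alternation between F∷G and H; edges separated by these two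
colours are also separated by the three. -/
theorem groupRel_plug : groupRel (((F.union G).union H).adj (color₃ F G H))
      (fun p : List (F.union G).E => F.IsAltPath G p ∧ ∃ h : p ≠ [],
        (F.union G).src (p.head h) ∈ symmDiff F.verts G.verts ∧
        (F.union G).tgt (p.getLast h) ∈ symmDiff F.verts G.verts) =
    ((F.plug G).union H).adj (color (F.plug G) H) := by
  funext a b
  obtain ⟨x, l, hx, hx1, hx2⟩ := plugLetter_last a
  obtain ⟨y, m, hy, hy1, hy2⟩ := plugLetter_head b
  refine propext ?_
  unfold groupRel
  change (color (F.plug G) H a ≠ color (F.plug G) H b ∧ ∀ x ∈ (plugLetter F G H a).getLast?,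
    ∀ y ∈ (plugLetter F G H b).head?, _) ↔ _
  rw [hx, hy]
  simp only [List.getLast?_append, List.getLast?_singleton, Option.some_or, Option.mem_def,
    Option.some.injEq, List.head?_cons, forall_eq']
  constructor
  · rintro ⟨h1, h2, -⟩
    exact ⟨by rw [← hx1, ← hy1]; exact h2, h1⟩
  · rintro ⟨h1, h2⟩
    refine ⟨h2, by rw [hx1, hy1]; exact h1, color₃_ne ?_⟩
    rw [hx2, hy2]
    exact h2

/-- The three-coloured circuits that avoid H are those between F and G; the others, once grouped,
are those between F∷G and H. -/
theorem interaction_add (hT : Tri F.verts G.verts H.verts) :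
    F.interaction G + (F.plug G).interaction H =
      cycSum (((F.union G).union H).adj (color₃ F G H)) ((F.union G).union H).weight := by
  rw [(isRuns hT).cycSum_eq, groupRel_plug, interaction_eq_cycSum, interaction_eq_cycSum]
  congr 2
  · funext a b
    refine propext (and_congr Iff.rfl ?_)
    rcases a with a | a <;> rcases b with b | b <;> simp [color₃, color]
  · funext a
    exact (plugLetter_weight a).symm

theorem src_head_flatMap {s : List ((F.plug G).union H).E} (h : s ≠ [])
    (h' : s.flatMap (plugLetter F G H) ≠ []) :
    ((F.union G).union H).src ((s.flatMap (plugLetter F G H)).head h') =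
      ((F.plug G).union H).src (s.head h) := by
  obtain ⟨a, s, rfl⟩ := List.exists_cons_of_ne_nil h
  obtain ⟨x, l, hx, hx1, -⟩ := plugLetter_head a
  simpa [List.flatMap_cons, hx] using hx1

theorem tgt_getLast_flatMap {s : List ((F.plug G).union H).E} (h : s ≠ [])
    (h' : s.flatMap (plugLetter F G H) ≠ []) :
    ((F.union G).union H).tgt ((s.flatMap (plugLetter F G H)).getLast h') =
      ((F.plug G).union H).tgt (s.getLast h) := by
  rcases List.eq_nil_or_concat s with rfl | ⟨s, a, rfl⟩
  · exact absurd rfl h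
  obtain ⟨x, l, hx, hx1, -⟩ := plugLetter_last a
  simpa [List.flatMap_append, hx] using hx1

theorem pathWeight_flatMap (s : List ((F.plug G).union H).E) :
    ((F.union G).union H).pathWeight (s.flatMap (plugLetter F G H)) =
      ((F.plug G).union H).pathWeight s := by
  unfold pathWeight
  induction s with
  | nil => simp
  | cons a s ih => rw [List.flatMap_cons, List.map_append, List.prod_append, ih,
      plugLetter_weight, List.map_cons, List.prod_cons]

/-- The same grouping for paths, where the two ends of the path need separate attention. -/
theorem plug_plug_iso (hT : Tri F.verts G.verts H.verts) :
    ((F.plug G).plug H).Iso (((F.union G).union H).reduct (color₃ F G H)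
      (symmDiff (symmDiff F.verts G.verts) H.verts)) := by
  have hR := isRuns hT
  have hchain : ∀ {s : List ((F.plug G).union H).E},
      s.IsChain (((F.plug G).union H).adj (color (F.plug G) H)) ↔ SideAlt s ∧
        (s.flatMap (plugLetter F G H)).IsChain (((F.union G).union H).adj (color₃ F G H)) := by
    intro s
    rw [← groupRel_plug]
    exact hR.isChain_iff
  have hne : ∀ {s : List ((F.plug G).union H).E}, s ≠ [] → s.flatMap (plugLetter F G H) ≠ [] := by
    intro s hs
    obtain ⟨a, s, rfl⟩ := List.exists_cons_of_ne_nil hs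
    obtain ⟨x, l, hx, -⟩ := plugLetter_head a
    simp [List.flatMap_cons, hx]
  let f : ((F.plug G).plug H).E → (((F.union G).union H).reduct (color₃ F G H)
      (symmDiff (symmDiff F.verts G.verts) H.verts)).E := fun s =>
    ⟨s.1.flatMap (plugLetter F G H), ⟨hne s.2.2.1, (hchain.1 (isAltPath_iff.1 s.2.1).2).2⟩,
      hne s.2.2.1, by rw [src_head_flatMap s.2.2.1]; exact s.2.2.2.1,
      by rw [tgt_getLast_flatMap s.2.2.1]; exact s.2.2.2.2⟩
  have hf : Function.Bijective f := by
    constructor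
    · intro s t hst
      refine Subtype.ext (hR.inj (hchain.1 (isAltPath_iff.1 s.2.1).2).1
        (hchain.1 (isAltPath_iff.1 t.2.1).2).1 (congrArg Subtype.val hst))
    · rintro ⟨p, ⟨h0, hp⟩, -, hs, ht⟩
      -- An end in F ∪ G that survives in the triple symmetric difference lies in F ∆ G; otherwise
      -- it would be a vertex of all three graphs.
      obtain ⟨s, hsa, hsp⟩ := hR.decode hp
        (by
          intro b hb
          have hb' : p.head h0 = Sum.inl b := by
            rw [List.head?_eq_some_head h0] at hb
            exact Option.some.inj hb
          rw [hb'] at hs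
          have h2 : (F.union G).src b ∈ F.verts ∪ G.verts := (F.union G).src_mem b
          have h1 : (F.union G).src b ∈ symmDiff (symmDiff F.verts G.verts) H.verts := hs
          have := hT ((F.union G).src b)
          simp only [Finset.mem_symmDiff, Finset.mem_union] at h1 h2 ⊢
          tauto)
        (by
          intro b hb
          have hb' : p.getLast h0 = Sum.inl b := by
            rw [List.getLast?_eq_some_getLast h0] at hb
            exact Option.some.inj hb
          rw [hb'] at ht
          have h2 : (F.union G).tgt b ∈ F.verts ∪ G.verts := (F.union G).tgt_mem b
          have h1 : (F.union G).tgt b ∈ symmDiff (symmDiff F.verts G.verts) H.verts := ht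
          have := hT ((F.union G).tgt b)
          simp only [Finset.mem_symmDiff, Finset.mem_union] at h1 h2 ⊢
          tauto)
      have hs0 : s ≠ [] := by
        rintro rfl
        exact h0 hsp.symm
      subst hsp
      refine ⟨⟨s, isAltPath_iff.2 ⟨hs0, hchain.2 ⟨hsa, hp⟩⟩, hs0, ?_, ?_⟩, rfl⟩
      · rw [src_head_flatMap hs0] at hs
        exact hs
      · rw [tgt_getLast_flatMap hs0] at ht
        exact ht
  refine ⟨rfl, Equiv.ofBijective f hf, fun s => ⟨?_, ?_, ?_⟩⟩
  · exact src_head_flatMap s.2.2.1 _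
  · exact tgt_getLast_flatMap s.2.2.1 _
  · exact pathWeight_flatMap s.1

/-- Rotation of a union of three graphs. -/
def unionRotate (F G H : WGraph V) :
    ColorIso id ((F.union G).union H) (color₃ F G H) ((G.union H).union F) (color₃ G H F) where
  e := (Equiv.sumAssoc F.E G.E H.E).trans (Equiv.sumComm _ _)
  inj := Function.injective_id.injOn
  src := by rintro ((x | x) | x) <;> rfl
  tgt := by rintro ((x | x) | x) <;> rfl
  weight := by rintro ((x | x) | x) <;> rfl
  color := by rintro ((x | x) | x) ((y | y) | y) <;> simp [color₃]

/-- Both sides sum over the circuits of the three-coloured union, which is unchanged when the three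
graphs are rotated. -/
theorem interaction_trefoil (hT : Tri F.verts G.verts H.verts) :
    F.interaction G + (F.plug G).interaction H = G.interaction H + F.interaction (G.plug H) := by
  rw [interaction_add hT, (unionRotate F G H).cycSum_eq, interaction_comm F (G.plug H),
    interaction_add]
  exact fun v h1 h2 h3 => hT v h3 h1 h2

theorem plug_assoc (hT : Tri F.verts G.verts H.verts) :
    ((F.plug G).plug H).Iso (F.plug (G.plug H)) := by
  refine (plug_plug_iso hT).trans (Iso.trans ?_ (plug_comm _ _))
  refine Iso.trans ?_ (plug_plug_iso (F := G) (G := H) (H := F)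
    fun v h1 h2 h3 => hT v h3 h1 h2).symm
  refine (deloc_id _).symm.trans ((unionRotate F G H).reduct_iso ?_ ?_)
  · intro v hv
    have := symmDiff_subset_union _ _ hv
    change v ∈ (F.verts ∪ G.verts) ∪ H.verts
    rw [Finset.mem_union] at this ⊢
    exact this.imp_left fun h => symmDiff_subset_union _ _ h
  · rw [Finset.image_id, symmDiff_assoc, symmDiff_comm]

/-! ### Disjoint graphs -/

theorem not_adj_of_disjoint (h : Disjoint F.verts G.verts) (a b : (F.union G).E) :
    ¬ (F.union G).adj (color F G) a b := by
  rintro ⟨h1, h2⟩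
  rw [Finset.disjoint_left] at h
  rcases a with a | a <;> rcases b with b | b
  · exact h2 rfl
  · have h1' : G.src b = F.tgt a := h1
    exact h (F.tgt_mem a) (h1' ▸ G.src_mem b)
  · have h1' : F.src b = G.tgt a := h1
    exact h (h1' ▸ F.src_mem b) (G.tgt_mem a)
  · exact h2 rfl

theorem interaction_of_disjoint (h : Disjoint F.verts G.verts) : F.interaction G = 0 := by
  rw [interaction_eq_cycSum]
  refine cycSum_eq_zero _ fun p hp hc => ?_
  obtain ⟨a, p, rfl⟩ := List.exists_cons_of_ne_nil hp
  obtain ⟨⟨b, -, hb⟩, -⟩ := hc.exists_rel List.mem_cons_self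
  exact not_adj_of_disjoint h a b hb

/-- Without adjacent edges of different colours, an alternating path is a single edge. -/
theorem union_iso_plug (h : Disjoint F.verts G.verts) : (F.union G).Iso (F.plug G) := by
  have hv : F.verts ∪ G.verts = symmDiff F.verts G.verts := by
    rw [Finset.disjoint_left] at h
    ext v
    have := @h v
    rw [Finset.mem_union, Finset.mem_symmDiff]
    tauto
  let f : (F.union G).E → (F.plug G).E := fun a => ⟨[a], isAltPath_iff.2 ⟨by simp, by simp⟩,
    by simp, by rw [← hv]; exact (F.union G).src_mem a, by rw [← hv]; exact (F.union G).tgt_mem a⟩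
  have hf : Function.Bijective f := by
    constructor
    · intro a b hab
      exact (List.cons.inj (congrArg Subtype.val hab)).1
    · rintro ⟨p, hp, h0, hs, ht⟩
      obtain ⟨a, p, rfl⟩ := List.exists_cons_of_ne_nil h0
      cases p with
      | nil => exact ⟨a, rfl⟩
      | cons b p =>
        exact absurd (List.isChain_cons_cons.1 (isAltPath_iff.1 hp).2).1 (not_adj_of_disjoint h a b)
  refine ⟨hv, Equiv.ofBijective f hf, fun a => ⟨rfl, rfl, ?_⟩⟩
  change (F.union G).pathWeight [a] = _
  simp [pathWeight]

end Plug

end WGraph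

end GoI

namespace GoI

namespace WGraph

variable {V W ι ι' : Type} [DecidableEq V] [DecidableEq W]

/-! ### Links -/

/-- The graph with edges of weight `1` between `s i` and `t i`, in both directions. -/
@[reducible]
def link (S : Finset ι) (s t : ι → V) : WGraph V where
  verts := S.image s ∪ S.image t
  E := S ⊕ S
  countable := inferInstance
  src := Sum.elim (fun i => s i.1) (fun i => t i.1)
  tgt := Sum.elim (fun i => t i.1) (fun i => s i.1)
  weight := fun _ => 1
  src_mem := by
    rintro (v | v)
    · exact Finset.mem_union_left _ (Finset.mem_image_of_mem _ v.2)
    · exact Finset.mem_union_right _ (Finset.mem_image_of_mem _ v.2)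
  tgt_mem := by
    rintro (v | v)
    · exact Finset.mem_union_right _ (Finset.mem_image_of_mem _ v.2)
    · exact Finset.mem_union_left _ (Finset.mem_image_of_mem _ v.2)
  weight_pos := fun _ => one_pos
  weight_le := fun _ => le_rfl

theorem fax_iso_link (S : Finset V) (θ : V → V) : (fax S θ).Iso (link S id θ) :=
  ⟨by simp [fax], Equiv.refl _, fun x => ⟨by rcases x with x | x <;> rfl,
    by rcases x with x | x <;> rfl, rfl⟩⟩

theorem link_comm (S : Finset ι) (s t : ι → V) : (link S s t).Iso (link S t s) :=
  ⟨Finset.union_comm _ _, Equiv.sumComm _ _, fun x => ⟨by rcases x with x | x <;> rfl,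
    by rcases x with x | x <;> rfl, rfl⟩⟩

theorem deloc_link (θ : V → W) (S : Finset ι) (s t : ι → V) :
    ((link S s t).deloc θ).Iso (link S (θ ∘ s) (θ ∘ t)) :=
  ⟨by simp [deloc, link, Finset.image_union, Finset.image_image], Equiv.refl _,
    fun x => ⟨by rcases x with x | x <;> rfl, by rcases x with x | x <;> rfl, rfl⟩⟩

theorem link_congr {S : Finset ι} {s t s' t' : ι → V} (hs : ∀ i ∈ S, s i = s' i)
    (ht : ∀ i ∈ S, t i = t' i) : (link S s t).Iso (link S s' t') := by
  refine ⟨?_, Equiv.refl _, fun x => ⟨?_, ?_, rfl⟩⟩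
  · change S.image s ∪ S.image t = S.image s' ∪ S.image t'
    rw [Finset.image_congr hs, Finset.image_congr ht]
  · rcases x with x | x
    · exact (hs x.1 x.2).symm
    · exact (ht x.1 x.2).symm
  · rcases x with x | x
    · exact (ht x.1 x.2).symm
    · exact (hs x.1 x.2).symm

theorem link_image [DecidableEq ι'] {S : Finset ι} {η : ι → ι'} (hη : Set.InjOn η S)
    (s t : ι' → V) : (link S (s ∘ η) (t ∘ η)).Iso (link (S.image η) s t) := by
  let f : S → S.image η := fun i => ⟨η i.1, Finset.mem_image_of_mem _ i.2⟩
  have hf : Function.Bijective f := by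
    constructor
    · intro i j hij
      exact Subtype.ext (hη i.2 j.2 (congrArg Subtype.val hij))
    · rintro ⟨j, hj⟩
      obtain ⟨i, hi, rfl⟩ := Finset.mem_image.1 hj
      exact ⟨⟨i, hi⟩, rfl⟩
  refine ⟨by simp [Finset.image_image], (Equiv.ofBijective f hf).sumCongr
    (Equiv.ofBijective f hf), fun x => ⟨?_, ?_, rfl⟩⟩ <;> rcases x with x | x <;> rfl

theorem link_union [DecidableEq ι] {S T : Finset ι} (h : Disjoint S T) (s t : ι → V) :
    ((link S s t).union (link T s t)).Iso (link (S ∪ T) s t) := by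
  refine ⟨?_, (Equiv.sumSumSumComm _ _ _ _).trans ((Equiv.Finset.union S T h).sumCongr
    (Equiv.Finset.union S T h)), fun x => ⟨?_, ?_, ?_⟩⟩
  · change (S.image s ∪ S.image t) ∪ (T.image s ∪ T.image t) = (S ∪ T).image s ∪ (S ∪ T).image t
    rw [Finset.image_union, Finset.image_union, Finset.union_union_union_comm]
  · rcases x with (x | x) | (x | x) <;> rfl
  · rcases x with (x | x) | (x | x) <;> rfl
  · rcases x with (x | x) | (x | x) <;> rfl

/-! ### Plugging with a link whose far ends are new vertices -/

section Absorb

variable {G : WGraph V} {S : Finset ι} {s t : ι → V}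

theorem mem_symmDiff_link (ht : ∀ i ∈ S, t i ∉ G.verts) {v : V} (hv : v ∈ G.verts) :
    v ∈ symmDiff G.verts (link S s t).verts ↔ ¬ ∃ i : S, s i = v := by
  rw [Finset.mem_symmDiff]
  simp only [Finset.mem_union, Finset.mem_image, hv]
  constructor
  · rintro (⟨-, h⟩ | ⟨-, h⟩) ⟨i, hi⟩
    · exact h (Or.inl ⟨i.1, i.2, hi⟩)
    · exact h trivial
  · intro h
    refine Or.inl ⟨trivial, ?_⟩
    rintro (⟨i, hi, hi'⟩ | ⟨i, hi, hi'⟩)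
    · exact h ⟨⟨i, hi⟩, hi'⟩
    · exact ht i hi (hi' ▸ hv)

theorem mem_symmDiff_link' (ht : ∀ i ∈ S, t i ∉ G.verts) (i : S) :
    t i ∈ symmDiff G.verts (link S s t).verts := by
  rw [Finset.mem_symmDiff]
  exact Or.inr ⟨Finset.mem_union_right _ (Finset.mem_image_of_mem _ i.2), ht i i.2⟩

theorem adj_link_left (ht : ∀ i ∈ S, t i ∉ G.verts) {g : G.E} {a : G.E ⊕ (S ⊕ S)}
    (h : (G.union (link S s t)).adj (color G (link S s t)) (Sum.inl g) a) :
    ∃ i : S, a = Sum.inr (Sum.inl i) ∧ s i = G.tgt g := by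
  obtain ⟨h1, h2⟩ := h
  rcases a with a | a | a
  · exact absurd rfl h2
  · exact ⟨a, rfl, h1⟩
  · have h1' : t a = G.tgt g := h1
    exact absurd (h1' ▸ G.tgt_mem g) (ht a a.2)

theorem adj_link_right (ht : ∀ i ∈ S, t i ∉ G.verts) {g : G.E} {a : G.E ⊕ (S ⊕ S)}
    (h : (G.union (link S s t)).adj (color G (link S s t)) a (Sum.inl g)) :
    ∃ i : S, a = Sum.inr (Sum.inr i) ∧ s i = G.src g := by
  obtain ⟨h1, h2⟩ := h
  rcases a with a | a | a
  · exact absurd rfl h2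
  · have h1' : G.src g = t a := h1
    exact absurd (h1' ▸ G.src_mem g) (ht a a.2)
  · exact ⟨a, rfl, h1.symm⟩

/-- A path that leaves `G` through the link arrives at some `t i`, which is not a vertex of `G`, and
by alternation cannot use the link again: it never closes up. -/
theorem interaction_link (ht : ∀ i ∈ S, t i ∉ G.verts) : G.interaction (link S s t) = 0 := by
  rw [interaction_eq_cycSum]
  refine cycSum_eq_zero _ fun p hp hc => ?_
  have key : ∀ g : G.E, Sum.inl g ∉ p := by
    intro g hg
    obtain ⟨⟨b, hb, hgb⟩, -⟩ := hc.exists_rel hg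
    obtain ⟨i, rfl, -⟩ := adj_link_left ht hgb
    obtain ⟨⟨c, hc, hbc⟩, -⟩ := hc.exists_rel hb
    rcases c with c | c
    · obtain ⟨j, hj, -⟩ := adj_link_right ht hbc
      simp at hj
    · exact hbc.2 rfl
  obtain ⟨a, p, rfl⟩ := List.exists_cons_of_ne_nil hp
  rcases a with a | a
  · exact key a List.mem_cons_self
  · obtain ⟨⟨b, hb, hab⟩, -⟩ := hc.exists_rel List.mem_cons_self
    rcases b with b | b
    · exact key b hb
    · exact hab.2 rfl

open Classical in
/-- The edge of the link that leads to a vertex. -/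
noncomputable def linkPre (S : Finset ι) (s : ι → V) (E : Type) (v : V) : List (E ⊕ (S ⊕ S)) :=
  if h : ∃ i : S, s i = v then [Sum.inr (Sum.inr h.choose)] else []

open Classical in
/-- The edge of the link that leaves a vertex. -/
noncomputable def linkPost (S : Finset ι) (s : ι → V) (E : Type) (v : V) : List (E ⊕ (S ⊕ S)) :=
  if h : ∃ i : S, s i = v then [Sum.inr (Sum.inl h.choose)] else []

theorem linkPre_of_mem (hs : Set.InjOn s S) {E : Type} {v : V} (i : S) (hi : s i = v) :
    linkPre S s E v = [Sum.inr (Sum.inr i)] := by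
  have h : ∃ i : S, s i = v := ⟨i, hi⟩
  rw [linkPre, dif_pos h]
  have : h.choose = i := Subtype.ext (hs h.choose.2 i.2 (h.choose_spec.trans hi.symm))
  rw [this]

theorem linkPost_of_mem (hs : Set.InjOn s S) {E : Type} {v : V} (i : S) (hi : s i = v) :
    linkPost S s E v = [Sum.inr (Sum.inl i)] := by
  have h : ∃ i : S, s i = v := ⟨i, hi⟩
  rw [linkPost, dif_pos h]
  have : h.choose = i := Subtype.ext (hs h.choose.2 i.2 (h.choose_spec.trans hi.symm))
  rw [this]

/-- The path that prolongs an edge by edges of the link. -/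
noncomputable def linkPath (S : Finset ι) (s : ι → V) (g : G.E) : List (G.E ⊕ (S ⊕ S)) :=
  linkPre S s G.E (G.src g) ++ Sum.inl g :: linkPost S s G.E (G.tgt g)

/-- Being a path that is an edge of the plugging with a link. -/
def IsLinkPath (G : WGraph V) (S : Finset ι) (s t : ι → V) (p : List (G.E ⊕ (S ⊕ S))) : Prop :=
  G.IsAltPath (link S s t) p ∧ ∃ h : p ≠ [],
    (G.union (link S s t)).src (p.head h) ∈ symmDiff G.verts (link S s t).verts ∧
    (G.union (link S s t)).tgt (p.getLast h) ∈ symmDiff G.verts (link S s t).verts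

theorem linkPath_spec (hs : Set.InjOn s S) (ht : ∀ i ∈ S, t i ∉ G.verts) {θ : V → V}
    (hθ : ∀ i ∈ S, θ (s i) = t i) (hθ' : ∀ v ∈ G.verts, v ∉ S.image s → θ v = v) (g : G.E) :
    G.IsAltPath (link S s t) (linkPath S s g) ∧ ∃ h : linkPath S s g ≠ [],
      ((G.union (link S s t)).src ((linkPath S s g).head h) ∈
        symmDiff G.verts (link S s t).verts ∧
      (G.union (link S s t)).tgt ((linkPath S s g).getLast h) ∈
        symmDiff G.verts (link S s t).verts) ∧
      (G.union (link S s t)).src ((linkPath S s g).head h) = θ (G.src g) ∧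
      (G.union (link S s t)).tgt ((linkPath S s g).getLast h) = θ (G.tgt g) ∧
      (G.union (link S s t)).pathWeight (linkPath S s g) = G.weight g := by
  have hout : ∀ v ∈ G.verts, (¬ ∃ i : S, s i = v) → θ v = v := by
    intro v hv h
    refine hθ' v hv fun hv' => ?_
    obtain ⟨i, hi, hiv⟩ := Finset.mem_image.1 hv'
    exact h ⟨⟨i, hi⟩, hiv⟩
  unfold linkPath
  rw [isAltPath_iff]
  by_cases h1 : ∃ i : S, s i = G.src g <;> by_cases h2 : ∃ j : S, s j = G.tgt g
  · obtain ⟨i, hi⟩ := h1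
    obtain ⟨j, hj⟩ := h2
    rw [linkPre_of_mem hs i hi, linkPost_of_mem hs j hj]
    refine ⟨⟨by simp, ?_⟩, by simp, ⟨mem_symmDiff_link' ht i, mem_symmDiff_link' ht j⟩,
      ?_, ?_, ?_⟩
    · refine List.isChain_cons_cons.2 ⟨⟨hi.symm, by simp [color]⟩,
        List.isChain_cons_cons.2 ⟨⟨hj, by simp [color]⟩, by simp⟩⟩
    · exact (hθ i i.2).symm.trans (congrArg θ hi)
    · exact (hθ j j.2).symm.trans (congrArg θ hj)
    · simp [pathWeight, link]
  · obtain ⟨i, hi⟩ := h1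
    rw [linkPre_of_mem hs i hi, linkPost, dif_neg h2]
    refine ⟨⟨by simp, ?_⟩, by simp, ⟨mem_symmDiff_link' ht i,
      (mem_symmDiff_link ht (G.tgt_mem g)).2 h2⟩, ?_, ?_, ?_⟩
    · exact List.isChain_cons_cons.2 ⟨⟨hi.symm, by simp [color]⟩, by simp⟩
    · exact (hθ i i.2).symm.trans (congrArg θ hi)
    · exact (hout _ (G.tgt_mem g) h2).symm
    · simp [pathWeight, link]
  · obtain ⟨j, hj⟩ := h2
    rw [linkPost_of_mem hs j hj, linkPre, dif_neg h1]
    refine ⟨⟨by simp, ?_⟩, by simp, ⟨(mem_symmDiff_link ht (G.src_mem g)).2 h1,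
      mem_symmDiff_link' ht j⟩, ?_, ?_, ?_⟩
    · exact List.isChain_cons_cons.2 ⟨⟨hj, by simp [color]⟩, by simp⟩
    · exact (hout _ (G.src_mem g) h1).symm
    · exact (hθ j j.2).symm.trans (congrArg θ hj)
    · simp [pathWeight, link]
  · rw [linkPost, dif_neg h2, linkPre, dif_neg h1]
    refine ⟨⟨by simp, by simp⟩, by simp, ⟨(mem_symmDiff_link ht (G.src_mem g)).2 h1,
      (mem_symmDiff_link ht (G.tgt_mem g)).2 h2⟩, ?_, ?_, ?_⟩
    · exact (hout _ (G.src_mem g) h1).symm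
    · exact (hout _ (G.tgt_mem g) h2).symm
    · simp [pathWeight]

theorem linkPath_injective : Function.Injective (linkPath S s : G.E → _) := by
  intro g g' h
  -- The edge `g` is the only letter of its path that comes from `G`.
  have h1 : ∀ g : G.E, (linkPath S s g).filterMap Sum.getLeft? = [g] := by
    intro g
    unfold linkPath linkPre linkPost
    split_ifs <;> simp [List.filterMap_cons]
  have := congrArg (List.filterMap Sum.getLeft?) h
  rw [h1, h1] at this
  simpa using this

/-- After an edge of `G` at most one link edge can follow, and one must follow when the edge ends at
some `s i`, since that vertex disappears in the plugging; the same holds before the edge. A link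
edge alone has such a vertex as an end, so it is not an edge of the plugging. -/
theorem exists_linkPath (hs : Set.InjOn s S) (hsG : ∀ i ∈ S, s i ∈ G.verts)
    (ht : ∀ i ∈ S, t i ∉ G.verts) {p : List (G.E ⊕ (S ⊕ S))} (hp : IsLinkPath G S s t p) :
    ∃ g : G.E, linkPath S s g = p := by
  have hsG' : ∀ i : S, s i ∉ symmDiff G.verts (link S s t).verts := fun i h =>
    (mem_symmDiff_link ht (hsG i i.2)).1 h ⟨i, rfl⟩
  have post : ∀ (g : G.E) (q : List (G.E ⊕ (S ⊕ S))),
      (Sum.inl g :: q).IsChain ((G.union (link S s t)).adj (color G (link S s t))) →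
      (∀ a ∈ (Sum.inl g :: q).getLast?,
        (G.union (link S s t)).tgt a ∈ symmDiff G.verts (link S s t).verts) →
      q = linkPost S s G.E (G.tgt g) := by
    intro g q hq hl
    cases q with
    | nil =>
      have h := hl (Sum.inl g) (by simp)
      rw [linkPost, dif_neg ((mem_symmDiff_link ht (G.tgt_mem g)).1 h)]
    | cons a q =>
      obtain ⟨h1, h2⟩ := List.isChain_cons_cons.1 hq
      obtain ⟨i, rfl, hi⟩ := adj_link_left ht h1
      rw [linkPost_of_mem hs i hi]
      cases q with
      | nil => rfl
      | cons b q =>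
        have h3 := (List.isChain_cons_cons.1 h2).1
        rcases b with b | b
        · obtain ⟨j, hj, -⟩ := adj_link_right ht h3
          simp at hj
        · exact absurd rfl h3.2
  obtain ⟨hp, h0, hps, hpt⟩ := hp
  have hc := (isAltPath_iff.1 hp).2
  have hl : ∀ a ∈ p.getLast?,
      (G.union (link S s t)).tgt a ∈ symmDiff G.verts (link S s t).verts := by
    intro a ha
    have := List.getLast?_eq_some_getLast h0
    rw [Option.mem_def, this] at ha
    exact Option.some.inj ha ▸ hpt
  clear hpt hp
  obtain ⟨a, q, rfl⟩ := List.exists_cons_of_ne_nil h0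
  rcases a with g | i | i
  · refine ⟨g, ?_⟩
    have h : G.src g ∈ symmDiff G.verts (link S s t).verts := hps
    rw [linkPath, linkPre, dif_neg ((mem_symmDiff_link ht (G.src_mem g)).1 h), post g q hc hl]
    rfl
  · exact absurd hps (hsG' i)
  · cases q with
    | nil => exact absurd (hl (Sum.inr (Sum.inr i)) (by simp)) (hsG' i)
    | cons b q =>
      obtain ⟨h1, h2⟩ := List.isChain_cons_cons.1 hc
      rcases b with g | b
      · have h3 : G.src g = s i := h1.1
        refine ⟨g, ?_⟩
        rw [linkPath, linkPre_of_mem hs i h3.symm, post g q h2 (by simpa using hl)]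
        rfl
      · exact absurd rfl h1.2

/-- Prolonging an edge by edges of weight 1 changes its ends and nothing else. -/
theorem deloc_iso_plug_link (hs : Set.InjOn s S) (hsG : ∀ i ∈ S, s i ∈ G.verts)
    (ht : ∀ i ∈ S, t i ∉ G.verts) {θ : V → V} (hθ : ∀ i ∈ S, θ (s i) = t i)
    (hθ' : ∀ v ∈ G.verts, v ∉ S.image s → θ v = v) :
    (G.deloc θ).Iso (G.plug (link S s t)) := by
  have spec := linkPath_spec hs ht hθ hθ'
  let f : (G.deloc θ).E → (G.plug (link S s t)).E := fun g =>
    ⟨linkPath S s g, (spec g).1, (spec g).2.choose, (spec g).2.choose_spec.1⟩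
  have hf : Function.Bijective f := by
    constructor
    · intro g g' h
      exact linkPath_injective (S := S) (s := s) (G := G) (congrArg Subtype.val h)
    · rintro ⟨p, hp⟩
      obtain ⟨g, rfl⟩ := exists_linkPath hs hsG ht hp
      exact ⟨g, rfl⟩
  refine ⟨?_, Equiv.ofBijective f hf, fun g => ⟨(spec g).2.choose_spec.2.1,
    (spec g).2.choose_spec.2.2.1, (spec g).2.choose_spec.2.2.2⟩⟩
  ext v
  change v ∈ G.verts.image θ ↔ v ∈ symmDiff G.verts (link S s t).verts
  rw [Finset.mem_image]
  constructor
  · rintro ⟨u, hu, rfl⟩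
    by_cases h : u ∈ S.image s
    · obtain ⟨i, hi, rfl⟩ := Finset.mem_image.1 h
      rw [hθ i hi]
      exact mem_symmDiff_link' ht ⟨i, hi⟩
    · rw [hθ' u hu h, mem_symmDiff_link ht hu]
      rintro ⟨i, hi⟩
      exact h (Finset.mem_image.2 ⟨i, i.2, hi⟩)
  · intro hv
    by_cases h : v ∈ G.verts
    · refine ⟨v, h, hθ' v h fun h' => ?_⟩
      obtain ⟨i, hi, hi'⟩ := Finset.mem_image.1 h'
      exact (mem_symmDiff_link ht h).1 hv ⟨⟨i, hi⟩, hi'⟩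
    · rw [Finset.mem_symmDiff] at hv
      have hv' := hv.resolve_left (fun h' => h h'.1)
      rcases Finset.mem_union.1 hv'.1 with h' | h'
      · obtain ⟨i, hi, rfl⟩ := Finset.mem_image.1 h'
        exact absurd (hsG i hi) h
      · obtain ⟨i, hi, rfl⟩ := Finset.mem_image.1 h'
        exact ⟨s i, hsG i hi, hθ i hi⟩

end Absorb

end WGraph

end GoI

namespace GoI

/-! ## Classes of projects with a possibly infinite wager -/

instance WGraph.isoSetoid (V : Type) : Setoid (WGraph V) :=
  ⟨WGraph.Iso, .refl, .symm, .trans⟩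

/-- A wager, possibly infinite, and a graph up to renaming of the edges. The cut of two such
objects is everywhere defined. -/
@[ext]
structure EProject (V : Type) where
  wager : ℝ≥0∞
  graph : Quotient (WGraph.isoSetoid V)


namespace EProject

variable {V W U ι : Type}

theorem induction {P : EProject V → Prop} (h : ∀ w G, P ⟨w, ⟦G⟧⟩) (x : EProject V) : P x := by
  obtain ⟨w, G⟩ := x
  induction G using Quotient.inductionOn with
  | h G => exact h w G

/-- The carrier. -/
def carrier (x : EProject V) : Finset V := Quotient.lift WGraph.verts (fun _ _ h => And.left h) x.graph

/-- The relocation. -/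
def map [DecidableEq W] (θ : V → W) (x : EProject V) : EProject W :=
  ⟨x.wager, Quotient.map (WGraph.deloc θ) (fun _ _ h => WGraph.Iso.deloc θ h) x.graph⟩

/-- The link between two families of locations. -/
def link [DecidableEq V] (S : Finset ι) (s t : ι → V) : EProject V := ⟨0, ⟦WGraph.link S s t⟧⟩

/-- The class of a project. -/
def ofProject (a : Project V) : EProject V := ⟨a.wager, ⟦a.graph⟧⟩

theorem ofProject_eq_iff {a b : Project V} : ofProject a = ofProject b ↔ a ≈ b := by
  rw [EProject.ext_iff]
  change (a.wager : ℝ≥0∞) = b.wager ∧ (⟦a.graph⟧ : Quotient (WGraph.isoSetoid V)) = ⟦b.graph⟧ ↔ _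
  rw [ENNReal.coe_inj, Quotient.eq]
  rfl

theorem exists_ofProject {x : EProject V} (h : x.wager ≠ ⊤) : ∃ a, ofProject a = x := by
  induction x using induction with
  | h w G =>
    lift w to ℝ≥0 using h
    exact ⟨⟨w, G⟩, rfl⟩

@[simp] theorem carrier_ofProject (a : Project V) : (ofProject a).carrier = a.carrier := rfl

@[simp] theorem wager_map [DecidableEq W] (θ : V → W) (x : EProject V) :
    (x.map θ).wager = x.wager := rfl

@[simp] theorem carrier_map [DecidableEq W] (θ : V → W) (x : EProject V) :
    (x.map θ).carrier = x.carrier.image θ := by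
  induction x using induction
  rfl

theorem ofProject_deloc [DecidableEq W] (θ : V → W) (a : Project V) :
    ofProject (a.deloc θ) = (ofProject a).map θ := rfl

theorem map_map [DecidableEq W] [DecidableEq U] (η : W → U) (θ : V → W) (x : EProject V) :
    (x.map θ).map η = x.map (η ∘ θ) := by
  induction x using induction with
  | h w G =>
    refine EProject.ext rfl (Quotient.sound ⟨?_, Equiv.refl _, fun _ => ⟨rfl, rfl, rfl⟩⟩)
    exact Finset.image_image

theorem map_congr [DecidableEq W] {θ η : V → W} {x : EProject V}
    (h : ∀ v ∈ x.carrier, θ v = η v) : x.map θ = x.map η := by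
  induction x using induction with
  | h w G =>
    refine EProject.ext rfl (Quotient.sound ⟨?_, Equiv.refl _, fun e => ⟨?_, ?_, rfl⟩⟩)
    · exact Finset.image_congr h
    · exact (h _ (G.src_mem e)).symm
    · exact (h _ (G.tgt_mem e)).symm

variable [DecidableEq V] [DecidableEq W] [DecidableEq U]

theorem map_eq_self {θ : V → V} {x : EProject V} (h : ∀ v ∈ x.carrier, θ v = v) :
    x.map θ = x := by
  induction x using induction with
  | h w G =>
    refine EProject.ext rfl (Quotient.sound ⟨?_, Equiv.refl _, fun e => ⟨?_, ?_, rfl⟩⟩)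
    · exact (Finset.image_congr h).trans Finset.image_id
    · exact (h _ (G.src_mem e)).symm
    · exact (h _ (G.tgt_mem e)).symm

theorem map_invFunOn [Nonempty V] {θ : V → W} {x : EProject V} {X : Finset V}
    (hθ : Set.InjOn θ X) (hx : x.carrier ⊆ X) :
    (x.map θ).map (Function.invFunOn θ X) = x := by
  rw [map_map]
  exact map_eq_self fun v hv => hθ.leftInvOn_invFunOn (hx hv)

theorem map_injOn [Nonempty V] {θ : V → W} {X : Finset V} (hθ : Set.InjOn θ X) {x y : EProject V}
    (hx : x.carrier ⊆ X) (hy : y.carrier ⊆ X) (h : x.map θ = y.map θ) : x = y := by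
  rw [← map_invFunOn hθ hx, h, map_invFunOn hθ hy]

/-- The cut. -/
noncomputable instance : Mul (EProject V) where
  mul x y := ⟨x.wager + y.wager + Quotient.liftOn₂ x.graph y.graph WGraph.interaction
      (fun _ _ _ _ h h' => WGraph.Iso.interaction_eq h h'),
    Quotient.map₂ WGraph.plug (fun _ _ h _ _ h' => WGraph.Iso.plug h h') x.graph y.graph⟩

theorem mk_mul_mk (v w : ℝ≥0∞) (G H : WGraph V) :
    (⟨v, ⟦G⟧⟩ : EProject V) * ⟨w, ⟦H⟧⟩ = ⟨v + w + G.interaction H, ⟦G.plug H⟧⟩ := rfl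

theorem ofProject_cut {a b : Project V} (h : a.measure b ≠ ⊤) :
    ofProject (a.cut b) = ofProject a * ofProject b :=
  EProject.ext (ENNReal.coe_toNNReal h) rfl

@[simp] theorem carrier_mul (x y : EProject V) :
    (x * y).carrier = symmDiff x.carrier y.carrier := by
  induction x using induction
  induction y using induction
  rfl

noncomputable instance : CommMagma (EProject V) where
  mul_comm x y := by
    induction x using induction with
    | h v G =>
      induction y using induction with
      | h w H =>
        rw [mk_mul_mk, mk_mul_mk, WGraph.interaction_comm, add_comm v w]
        exact EProject.ext rfl (Quotient.sound (WGraph.plug_comm G H))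

/-- The wagers agree by the trefoil identity and the graphs by `plug_assoc`; in `[0,∞]` infinite
values need no separate treatment. -/
theorem mul_assoc_of_tri {x y z : EProject V} (h : WGraph.Tri x.carrier y.carrier z.carrier) :
    x * y * z = x * (y * z) := by
  induction x using induction with
  | h u F =>
    induction y using induction with
    | h v G =>
      induction z using induction with
      | h w H =>
        rw [mk_mul_mk, mk_mul_mk, mk_mul_mk, mk_mul_mk]
        refine EProject.ext ?_ (Quotient.sound (WGraph.plug_assoc h))
        have := WGraph.interaction_trefoil h
        calc u + v + F.interaction G + w + (F.plug G).interaction H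
            = u + v + w + (F.interaction G + (F.plug G).interaction H) := by ring
          _ = u + (v + w + G.interaction H) + F.interaction (G.plug H) := by rw [this]; ring

theorem map_mul {θ : V → W} {x y : EProject V}
    (hθ : Set.InjOn θ (x.carrier ∪ y.carrier : Finset V)) :
    (x * y).map θ = x.map θ * y.map θ := by
  induction x using induction with
  | h v G =>
    induction y using induction with
    | h w H =>
      change EProject.map θ ⟨v + w + G.interaction H, ⟦G.plug H⟧⟩ =
        ⟨v + w + (G.deloc θ).interaction (H.deloc θ), ⟦(G.deloc θ).plug (H.deloc θ)⟧⟩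
      rw [WGraph.interaction_deloc hθ]
      exact EProject.ext rfl (Quotient.sound (WGraph.plug_deloc hθ))

theorem wager_mul_of_disjoint {x y : EProject V} (h : Disjoint x.carrier y.carrier) :
    (x * y).wager = x.wager + y.wager := by
  induction x using induction with
  | h v G =>
    induction y using induction with
    | h w H =>
      rw [mk_mul_mk, WGraph.interaction_of_disjoint h, add_zero]

/-- For disjoint carriers the tensor product is a cut, so that a single product serves for both. -/
theorem ofProject_tensor {a b : Project V} (h : Disjoint a.carrier b.carrier) :
    ofProject (a.tensor b) = ofProject a * ofProject b := by
  refine EProject.ext ?_ (Quotient.sound (WGraph.union_iso_plug h))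
  rw [wager_mul_of_disjoint (x := ofProject a) (y := ofProject b) h]
  exact ENNReal.coe_add _ _

theorem le_wager_mul_left (x y : EProject V) : x.wager ≤ (x * y).wager :=
  le_self_add.trans (le_self_add (a := x.wager + y.wager))

theorem carrier_link (S : Finset ι) (s t : ι → V) :
    (link S s t).carrier = S.image s ∪ S.image t := rfl

theorem ofProject_fax (S : Finset V) (θ : V → V) :
    ofProject (Project.fax S θ) = link S id θ :=
  EProject.ext rfl (Quotient.sound (WGraph.fax_iso_link S θ))

theorem link_comm (S : Finset ι) (s t : ι → V) : link S s t = link S t s :=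
  EProject.ext rfl (Quotient.sound (WGraph.link_comm S s t))

theorem map_link (θ : V → W) (S : Finset ι) (s t : ι → V) :
    (link S s t).map θ = link S (θ ∘ s) (θ ∘ t) :=
  EProject.ext rfl (Quotient.sound (WGraph.deloc_link θ S s t))

theorem link_congr {S : Finset ι} {s t s' t' : ι → V} (hs : ∀ i ∈ S, s i = s' i)
    (ht : ∀ i ∈ S, t i = t' i) : link S s t = link S s' t' :=
  EProject.ext rfl (Quotient.sound (WGraph.link_congr hs ht))

theorem link_image [DecidableEq ι] {κ : Type} {S : Finset κ} {η : κ → ι} (hη : Set.InjOn η S)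
    (s t : ι → V) : link (S.image η) s t = link S (s ∘ η) (t ∘ η) :=
  EProject.ext rfl (Quotient.sound (WGraph.link_image hη s t).symm)

theorem link_union [DecidableEq ι] {S T : Finset ι} {s t : ι → V}
    (h : Disjoint (S.image s ∪ S.image t) (T.image s ∪ T.image t)) :
    link (S ∪ T) s t = link S s t * link T s t := by
  have hST : Disjoint S T := by
    rw [Finset.disjoint_left] at h ⊢
    intro i hi hi'
    exact h (Finset.mem_union_left _ (Finset.mem_image_of_mem s hi))
      (Finset.mem_union_left _ (Finset.mem_image_of_mem s hi'))
  refine EProject.ext ?_ (Quotient.sound ((WGraph.link_union hST s t).symm.trans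
    (WGraph.union_iso_plug h)))
  rw [wager_mul_of_disjoint h]
  exact (add_zero 0).symm

/-- Composition with a link relocates. -/
theorem map_mul_link {y : EProject U} {T : Finset U} {α α' : U → V}
    (hα : Set.InjOn α y.carrier) (hT : T ⊆ y.carrier)
    (hα' : ∀ u ∈ y.carrier, u ∉ T → α' u = α u) (hnew : ∀ u ∈ T, α' u ∉ y.carrier.image α) :
    y.map α * link T α α' = y.map α' := by
  classical
  -- The relocation `α u ↦ α' u`, extended by the identity; injectivity of `α` on the carrier makes
  -- it independent of the chosen `u`.
  let θ : V → V := fun v => if h : ∃ u ∈ y.carrier, α u = v then α' h.choose else v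
  have hθ : ∀ u ∈ y.carrier, θ (α u) = α' u := by
    intro u hu
    have h : ∃ u' ∈ y.carrier, α u' = α u := ⟨u, hu, rfl⟩
    change (if h : ∃ u' ∈ y.carrier, α u' = α u then α' h.choose else α u) = α' u
    rw [dif_pos h, hα h.choose_spec.1 hu h.choose_spec.2]
  have hmap : y.map α' = (y.map α).map θ := by
    rw [map_map]
    exact map_congr fun u hu => (hθ u hu).symm
  rw [hmap]
  induction y using induction with
  | h w G =>
    have hs : Set.InjOn α T := hα.mono hT
    have hsG : ∀ i ∈ T, α i ∈ (G.deloc α).verts := fun i hi =>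
      Finset.mem_image_of_mem α (hT hi)
    have hθ' : ∀ v ∈ (G.deloc α).verts, v ∉ T.image α → θ v = v := by
      intro v hv hv'
      obtain ⟨u, hu, rfl⟩ := Finset.mem_image.1 hv
      rw [hθ u hu]
      exact hα' u hu fun h => hv' (Finset.mem_image_of_mem α h)
    refine EProject.ext ?_ (Quotient.sound (WGraph.deloc_iso_plug_link hs hsG hnew
      (fun i hi => hθ i (hT hi)) hθ').symm)
    change w + 0 + (G.deloc α).interaction (WGraph.link T α α') = w
    rw [WGraph.interaction_link hnew, add_zero, add_zero]

/-- The project with wager `0` and the empty graph. -/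
noncomputable instance : One (EProject V) := ⟨⟨0, ⟦WGraph.empty V⟧⟩⟩

theorem eq_of_carrier_eq_empty {x : EProject V} (h : x.carrier = ∅) :
    x = ⟨x.wager, ⟦WGraph.empty V⟧⟩ := by
  induction x using induction with
  | h w G =>
    have h' : G.verts = ∅ := h
    have hE : G.E → False := fun e => by
      have := G.src_mem e
      rw [h'] at this
      simp at this
    refine EProject.ext rfl (Quotient.sound ⟨h', ⟨fun e => (hE e).elim, fun e => e.elim,
      fun e => (hE e).elim, fun e => e.elim⟩, fun e => (hE e).elim⟩)

theorem link_empty (s t : ι → V) : link ∅ s t = 1 :=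
  eq_of_carrier_eq_empty rfl

protected theorem mul_one (x : EProject V) : x * 1 = x := by
  -- The unit is a link on the empty set, and absorbing it moves nothing.
  have h := map_mul_link (y := x) (T := ∅) (α := id) (α' := id) Function.injective_id.injOn
    (by simp) (by simp) (by simp)
  rwa [link_empty, map_eq_self (θ := id) fun _ _ => rfl] at h

protected theorem one_mul (x : EProject V) : 1 * x = x := by
  rw [mul_comm, EProject.mul_one]

theorem map_one (θ : V → W) : (1 : EProject V).map θ = 1 :=
  eq_of_carrier_eq_empty rfl

theorem mul_mul_mul_comm_of_tri {a b c d : EProject V}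
    (h1 : WGraph.Tri a.carrier b.carrier c.carrier)
    (h2 : WGraph.Tri a.carrier b.carrier d.carrier)
    (h3 : WGraph.Tri a.carrier c.carrier d.carrier)
    (h4 : WGraph.Tri b.carrier c.carrier d.carrier) : a * b * (c * d) = a * c * (b * d) := by
  have e1 : a * b * (c * d) = a * (b * (c * d)) := mul_assoc_of_tri fun v => by
    have := h1 v; have := h2 v; have := h3 v; have := h4 v
    rw [carrier_mul, Finset.mem_symmDiff]
    tauto
  have e2 : a * c * (b * d) = a * (c * (b * d)) := mul_assoc_of_tri fun v => by
    have := h1 v; have := h2 v; have := h3 v; have := h4 v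
    rw [carrier_mul, Finset.mem_symmDiff]
    tauto
  rw [e1, e2, ← mul_assoc_of_tri h4, mul_comm b c, mul_assoc_of_tri]
  exact fun v hc hb hd => h4 v hb hc hd

end EProject

end GoI

namespace GoI

/-! ## Sets of classes of projects -/

section Sets

variable {V W : Type} [DecidableEq V] [DecidableEq W]

/-- The wager is neither `0` nor infinite. -/
def EProject.Ok (x : EProject V) : Prop := x.wager ≠ 0 ∧ x.wager ≠ ⊤

/-- The orthogonal. -/
def perp (S : Set (EProject V)) : Set (EProject V) :=
  {b | ∀ a ∈ S, a.carrier = b.carrier ∧ (a * b).Ok}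

/-- The products of elements of two sets. -/
def prods (S T : Set (EProject V)) : Set (EProject V) := Set.image2 (· * ·) S T

/-- The tensor product. -/
def tens (S T : Set (EProject V)) : Set (EProject V) := perp (perp (prods S T))

/-- The linear implication. -/
def impl (S T : Set (EProject V)) : Set (EProject V) := {f | ∀ a ∈ S, f * a ∈ T}

/-- All the elements have the given carrier. -/
def HasCarrier (S : Set (EProject V)) (X : Finset V) : Prop := ∀ a ∈ S, a.carrier = X

/-- A non-empty set of common carrier, equal to its biorthogonal. -/
structure IsConduct (S : Set (EProject V)) (X : Finset V) : Prop where
  nonempty : S.Nonempty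
  carrier : HasCarrier S X
  biorth : perp (perp S) = S

variable {S T : Set (EProject V)} {X Y Z : Finset V}

theorem perp_antitone (h : S ⊆ T) : perp T ⊆ perp S := fun _ hb a ha => hb a (h ha)

theorem subset_perp_perp (S : Set (EProject V)) : S ⊆ perp (perp S) := by
  intro a ha b hb
  obtain ⟨h1, h2⟩ := hb a ha
  exact ⟨h1.symm, by rwa [mul_comm]⟩

theorem perp_perp_perp (S : Set (EProject V)) : perp (perp (perp S)) = perp S :=
  (perp_antitone (subset_perp_perp S)).antisymm (subset_perp_perp _)

theorem HasCarrier.perp (hS : S.Nonempty) (h : HasCarrier S X) : HasCarrier (perp S) X := by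
  intro b hb
  obtain ⟨a, ha⟩ := hS
  rw [← (hb a ha).1, h a ha]

/-- If nothing were orthogonal to `S`, its biorthogonal would contain everything, in particular a
link at a location outside `X`. -/
theorem IsConduct.perp_nonempty [Infinite V] (h : IsConduct S X) : (perp S).Nonempty := by
  by_contra hne
  rw [Set.not_nonempty_iff_eq_empty] at hne
  obtain ⟨v, hv⟩ := Infinite.exists_notMem_finset X
  have hmem : EProject.link {v} id id ∈ S := by
    rw [← h.biorth, hne]
    exact fun a ha => ha.elim
  have := h.carrier _ hmem
  rw [← this, EProject.carrier_link] at hv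
  simp at hv

theorem isConduct_perp (hS : S.Nonempty) (h : HasCarrier S X) (hp : (perp S).Nonempty) :
    IsConduct (perp S) X :=
  ⟨hp, h.perp hS, perp_perp_perp S⟩

theorem IsConduct.perp [Infinite V] (h : IsConduct S X) : IsConduct (perp S) X :=
  isConduct_perp h.nonempty h.carrier h.perp_nonempty

theorem isConduct_perp_perp (hS : S.Nonempty) (h : HasCarrier S X) (hp : (perp S).Nonempty) :
    IsConduct (perp (perp S)) X :=
  isConduct_perp hp (h.perp hS) (hS.mono (subset_perp_perp S))

/-- The wager is bounded by the finite measure against an orthogonal element. Hence every cut that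
lands in a conduct is defined. -/
theorem IsConduct.wager_ne_top [Infinite V] (h : IsConduct S X) {a : EProject V} (ha : a ∈ S) :
    a.wager ≠ ⊤ := by
  obtain ⟨b, hb⟩ := h.perp_nonempty
  exact ne_top_of_le_ne_top (hb a ha).2.2 (a.le_wager_mul_left b)

theorem HasCarrier.prods (hXY : Disjoint X Y) (hS : HasCarrier S X) (hT : HasCarrier T Y) :
    HasCarrier (prods S T) (X ∪ Y) := by
  rintro _ ⟨a, ha, b, hb, rfl⟩
  change (a * b).carrier = _
  rw [EProject.carrier_mul, hS a ha, hT b hb]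
  exact hXY.symmDiff_eq_sup

theorem prods_nonempty (hS : S.Nonempty) (hT : T.Nonempty) : (prods S T).Nonempty :=
  Set.Nonempty.image2 hS hT

theorem tri_of_disjoint {A : Finset V} (hXY : Disjoint X Y) : WGraph.Tri A X Y :=
  fun _ _ h h' => Finset.disjoint_left.1 hXY h h'

theorem mem_perp_prods (hXY : Disjoint X Y) (hS : HasCarrier S X) (hT : HasCarrier T Y)
    (hSn : S.Nonempty) (hTn : T.Nonempty) {f : EProject V} :
    f ∈ perp (prods S T) ↔ f.carrier = X ∪ Y ∧ ∀ a ∈ S, ∀ b ∈ T, (f * a * b).Ok := by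
  have key : ∀ a ∈ S, ∀ b ∈ T, f * a * b = a * b * f := by
    intro a ha b hb
    rw [EProject.mul_assoc_of_tri, mul_comm]
    rw [hS a ha, hT b hb]
    exact tri_of_disjoint hXY
  constructor
  · intro hf
    refine ⟨(hS.prods hXY hT).perp (prods_nonempty hSn hTn) f hf, fun a ha b hb => ?_⟩
    rw [key a ha b hb]
    exact (hf _ ⟨a, ha, b, hb, rfl⟩).2
  · rintro ⟨hc, hok⟩ _ ⟨a, ha, b, hb, rfl⟩
    refine ⟨?_, ?_⟩
    · rw [hc]
      exact hS.prods hXY hT _ ⟨a, ha, b, hb, rfl⟩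
    · change (a * b * f).Ok
      rw [← key a ha b hb]
      exact hok a ha b hb

theorem symmDiff_union_left (hXY : Disjoint X Y) : symmDiff (X ∪ Y) X = Y := by
  rw [Finset.disjoint_left] at hXY
  ext v
  have := @hXY v
  simp only [Finset.mem_symmDiff, Finset.mem_union]
  tauto

/-- The basic adjunction: the measure of `f` against `a * b` is the measure of `f * a` against `b`,
by associativity of the cut, since `X` and `Y` are disjoint. -/
theorem mem_perp_prods_iff (hXY : Disjoint X Y) (hS : HasCarrier S X) (hT : HasCarrier T Y)
    (hSn : S.Nonempty) (hTn : T.Nonempty) {f : EProject V} :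
    f ∈ perp (prods S T) ↔ ∀ a ∈ S, f * a ∈ perp T := by
  rw [mem_perp_prods hXY hS hT hSn hTn]
  constructor
  · rintro ⟨hc, hok⟩ a ha b hb
    refine ⟨?_, ?_⟩
    · rw [EProject.carrier_mul, hc, hS a ha, hT b hb, symmDiff_union_left hXY]
    · rw [mul_comm]
      exact hok a ha b hb
  · intro h
    refine ⟨?_, fun a ha b hb => ?_⟩
    · obtain ⟨a, ha⟩ := hSn
      have := hT.perp hTn _ (h a ha)
      rw [EProject.carrier_mul, hS a ha] at this
      -- The carrier of `f` is recovered from that of `f * a` by cancelling `X` in the symmetric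
      -- difference.
      rw [← symmDiff_symmDiff_cancel_right X f.carrier, this, symmDiff_comm]
      exact hXY.symmDiff_eq_sup
    · rw [mul_comm]
      exact (h a ha b hb).2

/-- The adjunction applied to `perp T`, whose orthogonal is `T`. It exhibits the linear implication
as an orthogonal, hence as a conduct. -/
theorem impl_eq [Infinite V] (hXY : Disjoint X Y) (hS : HasCarrier S X) (hSn : S.Nonempty)
    (hT : IsConduct T Y) : impl S T = perp (prods S (perp T)) := by
  ext f
  rw [mem_perp_prods_iff hXY hS hT.perp.carrier hSn hT.perp_nonempty, hT.biorth]
  rfl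

theorem prods_comm (S T : Set (EProject V)) : prods S T = prods T S :=
  Set.image2_comm mul_comm

theorem tens_comm (S T : Set (EProject V)) : tens S T = tens T S := by
  rw [tens, prods_comm, tens]

/-- By the adjunction only `perp T` matters, and it does not change under biorthogonality. So tensor
products can be tested on elementary tensors. -/
theorem perp_prods_biorth_right (hXY : Disjoint X Y) (hS : HasCarrier S X) (hT : HasCarrier T Y)
    (hSn : S.Nonempty) (hTn : T.Nonempty) (hTp : (perp T).Nonempty) :
    perp (prods S (perp (perp T))) = perp (prods S T) := by
  ext f
  rw [mem_perp_prods_iff hXY hS hT hSn hTn, mem_perp_prods_iff hXY hS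
    ((hT.perp hTn).perp hTp) hSn (hTn.mono (subset_perp_perp T)), perp_perp_perp]

theorem perp_prods_biorth_left (hXY : Disjoint X Y) (hS : HasCarrier S X) (hT : HasCarrier T Y)
    (hSn : S.Nonempty) (hTn : T.Nonempty) (hSp : (perp S).Nonempty) :
    perp (prods (perp (perp S)) T) = perp (prods S T) := by
  rw [prods_comm, perp_prods_biorth_right hXY.symm hT hS hTn hSn hSp, prods_comm]

theorem prods_assoc {R : Set (EProject V)} (hYZ : Disjoint Y Z) (hS : HasCarrier S Y)
    (hT : HasCarrier T Z) : prods (prods R S) T = prods R (prods S T) := by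
  refine Set.Subset.antisymm ?_ ?_
  · rintro _ ⟨_, ⟨a, ha, b, hb, rfl⟩, c, hc, rfl⟩
    refine ⟨a, ha, b * c, ⟨b, hb, c, hc, rfl⟩, ?_⟩
    refine (EProject.mul_assoc_of_tri ?_).symm
    rw [hS b hb, hT c hc]
    exact tri_of_disjoint hYZ
  · rintro _ ⟨a, ha, _, ⟨b, hb, c, hc, rfl⟩, rfl⟩
    refine ⟨a * b, ⟨a, ha, b, hb, rfl⟩, c, hc, ?_⟩
    refine EProject.mul_assoc_of_tri ?_
    rw [hS b hb, hT c hc]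
    exact tri_of_disjoint hYZ

/-- A product of an element of `perp S` and one of `perp T` is orthogonal to all elementary tensors:
the two measures add up, and a sum of two numbers of `]0,∞[` is in `]0,∞[`. -/
theorem perp_prods_nonempty (hXY : Disjoint X Y) (hS : HasCarrier S X) (hT : HasCarrier T Y)
    (hSn : S.Nonempty) (hTn : T.Nonempty) (hSp : (perp S).Nonempty) (hTp : (perp T).Nonempty) :
    (perp (prods S T)).Nonempty := by
  obtain ⟨a', ha'⟩ := hSp
  obtain ⟨b', hb'⟩ := hTp
  refine ⟨a' * b', ?_⟩
  rintro _ ⟨a, ha, b, hb, rfl⟩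
  have h1 := hS.perp hSn a' ha'
  have h2 := hT.perp hTn b' hb'
  have h3 := hS a ha
  have h4 := hT b hb
  have hd := Finset.disjoint_left.1 hXY
  refine ⟨by simp [h1, h2, h3, h4], ?_⟩
  change (a * b * (a' * b')).Ok
  rw [EProject.mul_mul_mul_comm_of_tri]
  · have h5 := (ha' a ha).2
    have h6 := (hb' b hb).2
    rw [EProject.Ok, EProject.wager_mul_of_disjoint]
    · exact ⟨fun h => h5.1 (add_eq_zero.1 h).1, ENNReal.add_ne_top.2 ⟨h5.2, h6.2⟩⟩
    · rw [EProject.carrier_mul, h3, h1, symmDiff_self]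
      exact Finset.disjoint_empty_left _
  all_goals
    intro v
    have := @hd v
    simp only [h1, h2, h3, h4]
    tauto

theorem IsConduct.tens [Infinite V] (hXY : Disjoint X Y) (hS : IsConduct S X)
    (hT : IsConduct T Y) : IsConduct (tens S T) (X ∪ Y) :=
  isConduct_perp_perp (prods_nonempty hS.nonempty hT.nonempty) (hS.carrier.prods hXY hT.carrier)
    (perp_prods_nonempty hXY hS.carrier hT.carrier hS.nonempty hT.nonempty hS.perp_nonempty
      hT.perp_nonempty)

theorem IsConduct.impl [Infinite V] (hXY : Disjoint X Y) (hS : IsConduct S X)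
    (hT : IsConduct T Y) : IsConduct (impl S T) (X ∪ Y) := by
  rw [impl_eq hXY hS.carrier hS.nonempty hT]
  exact isConduct_perp (prods_nonempty hS.nonempty hT.perp_nonempty)
    (hS.carrier.prods hXY hT.perp.carrier)
    (perp_prods_nonempty hXY hS.carrier hT.perp.carrier hS.nonempty hT.perp_nonempty
      hS.perp_nonempty hT.perp.perp_nonempty)

theorem tens_assoc [Infinite V] {R : Set (EProject V)} (hXY : Disjoint X Y) (hYZ : Disjoint Y Z)
    (hXZ : Disjoint X Z) (hR : IsConduct R X) (hS : IsConduct S Y) (hT : IsConduct T Z) :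
    tens (tens R S) T = tens R (tens S T) := by
  have hRS := prods_nonempty hR.nonempty hS.nonempty
  have hST := prods_nonempty hS.nonempty hT.nonempty
  unfold tens
  rw [perp_prods_biorth_left (Finset.disjoint_union_left.2 ⟨hXZ, hYZ⟩)
      (hR.carrier.prods hXY hS.carrier) hT.carrier hRS hT.nonempty
      (perp_prods_nonempty hXY hR.carrier hS.carrier hR.nonempty hS.nonempty hR.perp_nonempty
        hS.perp_nonempty),
    perp_prods_biorth_right (Finset.disjoint_union_right.2 ⟨hXY, hXZ⟩) hR.carrier
      (hS.carrier.prods hYZ hT.carrier) hR.nonempty hST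
      (perp_prods_nonempty hYZ hS.carrier hT.carrier hS.nonempty hT.nonempty hS.perp_nonempty
        hT.perp_nonempty), prods_assoc hYZ hS.carrier hT.carrier]

theorem impl_tens_eq [Infinite V] {R : Set (EProject V)} (hXY : Disjoint X Y)
    (hYZ : Disjoint Y Z) (hXZ : Disjoint X Z) (hS : IsConduct S X) (hT : IsConduct T Y)
    (hR : IsConduct R Z) : impl (tens S T) R = impl (prods S T) R := by
  have hST := prods_nonempty hS.nonempty hT.nonempty
  have hd := Finset.disjoint_union_left.2 ⟨hXZ, hYZ⟩
  rw [impl_eq hd (hS.tens hXY hT).carrier (hS.tens hXY hT).nonempty hR,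
    impl_eq hd (hS.carrier.prods hXY hT.carrier) hST hR]
  exact perp_prods_biorth_left hd (hS.carrier.prods hXY hT.carrier) hR.perp.carrier hST
    hR.perp_nonempty (perp_prods_nonempty hXY hS.carrier hT.carrier hS.nonempty hT.nonempty
      hS.perp_nonempty hT.perp_nonempty)

/-- The currying identity: on elementary tensors it is the associativity of the cut. -/
theorem impl_tens [Infinite V] {R : Set (EProject V)} (hXY : Disjoint X Y) (hYZ : Disjoint Y Z)
    (hXZ : Disjoint X Z) (hS : IsConduct S X) (hT : IsConduct T Y) (hR : IsConduct R Z) :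
    impl (tens S T) R = impl S (impl T R) := by
  rw [impl_tens_eq hXY hYZ hXZ hS hT hR]
  have key : ∀ a ∈ S, ∀ b ∈ T, ∀ f : EProject V, f * (a * b) = f * a * b := by
    intro a ha b hb f
    refine (EProject.mul_assoc_of_tri ?_).symm
    rw [hS.carrier a ha, hT.carrier b hb]
    exact tri_of_disjoint hXY
  ext f
  constructor
  · intro hf a ha b hb
    rw [← key a ha b hb]
    exact hf _ ⟨a, ha, b, hb, rfl⟩
  · rintro hf _ ⟨a, ha, b, hb, rfl⟩
    change f * (a * b) ∈ R
    rw [key a ha b hb]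
    exact hf a ha b hb

theorem HasCarrier.impl (hXY : Disjoint X Y) (hS : HasCarrier S X) (hSn : S.Nonempty)
    (hT : HasCarrier T Y) : HasCarrier (impl S T) (X ∪ Y) := by
  intro f hf
  obtain ⟨a, ha⟩ := hSn
  have := hT _ (hf a ha)
  rw [EProject.carrier_mul, hS a ha] at this
  rw [← symmDiff_symmDiff_cancel_right X f.carrier, this, symmDiff_comm]
  exact hXY.symmDiff_eq_sup

/-- Applying a composite is applying `f`, then `g`. Associativity is available because each of `X`,
`Y`, `Z` meets only two of the carriers of `f`, `g`, `a`. -/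
theorem mul_mem_impl {R : Set (EProject V)} (hXY : Disjoint X Y) (hXZ : Disjoint X Z)
    (hYZ : Disjoint Y Z) (hS : HasCarrier S X) (hSn : S.Nonempty) (hT : HasCarrier T Y)
    (hTn : T.Nonempty) (hR : HasCarrier R Z) {f g : EProject V} (hf : f ∈ GoI.impl S T)
    (hg : g ∈ GoI.impl T R) : f * g ∈ GoI.impl S R := by
  intro a ha
  have h1 := HasCarrier.impl hXY hS hSn hT f hf
  have h2 := HasCarrier.impl hYZ hT hTn hR g hg
  have h3 := hS a ha
  have d1 := Finset.disjoint_left.1 hXY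
  have d2 := Finset.disjoint_left.1 hXZ
  have d3 := Finset.disjoint_left.1 hYZ
  have key : f * g * a = g * (f * a) := by
    rw [mul_comm f g]
    refine EProject.mul_assoc_of_tri fun v => ?_
    have := @d1 v; have := @d2 v; have := @d3 v
    simp only [h1, h2, h3, Finset.mem_union]
    tauto
  rw [key]
  exact hg _ (hf a ha)

theorem prods_mem_impl_tens [Infinite V] {S' T' : Set (EProject V)} {X' Y' : Finset V}
    (h1 : Disjoint X Y) (h2 : Disjoint X X') (h3 : Disjoint X Y') (h4 : Disjoint Y X')
    (h5 : Disjoint Y Y') (h6 : Disjoint X' Y') (hS : IsConduct S X) (hT : IsConduct T Y)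
    (hS' : IsConduct S' X') (hT' : IsConduct T' Y') {f g : EProject V} (hf : f ∈ GoI.impl S S')
    (hg : g ∈ GoI.impl T T') : f * g ∈ GoI.impl (GoI.tens S T) (GoI.tens S' T') := by
  rw [impl_tens_eq h1 (Finset.disjoint_union_right.2 ⟨h4, h5⟩)
    (Finset.disjoint_union_right.2 ⟨h2, h3⟩) hS hT (hS'.tens h6 hT')]
  rintro _ ⟨a, ha, b, hb, rfl⟩
  have c1 := hS.carrier.impl h2 hS.nonempty hS'.carrier f hf
  have c2 := hT.carrier.impl h5 hT.nonempty hT'.carrier g hg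
  have c3 := hS.carrier a ha
  have c4 := hT.carrier b hb
  have d1 := Finset.disjoint_left.1 h1
  have d2 := Finset.disjoint_left.1 h2
  have d3 := Finset.disjoint_left.1 h3
  have d4 := Finset.disjoint_left.1 h4
  have d5 := Finset.disjoint_left.1 h5
  have d6 := Finset.disjoint_left.1 h6
  have key : f * g * (a * b) = f * a * (g * b) := by
    apply EProject.mul_mul_mul_comm_of_tri
    all_goals
      intro v
      have := @d1 v; have := @d2 v; have := @d3 v; have := @d4 v; have := @d5 v; have := @d6 v
      simp only [c1, c2, c3, c4, Finset.mem_union]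
      tauto
  change f * g * (a * b) ∈ _
  rw [key]
  exact subset_perp_perp _ ⟨_, hf a ha, _, hg b hb, rfl⟩

/-! ### Relocation -/

variable [Nonempty V] {θ : V → W}

/-- An element orthogonal to the relocated set has carrier `X.image θ`, so it can be brought back by
an inverse of `θ` on `X`; relocation along an injection preserves measures. -/
theorem perp_map (hθ : Set.InjOn θ X) (hS : HasCarrier S X) (hSn : S.Nonempty) :
    perp (EProject.map θ '' S) = EProject.map θ '' perp S := by
  have key : ∀ a ∈ S, ∀ b : EProject V, b.carrier = X → (a.map θ * b.map θ).Ok → (a * b).Ok := by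
    intro a ha b hb h
    rwa [← EProject.map_mul (by rwa [hS a ha, hb, Finset.union_self])] at h
  ext b
  constructor
  · intro hb
    have hbc : b.carrier = X.image θ := by
      obtain ⟨a, ha⟩ := hSn
      rw [← (hb _ ⟨a, ha, rfl⟩).1, EProject.carrier_map, hS a ha]
    have hb' : (b.map (Function.invFunOn θ X)).map θ = b := by
      rw [EProject.map_map]
      refine EProject.map_eq_self fun w hw => ?_
      rw [hbc, Finset.mem_image] at hw
      exact Function.invFunOn_eq hw
    have hb'' : (b.map (Function.invFunOn θ X)).carrier = X := by
      rw [EProject.carrier_map, hbc, Finset.image_image]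
      exact (Finset.image_congr hθ.leftInvOn_invFunOn).trans Finset.image_id
    refine ⟨_, fun a ha => ⟨by rw [hb'', hS a ha], key a ha _ hb'' ?_⟩, hb'⟩
    rw [hb']
    exact (hb _ ⟨a, ha, rfl⟩).2
  · rintro ⟨b, hb, rfl⟩ _ ⟨a, ha, rfl⟩
    obtain ⟨h1, h2⟩ := hb a ha
    refine ⟨by rw [EProject.carrier_map, EProject.carrier_map, h1], ?_⟩
    rwa [← EProject.map_mul (by rwa [← h1, hS a ha, Finset.union_self])]

theorem HasCarrier.map (hS : HasCarrier S X) : HasCarrier (EProject.map θ '' S) (X.image θ) := by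
  rintro _ ⟨a, ha, rfl⟩
  rw [EProject.carrier_map, hS a ha]

theorem IsConduct.map [Infinite V] (hθ : Set.InjOn θ X) (hS : IsConduct S X) :
    IsConduct (EProject.map θ '' S) (X.image θ) :=
  ⟨hS.nonempty.image _, hS.carrier.map, by
    rw [perp_map hθ hS.carrier hS.nonempty, perp_map hθ hS.perp.carrier hS.perp_nonempty,
      hS.biorth]⟩

theorem prods_map (hθ : Set.InjOn θ (X ∪ Y : Finset V)) (hS : HasCarrier S X)
    (hT : HasCarrier T Y) :
    prods (EProject.map θ '' S) (EProject.map θ '' T) = EProject.map θ '' prods S T := by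
  have key : ∀ a ∈ S, ∀ b ∈ T, (a * b).map θ = a.map θ * b.map θ := fun a ha b hb =>
    EProject.map_mul (by rwa [hS a ha, hT b hb])
  ext x
  constructor
  · rintro ⟨_, ⟨a, ha, rfl⟩, _, ⟨b, hb, rfl⟩, rfl⟩
    exact ⟨a * b, ⟨a, ha, b, hb, rfl⟩, key a ha b hb⟩
  · rintro ⟨_, ⟨a, ha, b, hb, rfl⟩, rfl⟩
    exact ⟨_, ⟨a, ha, rfl⟩, _, ⟨b, hb, rfl⟩, (key a ha b hb).symm⟩

theorem tens_map [Infinite V] (hXY : Disjoint X Y) (hθ : Set.InjOn θ (X ∪ Y : Finset V))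
    (hS : IsConduct S X) (hT : IsConduct T Y) :
    tens (EProject.map θ '' S) (EProject.map θ '' T) = EProject.map θ '' tens S T := by
  have hn := prods_nonempty hS.nonempty hT.nonempty
  have hc := hS.carrier.prods hXY hT.carrier
  rw [tens, prods_map hθ hS.carrier hT.carrier, perp_map hθ hc hn, perp_map hθ (hc.perp hn)
    (perp_prods_nonempty hXY hS.carrier hT.carrier hS.nonempty hT.nonempty
      hS.perp_nonempty hT.perp_nonempty), tens]

theorem disjoint_image (hXY : Disjoint X Y) (hθ : Set.InjOn θ (X ∪ Y : Finset V)) :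
    Disjoint (X.image θ) (Y.image θ) := by
  rw [Finset.disjoint_left] at hXY ⊢
  intro w hw hw'
  obtain ⟨x, hx, rfl⟩ := Finset.mem_image.1 hw
  obtain ⟨y, hy, hxy⟩ := Finset.mem_image.1 hw'
  have : y = x := hθ (by simp [hy]) (by simp [hx]) hxy
  exact hXY hx (this ▸ hy)

theorem impl_map [Infinite V] [Infinite W] (hXY : Disjoint X Y)
    (hθ : Set.InjOn θ (X ∪ Y : Finset V)) (hS : IsConduct S X) (hT : IsConduct T Y) :
    impl (EProject.map θ '' S) (EProject.map θ '' T) = EProject.map θ '' impl S T := by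
  have hX : Set.InjOn θ X := hθ.mono (by simp)
  have hY : Set.InjOn θ Y := hθ.mono (by simp)
  rw [impl_eq (disjoint_image hXY hθ) hS.carrier.map (hS.nonempty.image _) (hT.map hY),
    perp_map hY hT.carrier hT.nonempty, prods_map hθ hS.carrier hT.perp.carrier,
    perp_map hθ (hS.carrier.prods hXY hT.perp.carrier)
      (prods_nonempty hS.nonempty hT.perp_nonempty), impl_eq hXY hS.carrier hS.nonempty hT]

end Sets

end GoI

namespace GoI

/-! ## Conducts as sets of classes of projects -/

section Bridge

variable {V W : Type} [DecidableEq V] [DecidableEq W]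

theorem orth_eq (P : Set (Project V)) :
    orth P = EProject.ofProject ⁻¹' perp (EProject.ofProject '' P) := by
  ext b
  constructor
  · rintro hb _ ⟨a, ha, rfl⟩
    exact hb a ha
  · intro hb a ha
    exact hb _ ⟨a, ha, rfl⟩

/-- Elements orthogonal to something have finite wager, so they all come from projects. -/
theorem image_orth {P : Set (Project V)} (hP : P.Nonempty) :
    EProject.ofProject '' orth P = perp (EProject.ofProject '' P) := by
  rw [orth_eq, Set.image_preimage_eq_iff]
  intro b hb
  obtain ⟨a, ha⟩ := hP
  refine EProject.exists_ofProject ?_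
  have h := (hb _ ⟨a, ha, rfl⟩).2.2
  rw [mul_comm] at h
  exact ne_top_of_le_ne_top h (EProject.le_wager_mul_left _ _)

theorem IsConduct.image_preimage [Infinite V] {S : Set (EProject V)} {X : Finset V}
    (h : IsConduct S X) : EProject.ofProject '' (EProject.ofProject ⁻¹' S) = S := by
  rw [Set.image_preimage_eq_iff]
  exact fun a (ha : a ∈ S) => EProject.exists_ofProject (h.wager_ne_top ha)

namespace Conduct

/-- The classes of the projects of a conduct. -/
def set (A : Conduct V) : Set (EProject V) := EProject.ofProject '' A.projects

/-- A conduct is an orthogonal, hence closed under renaming of edges. -/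
theorem preimage_set (A : Conduct V) : EProject.ofProject ⁻¹' A.set = A.projects := by
  refine Set.Subset.antisymm (fun a ha => ?_) (Set.subset_preimage_image _ _)
  obtain ⟨b, hb, hab⟩ := ha
  rw [A.biorth, orth_eq] at hb ⊢
  rw [Set.mem_preimage, ← hab]
  exact hb

theorem isConduct [Infinite V] (A : Conduct V) : IsConduct A.set A.carrier := by
  refine ⟨A.nonempty.image _, ?_, ?_⟩
  · rintro _ ⟨a, ha, rfl⟩
    exact A.carrier_eq a ha
  · have hne : (orth A.projects).Nonempty := by
      by_contra hne
      rw [Set.not_nonempty_iff_eq_empty] at hne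
      obtain ⟨v, hv⟩ := Infinite.exists_notMem_finset A.carrier
      have hmem : Project.fax {v} id ∈ A.projects := by
        rw [A.biorth, hne]
        exact fun a ha => ha.elim
      have := A.carrier_eq _ hmem
      rw [← this] at hv
      exact hv (Finset.mem_union_left _ (Finset.mem_singleton_self v))
    rw [set, ← image_orth A.nonempty, ← image_orth hne, ← A.biorth]

/-- The conduct given by a set of classes of projects. -/
def ofSet [Infinite V] (S : Set (EProject V)) (X : Finset V) (h : IsConduct S X) : Conduct V where
  carrier := X
  projects := EProject.ofProject ⁻¹' S
  nonempty := by
    obtain ⟨a, ha⟩ := h.nonempty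
    obtain ⟨b, rfl⟩ := EProject.exists_ofProject (h.wager_ne_top ha)
    exact ⟨b, ha⟩
  carrier_eq := fun a ha => h.carrier _ ha
  biorth := by
    rw [orth_eq (EProject.ofProject ⁻¹' S), h.image_preimage, orth_eq, h.perp.image_preimage,
      h.biorth]

@[simp] theorem set_ofSet [Infinite V] (S : Set (EProject V)) (X : Finset V)
    (h : IsConduct S X) : (ofSet S X h).set = S := h.image_preimage

/-- The projects of a conduct, moved along `θ`. -/
def at_ (A : Conduct V) (θ : V → W) : Set (EProject W) := EProject.map θ '' A.set

theorem map_at {U : Type} [DecidableEq U] (A : Conduct V) (θ : V → W) (η : W → U) :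
    EProject.map η '' A.at_ θ = A.at_ (η ∘ θ) := by
  rw [at_, Set.image_image, at_]
  simp only [EProject.map_map]

theorem isConduct_at [Infinite V] (A : Conduct V) {θ : V → W} (hθ : Function.Injective θ) :
    IsConduct (A.at_ θ) (A.carrier.image θ) :=
  A.isConduct.map hθ.injOn

end Conduct

/-- An equality and not only an isomorphism, because relocation keeps the type of edges. It is
needed since the tensor product and the internal hom are sets of projects, not of classes. -/
theorem WGraph.deloc_deloc_eq {θ : V → W} {η : W → V} {G : WGraph W}
    (h : ∀ w ∈ G.verts, θ (η w) = w) : (G.deloc η).deloc θ = G := by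
  obtain ⟨verts, E, hE, src, tgt, weight, hs, ht, hw, hw'⟩ := G
  have h1 : (verts.image η).image θ = verts := by
    rw [Finset.image_image]
    exact (Finset.image_congr h).trans Finset.image_id
  have h2 : (fun e => θ (η (src e))) = src := funext fun e => h _ (hs e)
  have h3 : (fun e => θ (η (tgt e))) = tgt := funext fun e => h _ (ht e)
  simp only [WGraph.deloc, h1, h2, h3]

theorem deloc_image [Nonempty V] {S : Set (EProject V)} {X : Finset V} {θ : V → W}
    (hS : HasCarrier S X) (hθ : Set.InjOn θ X) :
    Project.deloc θ '' (EProject.ofProject ⁻¹' S) =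
      EProject.ofProject ⁻¹' (EProject.map θ '' S) := by
  ext q
  constructor
  · rintro ⟨a, ha, rfl⟩
    exact ⟨_, ha, rfl⟩
  · rintro ⟨s, hs, hsq⟩
    have hq : q.carrier = X.image θ := by
      rw [← EProject.carrier_ofProject, ← hsq, EProject.carrier_map, hS s hs]
    refine ⟨q.deloc (Function.invFunOn θ X), ?_, ?_⟩
    · change EProject.ofProject _ ∈ S
      rw [EProject.ofProject_deloc, ← hsq, EProject.map_invFunOn hθ (hS s hs).subset]
      exact hs
    · have : (q.graph.deloc (Function.invFunOn θ X)).deloc θ = q.graph := by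
        refine WGraph.deloc_deloc_eq fun w hw => ?_
        have hw' : w ∈ X.image θ := hq ▸ hw
        exact Function.invFunOn_eq (by simpa using hw')
      obtain ⟨w, G⟩ := q
      exact congrArg (Project.mk w) this

theorem lolli_eq {S T : Set (EProject V)} :
    lolli (EProject.ofProject ⁻¹' S) (EProject.ofProject ⁻¹' T) =
      {f | ∀ a, EProject.ofProject a ∈ S → f.measure a ≠ ⊤ ∧
        EProject.ofProject f * EProject.ofProject a ∈ T} := by
  ext f
  refine forall₂_congr fun a ha => and_congr_right fun h => ?_
  rw [← EProject.ofProject_cut h]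
  rfl

/-- That the cut is defined is automatic: its value lies in a conduct, where wagers are finite. -/
theorem lolli_eq_preimage [Infinite V] {S T : Set (EProject V)} {X Y : Finset V}
    (hS : IsConduct S X) (hT : IsConduct T Y) :
    lolli (EProject.ofProject ⁻¹' S) (EProject.ofProject ⁻¹' T) =
      EProject.ofProject ⁻¹' impl S T := by
  rw [lolli_eq]
  ext f
  constructor
  · intro hf a ha
    obtain ⟨a, rfl⟩ := EProject.exists_ofProject (hS.wager_ne_top ha)
    exact (hf a ha).2
  · intro hf a ha
    have := hf _ ha
    exact ⟨hT.wager_ne_top this, this⟩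

theorem tensorSet_eq_preimage [Infinite V] {S T : Set (EProject V)} {X Y : Finset V}
    (hXY : Disjoint X Y) (hS : IsConduct S X) (hT : IsConduct T Y) :
    tensorSet (EProject.ofProject ⁻¹' S) (EProject.ofProject ⁻¹' T) =
      EProject.ofProject ⁻¹' tens S T := by
  have hne := perp_prods_nonempty hXY hS.carrier hT.carrier hS.nonempty hT.nonempty
    hS.perp_nonempty hT.perp_nonempty
  have hpr : EProject.ofProject '' {c | ∃ a ∈ EProject.ofProject ⁻¹' S,
      ∃ b ∈ EProject.ofProject ⁻¹' T, c = a.tensor b} = prods S T := by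
    have key : ∀ a b : Project V, EProject.ofProject a ∈ S → EProject.ofProject b ∈ T →
        EProject.ofProject (a.tensor b) = EProject.ofProject a * EProject.ofProject b := by
      intro a b ha hb
      refine EProject.ofProject_tensor ?_
      have h1 := hS.carrier _ ha
      have h2 := hT.carrier _ hb
      rw [EProject.carrier_ofProject] at h1 h2
      rwa [h1, h2]
    ext x
    constructor
    · rintro ⟨_, ⟨a, ha, b, hb, rfl⟩, rfl⟩
      exact ⟨_, ha, _, hb, (key a b ha hb).symm⟩
    · rintro ⟨a, ha, b, hb, rfl⟩
      obtain ⟨a, rfl⟩ := EProject.exists_ofProject (hS.wager_ne_top ha)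
      obtain ⟨b, rfl⟩ := EProject.exists_ofProject (hT.wager_ne_top hb)
      exact ⟨_, ⟨a, ha, b, hb, rfl⟩, key a b ha hb⟩
  have hc := isConduct_perp (prods_nonempty hS.nonempty hT.nonempty)
    (hS.carrier.prods hXY hT.carrier) hne
  rw [tensorSet, orth_eq, orth_eq, hpr, hc.image_preimage]
  rfl

end Bridge

/-! ## Arrows -/

theorem psi_injective (i : ℕ) : Function.Injective (psi i) := fun _ _ h => congrArg Prod.fst h

/-- The map that is `α` on the locations `(x, 0)` and `β` on the locations `(x, 1)`. -/
def side {V : Type} (α β : ℕ → V) (p : ℕ × ℕ) : V := if p.2 = 0 then α p.1 else β p.1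

/-- Two injections of disjoint images. -/
structure Apart {V : Type} (α β : ℕ → V) : Prop where
  left : Function.Injective α
  right : Function.Injective β
  ne : ∀ x y, α x ≠ β y

theorem Apart.symm {V : Type} {α β : ℕ → V} (h : Apart α β) : Apart β α :=
  ⟨h.right, h.left, fun x y hxy => h.ne y x hxy.symm⟩

theorem Apart.comp {V : Type} {α β : ℕ → V} (h : Apart α β) {σ τ : ℕ → ℕ}
    (hσ : Function.Injective σ) (hτ : Function.Injective τ) : Apart (α ∘ σ) (β ∘ τ) :=
  ⟨h.left.comp hσ, h.right.comp hτ, fun _ _ => h.ne _ _⟩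

theorem Apart.comp_left {V W : Type} {α β : ℕ → V} (h : Apart α β) {η : V → W}
    (hη : Function.Injective η) : Apart (η ∘ α) (η ∘ β) :=
  ⟨hη.comp h.left, hη.comp h.right, fun x y hxy => h.ne x y (hη hxy)⟩

theorem apart_psi {i j : ℕ} (h : i ≠ j) : Apart (psi i) (psi j) :=
  ⟨psi_injective i, psi_injective j, fun _ _ hxy => h (congrArg Prod.snd hxy)⟩

theorem Apart.disjoint {V : Type} [DecidableEq V] {α β : ℕ → V} (h : Apart α β)
    (S T : Finset ℕ) : Disjoint (S.image α) (T.image β) := by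
  rw [Finset.disjoint_left]
  intro v hv hv'
  obtain ⟨x, -, rfl⟩ := Finset.mem_image.1 hv
  obtain ⟨y, -, hy⟩ := Finset.mem_image.1 hv'
  exact h.ne x y hy.symm

theorem Apart.notMem {V : Type} [DecidableEq V] {α β : ℕ → V} (h : Apart α β)
    (S T : Finset ℕ) (v : V) : v ∈ S.image α → v ∉ T.image β :=
  fun hv => Finset.disjoint_left.1 (h.disjoint S T) hv

/-- The vertices of an arrow. -/
def arrVerts (S T : Finset ℕ) : Finset (ℕ × ℕ) := S.image (psi 0) ∪ T.image (psi 1)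

theorem mem_arrVerts {S T : Finset ℕ} {p : ℕ × ℕ} :
    p ∈ arrVerts S T ↔ (∃ x ∈ S, p = (x, 0)) ∨ ∃ y ∈ T, p = (y, 1) := by
  unfold arrVerts
  rw [Finset.mem_union, Finset.mem_image, Finset.mem_image]
  simp only [psi, eq_comm]

section Side

variable {V W : Type} [DecidableEq V] [DecidableEq W] {S T U R : Finset ℕ}

theorem side_injOn {α β : ℕ → V} (h : Apart α β) (S T : Finset ℕ) :
    Set.InjOn (side α β) (arrVerts S T) := by
  intro p hp q hq hpq
  rcases mem_arrVerts.1 hp with ⟨x, -, rfl⟩ | ⟨x, -, rfl⟩ <;>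
    rcases mem_arrVerts.1 hq with ⟨y, -, rfl⟩ | ⟨y, -, rfl⟩
  · have : α x = α y := hpq
    rw [h.left this]
  · exact absurd hpq (h.ne x y)
  · exact absurd hpq.symm (h.ne y x)
  · have : β x = β y := hpq
    rw [h.right this]

theorem image_side (α β : ℕ → V) (S T : Finset ℕ) :
    (arrVerts S T).image (side α β) = S.image α ∪ T.image β := by
  rw [arrVerts, Finset.image_union, Finset.image_image, Finset.image_image]
  rfl

/-- An arrow from `S` to `T`, placed along `α` and `β`. -/
def rel (x : EProject (ℕ × ℕ)) (α β : ℕ → V) : EProject V := x.map (side α β)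

variable {x y : EProject (ℕ × ℕ)}

theorem carrier_rel (hx : x.carrier = arrVerts S T) (α β : ℕ → V) :
    (rel x α β).carrier = S.image α ∪ T.image β := by
  rw [rel, EProject.carrier_map, hx, image_side]

theorem rel_psi (hx : x.carrier = arrVerts S T) : rel x (psi 0) (psi 1) = x := by
  refine EProject.map_eq_self fun p hp => ?_
  rw [hx] at hp
  rcases mem_arrVerts.1 hp with ⟨z, -, rfl⟩ | ⟨z, -, rfl⟩ <;> rfl

theorem rel_rel (hx : x.carrier = arrVerts S T) (σ τ : ℕ → ℕ) (α β : ℕ → V) :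
    rel (rel x (psi 0 ∘ σ) (psi 1 ∘ τ)) α β = rel x (α ∘ σ) (β ∘ τ) := by
  unfold rel
  rw [EProject.map_map]
  refine EProject.map_congr fun p hp => ?_
  rw [hx] at hp
  rcases mem_arrVerts.1 hp with ⟨z, -, rfl⟩ | ⟨z, -, rfl⟩ <;> rfl

theorem map_rel (hx : x.carrier = arrVerts S T) (η : V → W) (α β : ℕ → V) :
    (rel x α β).map η = rel x (η ∘ α) (η ∘ β) := by
  unfold rel
  rw [EProject.map_map]
  refine EProject.map_congr fun p hp => ?_
  rw [hx] at hp
  rcases mem_arrVerts.1 hp with ⟨z, -, rfl⟩ | ⟨z, -, rfl⟩ <;> rfl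

theorem rel_injective {α β : ℕ → V} (h : Apart α β) (hx : x.carrier = arrVerts S T)
    (hy : y.carrier = arrVerts S T) (hxy : rel x α β = rel y α β) : x = y :=
  EProject.map_injOn (side_injOn h S T) hx.subset hy.subset hxy

theorem rel_link {ι : Type} (S : Finset ι) (s t : ι → ℕ) (α β : ℕ → V) :
    rel (EProject.link S (psi 0 ∘ s) (psi 1 ∘ t)) α β = EProject.link S (α ∘ s) (β ∘ t) :=
  EProject.map_link _ _ _ _

theorem carrier_link_psi (S : Finset ℕ) (s t : ℕ → ℕ) :
    (EProject.link S (psi 0 ∘ s) (psi 1 ∘ t)).carrier = arrVerts (S.image s) (S.image t) := by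
  rw [EProject.carrier_link, arrVerts, Finset.image_image, Finset.image_image]

theorem rel_mul_link {α β γ : ℕ → V} (hx : x.carrier = arrVerts S T) (h1 : Apart α β)
    (h2 : Apart α γ) (h3 : Apart β γ) :
    rel x α β * EProject.link T β γ = rel x α γ := by
  -- The link is reindexed by the vertices `(z, 1)` of the arrow, the form that `map_mul_link`
  -- absorbs.
  have hl : EProject.link T β γ = EProject.link (T.image (psi 1)) (side α β) (side α γ) :=
    (EProject.link_image (psi_injective 1).injOn (side α β) (side α γ)).symm
  rw [hl]
  refine EProject.map_mul_link ?_ ?_ ?_ ?_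
  · rw [hx]
    exact side_injOn h1 S T
  · rw [hx, arrVerts]
    exact Finset.subset_union_right
  · intro p hp hp'
    rw [hx, arrVerts, Finset.mem_union] at hp
    obtain ⟨z, -, rfl⟩ := Finset.mem_image.1 (hp.resolve_right hp')
    rfl
  · intro p hp
    obtain ⟨z, -, rfl⟩ := Finset.mem_image.1 hp
    rw [hx, image_side, Finset.mem_union, Finset.mem_image, Finset.mem_image]
    rintro (⟨u, -, hu⟩ | ⟨u, -, hu⟩)
    · exact h2.ne u z hu
    · exact h3.ne u z hu

theorem link_mul_rel {α β γ : ℕ → V} (hx : x.carrier = arrVerts S T) (h1 : Apart β γ)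
    (h2 : Apart α γ) (h3 : Apart α β) :
    EProject.link S α β * rel x β γ = rel x α γ := by
  rw [mul_comm, EProject.link_comm]
  have hl : EProject.link S β α = EProject.link (S.image (psi 0)) (side β γ) (side α γ) :=
    (EProject.link_image (psi_injective 0).injOn (side β γ) (side α γ)).symm
  rw [hl]
  refine EProject.map_mul_link ?_ ?_ ?_ ?_
  · rw [hx]
    exact side_injOn h1 S T
  · rw [hx, arrVerts]
    exact Finset.subset_union_left
  · intro p hp hp'
    rw [hx, arrVerts, Finset.mem_union] at hp
    obtain ⟨z, -, rfl⟩ := Finset.mem_image.1 (hp.resolve_left hp')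
    rfl
  · intro p hp
    obtain ⟨z, -, rfl⟩ := Finset.mem_image.1 hp
    rw [hx, image_side, Finset.mem_union, Finset.mem_image, Finset.mem_image]
    rintro (⟨u, -, hu⟩ | ⟨u, -, hu⟩)
    · exact h3.ne z u hu.symm
    · exact h2.ne z u hu.symm

/-- The composition. -/
noncomputable def compE (x y : EProject (ℕ × ℕ)) : EProject (ℕ × ℕ) := (x * y.map mu).map nu

/-- The map that is `α`, `β`, `γ` on the locations `(x, 0)`, `(x, 1)`, `(x, 2)`. -/
def side₃ (α β γ : ℕ → V) (p : ℕ × ℕ) : V :=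
  if p.2 = 0 then α p.1 else if p.2 = 1 then β p.1 else γ p.1

theorem mu_image (T U : Finset ℕ) :
    (arrVerts T U).image mu = T.image (psi 1) ∪ U.image (psi 2) := by
  rw [arrVerts, Finset.image_union, Finset.image_image, Finset.image_image]
  rfl

theorem carrier_mul_mu (hx : x.carrier = arrVerts S T) (hy : y.carrier = arrVerts T U) :
    (x * y.map mu).carrier = S.image (psi 0) ∪ U.image (psi 2) := by
  rw [EProject.carrier_mul, EProject.carrier_map, hx, hy, mu_image, arrVerts]
  have d1 := Finset.disjoint_left.1 ((apart_psi (i := 0) (j := 1) (by simp)).disjoint S T)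
  have d2 := Finset.disjoint_left.1 ((apart_psi (i := 0) (j := 2) (by simp)).disjoint S U)
  have d3 := Finset.disjoint_left.1 ((apart_psi (i := 1) (j := 2) (by simp)).disjoint T U)
  ext v
  have := @d1 v; have := @d2 v; have := @d3 v
  simp only [Finset.mem_symmDiff, Finset.mem_union]
  tauto

theorem carrier_compE (hx : x.carrier = arrVerts S T) (hy : y.carrier = arrVerts T U) :
    (compE x y).carrier = arrVerts S U := by
  rw [compE, EProject.carrier_map, carrier_mul_mu hx hy, Finset.image_union, Finset.image_image,
    Finset.image_image]
  rfl

/-- Wherever source, middle and target are placed, as long as they are apart, to compose is to cut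
along the middle, and `mu` and `nu` disappear. Identities between composites thus become identities
between products. -/
theorem rel_compE {α β γ : ℕ → V} (h1 : Apart α β) (h2 : Apart α γ) (h3 : Apart β γ)
    (hx : x.carrier = arrVerts S T) (hy : y.carrier = arrVerts T U) :
    rel (compE x y) α γ = rel x α β * rel y β γ := by
  -- The bound is necessary: `side₃` takes the values of `γ` for every second coordinate from 2 on.
  have hinj : Set.InjOn (side₃ α β γ) {p : ℕ × ℕ | p.2 ≤ 2} := by
    rintro ⟨a, i⟩ hi ⟨b, j⟩ hj hab
    change i ≤ 2 at hi
    change j ≤ 2 at hj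
    have l1 := @h1.left a b; have l2 := @h3.left a b; have l3 := @h3.right a b
    have n1 := h1.ne a b; have n2 := h2.ne a b; have n3 := h3.ne a b
    have m1 := h1.symm.ne a b; have m2 := h2.symm.ne a b; have m3 := h3.symm.ne a b
    interval_cases i <;> interval_cases j <;> simp_all [side₃]
  have e1 : rel (compE x y) α γ = (x * y.map mu).map (side₃ α β γ) := by
    rw [rel, compE, EProject.map_map]
    refine EProject.map_congr fun p hp => ?_
    rw [carrier_mul_mu hx hy, Finset.mem_union, Finset.mem_image, Finset.mem_image] at hp
    rcases hp with ⟨z, -, rfl⟩ | ⟨z, -, rfl⟩ <;> rfl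
  rw [e1, EProject.map_mul, EProject.map_map]
  · congr 1
    · refine EProject.map_congr fun p hp => ?_
      rw [hx] at hp
      rcases mem_arrVerts.1 hp with ⟨z, -, rfl⟩ | ⟨z, -, rfl⟩ <;> rfl
    · refine EProject.map_congr fun p hp => ?_
      rw [hy] at hp
      rcases mem_arrVerts.1 hp with ⟨z, -, rfl⟩ | ⟨z, -, rfl⟩ <;> rfl
  · refine hinj.mono ?_
    intro p hp
    rw [Finset.mem_coe, Finset.mem_union, hx, EProject.carrier_map, hy, mu_image,
      Finset.mem_union, mem_arrVerts, Finset.mem_image, Finset.mem_image] at hp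
    rcases hp with (⟨z, -, rfl⟩ | ⟨z, -, rfl⟩) | ⟨z, -, rfl⟩ | ⟨z, -, rfl⟩ <;>
      simp [psi]

/-- The four objects are placed at `psi 0`, …, `psi 3`; each location then belongs to at most two of
the three arrows, so the cut is associative. -/
theorem compE_assoc {z : EProject (ℕ × ℕ)} (hx : x.carrier = arrVerts S T)
    (hy : y.carrier = arrVerts T U) (hz : z.carrier = arrVerts U R) :
    compE (compE x y) z = compE x (compE y z) := by
  have a01 := apart_psi (i := 0) (j := 1) (by simp)
  have a02 := apart_psi (i := 0) (j := 2) (by simp)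
  have a03 := apart_psi (i := 0) (j := 3) (by simp)
  have a12 := apart_psi (i := 1) (j := 2) (by simp)
  have a13 := apart_psi (i := 1) (j := 3) (by simp)
  have a23 := apart_psi (i := 2) (j := 3) (by simp)
  refine rel_injective a03 (carrier_compE (carrier_compE hx hy) hz)
    (carrier_compE hx (carrier_compE hy hz)) ?_
  rw [rel_compE a02 a03 a23 (carrier_compE hx hy) hz, rel_compE a01 a02 a12 hx hy,
    rel_compE a01 a03 a13 hx (carrier_compE hy hz), rel_compE a12 a13 a23 hy hz]
  refine EProject.mul_assoc_of_tri fun v => ?_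
  rw [carrier_rel hx, carrier_rel hy, carrier_rel hz]
  have d1 := a01.notMem S T v
  have d2 := a02.notMem S U v
  have d3 := a03.notMem S R v
  have d4 := a12.notMem T U v
  have d5 := a13.notMem T R v
  have d6 := a23.notMem U R v
  simp only [Finset.mem_union]
  tauto

/-- Postcomposition with a link moves the target; with both maps the identity this is a unit law. -/
theorem compE_link {σ τ : ℕ → ℕ} (hσ : Function.Injective σ) (hτ : Function.Injective τ)
    (hx : x.carrier = arrVerts S T) :
    compE (rel x (psi 0) (psi 1 ∘ σ)) (EProject.link T (psi 0 ∘ σ) (psi 1 ∘ τ)) =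
      rel x (psi 0) (psi 1 ∘ τ) := by
  have a01 := apart_psi (i := 0) (j := 1) (by simp)
  have a02 := apart_psi (i := 0) (j := 2) (by simp)
  have a12 := apart_psi (i := 1) (j := 2) (by simp)
  have c : ∀ σ : ℕ → ℕ, (rel x (psi 0) (psi 1 ∘ σ)).carrier = arrVerts S (T.image σ) := by
    intro σ
    rw [carrier_rel hx, arrVerts, Finset.image_image]
  refine rel_injective a02 (carrier_compE (c σ) (carrier_link_psi _ _ _)) (c τ) ?_
  rw [rel_compE a01 a02 a12 (c σ) (carrier_link_psi _ _ _), rel_link]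
  have r := fun σ => rel_rel (V := ℕ × ℕ) hx id σ
  simp only [Function.comp_id] at r
  rw [r, r]
  exact rel_mul_link hx (a01.comp Function.injective_id hσ) (a02.comp Function.injective_id hτ)
    (a12.comp hσ hτ)

theorem link_compE {σ τ : ℕ → ℕ} (hσ : Function.Injective σ) (hτ : Function.Injective τ)
    (hx : x.carrier = arrVerts S T) :
    compE (EProject.link S (psi 0 ∘ σ) (psi 1 ∘ τ)) (rel x (psi 0 ∘ τ) (psi 1)) =
      rel x (psi 0 ∘ σ) (psi 1) := by
  have a01 := apart_psi (i := 0) (j := 1) (by simp)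
  have a02 := apart_psi (i := 0) (j := 2) (by simp)
  have a12 := apart_psi (i := 1) (j := 2) (by simp)
  have c : ∀ σ : ℕ → ℕ, (rel x (psi 0 ∘ σ) (psi 1)).carrier = arrVerts (S.image σ) T := by
    intro σ
    rw [carrier_rel hx, arrVerts, Finset.image_image]
  refine rel_injective a02 (carrier_compE (carrier_link_psi _ _ _) (c τ)) (c σ) ?_
  rw [rel_compE a01 a02 a12 (carrier_link_psi _ _ _) (c τ), rel_link]
  have r := fun σ => rel_rel (V := ℕ × ℕ) hx σ id
  simp only [Function.comp_id] at r
  rw [r, r]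
  exact link_mul_rel hx (a12.comp hτ Function.injective_id) (a02.comp hσ Function.injective_id)
    (a01.comp hσ hτ)

end Side

end GoI

namespace GoI

/-! ## The classes of the arrows -/

/-- The classes of the arrows between two conducts. -/
def arrows (A B : Obj) : Set (EProject (ℕ × ℕ)) := impl (A.at_ (psi 0)) (B.at_ (psi 1))

theorem isConduct_impl_at {V : Type} [DecidableEq V] [Infinite V] {α β : ℕ → V} (h : Apart α β)
    (A B : Obj) :
    IsConduct (impl (A.at_ α) (B.at_ β)) (A.carrier.image α ∪ B.carrier.image β) :=
  (A.isConduct_at h.left).impl (h.disjoint _ _) (B.isConduct_at h.right)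

theorem isConduct_tens_at {V : Type} [DecidableEq V] [Infinite V] {α β : ℕ → V} (h : Apart α β)
    (A B : Obj) :
    IsConduct (tens (A.at_ α) (B.at_ β)) (A.carrier.image α ∪ B.carrier.image β) :=
  (A.isConduct_at h.left).tens (h.disjoint _ _) (B.isConduct_at h.right)

theorem apart_psi_zero_one : Apart (psi 0) (psi 1) := apart_psi (by simp)

theorem isConduct_arrows (A B : Obj) :
    IsConduct (arrows A B) (arrVerts A.carrier B.carrier) :=
  isConduct_impl_at apart_psi_zero_one A B

theorem image_at {W : Type} [DecidableEq W] (A : Obj) {θ : ℕ → W} (hθ : Function.Injective θ) :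
    Project.deloc θ '' A.projects = EProject.ofProject ⁻¹' A.at_ θ := by
  rw [← A.preimage_set, deloc_image A.isConduct.carrier hθ.injOn, Conduct.at_]

theorem morphisms_eq (A B : Obj) : morphisms A B = EProject.ofProject ⁻¹' arrows A B := by
  rw [morphisms, image_at A (psi_injective 0), image_at B (psi_injective 1),
    lolli_eq_preimage (A.isConduct_at (psi_injective 0)) (B.isConduct_at (psi_injective 1)), arrows]

section Placed

variable {V : Type} [DecidableEq V] {A B C D : Obj} {α β γ : ℕ → V}
  {x y : EProject (ℕ × ℕ)}

theorem image_rel [Infinite V] (h : Apart α β) (A B : Obj) :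
    (fun x => rel x α β) '' arrows A B = impl (A.at_ α) (B.at_ β) := by
  have := impl_map (apart_psi_zero_one.disjoint A.carrier B.carrier) (side_injOn h _ _)
    (A.isConduct_at (psi_injective 0)) (B.isConduct_at (psi_injective 1))
  rw [Conduct.map_at, Conduct.map_at] at this
  exact this.symm

theorem rel_mem [Infinite V] (h : Apart α β) (hx : x ∈ arrows A B) :
    rel x α β ∈ impl (A.at_ α) (B.at_ β) := by
  rw [← image_rel h]
  exact ⟨x, hx, rfl⟩

theorem mem_arrows_of_rel [Infinite V] (h : Apart α β) (hc : x.carrier = arrVerts A.carrier B.carrier)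
    (hx : rel x α β ∈ impl (A.at_ α) (B.at_ β)) : x ∈ arrows A B := by
  rw [← image_rel h] at hx
  obtain ⟨y, hy, hyx⟩ := hx
  rwa [← rel_injective h ((isConduct_arrows A B).carrier y hy) hc hyx]

theorem compE_mem (hx : x ∈ arrows A B) (hy : y ∈ arrows B C) : compE x y ∈ arrows A C := by
  have a01 := apart_psi (i := 0) (j := 1) (by simp)
  have a02 := apart_psi (i := 0) (j := 2) (by simp)
  have a12 := apart_psi (i := 1) (j := 2) (by simp)
  have cx := (isConduct_arrows A B).carrier x hx
  have cy := (isConduct_arrows B C).carrier y hy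
  refine mem_arrows_of_rel a02 (carrier_compE cx cy) ?_
  rw [rel_compE a01 a02 a12 cx cy]
  have iA := A.isConduct_at (psi_injective 0)
  have iB := B.isConduct_at (psi_injective 1)
  have iC := C.isConduct_at (psi_injective 2)
  exact mul_mem_impl (a01.disjoint _ _) (a02.disjoint _ _) (a12.disjoint _ _) iA.carrier
    iA.nonempty iB.carrier iB.nonempty iC.carrier (rel_mem a01 hx) (rel_mem a12 hy)

/-- An element placed along `α` absorbs the link and moves to `β`. Identities and all relocations of
objects are morphisms for this reason. -/
theorem link_mem_impl {S : Set (EProject ℕ)} {X : Finset ℕ} (hS : HasCarrier S X)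
    (h : Apart α β) :
    EProject.link X α β ∈ impl (EProject.map α '' S) (EProject.map β '' S) := by
  rintro _ ⟨a, ha, rfl⟩
  refine ⟨a, ha, ?_⟩
  have hc := hS a ha
  rw [mul_comm]
  refine (EProject.map_mul_link h.left.injOn hc.symm.subset (fun u hu hu' => ?_) ?_).symm
  · exact absurd (hc ▸ hu) hu'
  · intro u _ hu
    obtain ⟨v, -, hv⟩ := Finset.mem_image.1 hu
    exact h.ne v u hv

end Placed

/-! ### The tensor product of arrows -/

/-- The even locations. -/
def ev (x : ℕ) : ℕ := 2 * x

/-- The odd locations. -/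
def od (x : ℕ) : ℕ := 2 * x + 1

theorem apart_ev_od : Apart ev od :=
  ⟨fun x y h => by simp only [ev] at h; omega, fun x y h => by simp only [od] at h; omega,
    fun x y h => by simp only [ev, od] at h; omega⟩

/-- The tensor product of arrows. -/
noncomputable def tensE (x y : EProject (ℕ × ℕ)) : EProject (ℕ × ℕ) :=
  rel x (psi 0 ∘ ev) (psi 1 ∘ ev) * rel y (psi 0 ∘ od) (psi 1 ∘ od)

section TensE

variable {V : Type} [DecidableEq V] {S T S' T' U U' : Finset ℕ} {α β : ℕ → V}
  {x y x' y' : EProject (ℕ × ℕ)}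

theorem disjoint_rel (hx : x.carrier = arrVerts S T) (hy : y.carrier = arrVerts S' T')
    {α β α' β' : ℕ → V} (h1 : Apart α α') (h2 : Apart α β') (h3 : Apart β α')
    (h4 : Apart β β') : Disjoint (rel x α β).carrier (rel y α' β').carrier := by
  rw [carrier_rel hx, carrier_rel hy, Finset.disjoint_union_left, Finset.disjoint_union_right,
    Finset.disjoint_union_right]
  exact ⟨⟨h1.disjoint _ _, h2.disjoint _ _⟩, h3.disjoint _ _, h4.disjoint _ _⟩

theorem disjoint_rel_ev_od (h : Apart α β) (hx : x.carrier = arrVerts S T)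
    (hy : y.carrier = arrVerts S' T') :
    Disjoint (rel x (α ∘ ev) (β ∘ ev)).carrier (rel y (α ∘ od) (β ∘ od)).carrier :=
  disjoint_rel hx hy (apart_ev_od.comp_left h.left)
    (h.comp apart_ev_od.left apart_ev_od.right)
    (h.symm.comp apart_ev_od.left apart_ev_od.right) (apart_ev_od.comp_left h.right)

theorem EProject.carrier_mul_of_disjoint {x y : EProject V} (h : Disjoint x.carrier y.carrier) :
    (x * y).carrier = x.carrier ∪ y.carrier := by
  rw [EProject.carrier_mul]
  exact h.symmDiff_eq_sup

theorem carrier_tensE (hx : x.carrier = arrVerts S T) (hy : y.carrier = arrVerts S' T') :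
    (tensE x y).carrier = arrVerts (S.image ev ∪ S'.image od) (T.image ev ∪ T'.image od) := by
  rw [tensE, EProject.carrier_mul_of_disjoint (disjoint_rel_ev_od apart_psi_zero_one hx hy),
    carrier_rel hx, carrier_rel hy, arrVerts, Finset.image_union, Finset.image_union,
    Finset.image_image, Finset.image_image, Finset.image_image, Finset.image_image,
    Finset.union_union_union_comm]

theorem rel_tensE (h : Apart α β) (hx : x.carrier = arrVerts S T)
    (hy : y.carrier = arrVerts S' T') :
    rel (tensE x y) α β = rel x (α ∘ ev) (β ∘ ev) * rel y (α ∘ od) (β ∘ od) := by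
  have hd := disjoint_rel_ev_od apart_psi_zero_one hx hy
  rw [← rel_rel hx, ← rel_rel hy]
  refine EProject.map_mul ?_
  rw [← EProject.carrier_mul_of_disjoint hd, ← tensE, carrier_tensE hx hy]
  exact side_injOn h _ _

/-- Even and odd locations never meet, so the four placed factors can be regrouped. -/
theorem compE_tensE (hx : x.carrier = arrVerts S T) (hy : y.carrier = arrVerts S' T')
    (hx' : x'.carrier = arrVerts T U) (hy' : y'.carrier = arrVerts T' U') :
    compE (tensE x y) (tensE x' y') = tensE (compE x x') (compE y y') := by
  have a01 := apart_psi (i := 0) (j := 1) (by simp)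
  have a02 := apart_psi (i := 0) (j := 2) (by simp)
  have a12 := apart_psi (i := 1) (j := 2) (by simp)
  have hee : ∀ i j : ℕ, i ≠ j → Apart (psi i ∘ ev) (psi j ∘ ev) := fun i j h =>
    (apart_psi h).comp apart_ev_od.left apart_ev_od.left
  have hoo : ∀ i j : ℕ, i ≠ j → Apart (psi i ∘ od) (psi j ∘ od) := fun i j h =>
    (apart_psi h).comp apart_ev_od.right apart_ev_od.right
  have hoe : ∀ i j : ℕ, Apart (psi i ∘ ev) (psi j ∘ od) := fun i j => by
    by_cases h : i = j
    · subst h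
      exact apart_ev_od.comp_left (psi_injective i)
    · exact (apart_psi h).comp apart_ev_od.left apart_ev_od.right
  have c1 := carrier_tensE hx hy
  have c2 := carrier_tensE hx' hy'
  refine rel_injective a02 (carrier_compE c1 c2)
    (carrier_tensE (carrier_compE hx hx') (carrier_compE hy hy')) ?_
  rw [rel_compE a01 a02 a12 c1 c2, rel_tensE a01 hx hy, rel_tensE a12 hx' hy',
    rel_tensE a02 (carrier_compE hx hx') (carrier_compE hy hy'),
    rel_compE (hee 0 1 (by simp)) (hee 0 2 (by simp)) (hee 1 2 (by simp)) hx hx',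
    rel_compE (hoo 0 1 (by simp)) (hoo 0 2 (by simp)) (hoo 1 2 (by simp)) hy hy']
  have d1 := disjoint_rel_ev_od a01 hx hy
  have d2 := disjoint_rel_ev_od a12 hx' hy'
  exact EProject.mul_mul_mul_comm_of_tri (fun v h h' => absurd h' (Finset.disjoint_left.1 d1 h))
    (fun v h h' => absurd h' (Finset.disjoint_left.1 d1 h)) (tri_of_disjoint d2)
    (tri_of_disjoint d2)

end TensE

/-! ### Classes of projects -/

/-- The inclusion of the classes of projects into the extended classes. -/
def clsE {V : Type} : ProjectClass V → EProject V :=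
  Quotient.lift EProject.ofProject fun _ _ h => EProject.ofProject_eq_iff.2 h

theorem clsE_injective {V : Type} : Function.Injective (clsE (V := V)) := by
  intro x y
  induction x using Quotient.inductionOn
  induction y using Quotient.inductionOn
  exact fun h => Quotient.sound (EProject.ofProject_eq_iff.1 h)

theorem clsE_idClass (S : Finset ℕ) : clsE (idClass S) = EProject.link S (psi 0) (psi 1) := by
  change EProject.ofProject (Project.fax _ _) = _
  rw [EProject.ofProject_fax, EProject.link_image (psi_injective 0).injOn]
  rfl

/-- The hypothesis excludes the value `0` that `toNNReal` gives to an undefined cut. -/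
theorem clsE_compClass {x y : ProjectClass (ℕ × ℕ)} (h : (compE (clsE x) (clsE y)).wager ≠ ⊤) :
    clsE (compClass x y) = compE (clsE x) (clsE y) := by
  induction x using Quotient.inductionOn with
  | h f =>
    induction y using Quotient.inductionOn with
    | h g =>
      have h' : f.measure (g.deloc mu) ≠ ⊤ := by
        rwa [compE, EProject.wager_map] at h
      change (EProject.ofProject (f.cut (g.deloc mu))).map nu = _
      rw [EProject.ofProject_cut h']
      rfl

theorem tau_injective : Function.Injective tau := by
  have h : ∀ p, tau (tau p) = p := by
    rintro ⟨x, i⟩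
    simp only [tau]
    split_ifs <;> simp_all <;> omega
  exact fun p q hpq => by rw [← h p, hpq, h]

/-- On the vertices of arrows, `tau ∘ psi 0 ∘ phi` sends `(x, i)` to `(2x, i)` and `tau ∘ psi 1 ∘
phi` sends it to `(2x + 1, i)`: the two factors sit on even and on odd locations. -/
theorem clsE_tensorHomClass {x y : ProjectClass (ℕ × ℕ)} {S T S' T' : Finset ℕ}
    (hx : (clsE x).carrier = arrVerts S T) (hy : (clsE y).carrier = arrVerts S' T') :
    clsE (tensorHomClass x y) = tensE (clsE x) (clsE y) := by
  have hd : Disjoint (((clsE x).map phi).map (psi 0)).carrier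
      (((clsE y).map phi).map (psi 1)).carrier := by
    rw [EProject.carrier_map, EProject.carrier_map (psi 1)]
    exact apart_psi_zero_one.disjoint _ _
  have e1 : (((clsE x).map phi).map (psi 0)).map tau = rel (clsE x) (psi 0 ∘ ev) (psi 1 ∘ ev) := by
    rw [EProject.map_map, EProject.map_map]
    refine EProject.map_congr fun p hp => ?_
    rw [hx] at hp
    rcases mem_arrVerts.1 hp with ⟨z, -, rfl⟩ | ⟨z, -, rfl⟩ <;>
      simp [side, tau, psi, phi, ev]
  have e2 : (((clsE y).map phi).map (psi 1)).map tau = rel (clsE y) (psi 0 ∘ od) (psi 1 ∘ od) := by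
    rw [EProject.map_map, EProject.map_map]
    refine EProject.map_congr fun p hp => ?_
    rw [hy] at hp
    rcases mem_arrVerts.1 hp with ⟨z, -, rfl⟩ | ⟨z, -, rfl⟩ <;>
      simp [side, tau, psi, phi, od]
  rw [tensE, ← e1, ← e2, ← EProject.map_mul tau_injective.injOn]
  induction x using Quotient.inductionOn with
  | h f =>
    induction y using Quotient.inductionOn with
    | h g =>
      exact congrArg (EProject.map tau) (EProject.ofProject_tensor
        (a := (f.deloc phi).deloc (psi 0)) (b := (g.deloc phi).deloc (psi 1)) hd)

/-! ### The category -/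

theorem exists_morphism_iff {A B : Obj} {c : ProjectClass (ℕ × ℕ)} :
    (∃ f ∈ morphisms A B, ⟦f⟧ = c) ↔ clsE c ∈ arrows A B := by
  rw [morphisms_eq]
  constructor
  · rintro ⟨f, hf, rfl⟩
    exact hf
  · induction c using Quotient.inductionOn with
    | h f => exact fun hf => ⟨f, hf, rfl⟩

namespace Hom

/-- The extended class of a morphism. -/
def val {A B : Obj} (f : Hom A B) : EProject (ℕ × ℕ) := clsE f.cls

variable {A B C : Obj}

theorem val_mem (f : Hom A B) : f.val ∈ arrows A B := exists_morphism_iff.1 f.mem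

theorem carrier_val (f : Hom A B) : f.val.carrier = arrVerts A.carrier B.carrier :=
  (isConduct_arrows A B).carrier _ f.val_mem

theorem val_injective {f g : Hom A B} (h : f.val = g.val) : f = g :=
  Hom.ext (clsE_injective h)

theorem exists_val {x : EProject (ℕ × ℕ)} (hx : x ∈ arrows A B) : ∃ f : Hom A B, f.val = x := by
  obtain ⟨f, rfl⟩ := EProject.exists_ofProject ((isConduct_arrows A B).wager_ne_top hx)
  exact ⟨⟨⟦f⟧, exists_morphism_iff.2 hx⟩, rfl⟩

/-- The morphism of given extended class. -/
noncomputable def mkE (x : EProject (ℕ × ℕ)) (hx : x ∈ arrows A B) : Hom A B :=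
  (exists_val hx).choose

@[simp] theorem val_mkE (x : EProject (ℕ × ℕ)) (hx : x ∈ arrows A B) : (mkE x hx).val = x :=
  (exists_val hx).choose_spec

theorem clsE_comp (f : Hom A B) (g : Hom B C) :
    clsE (compClass f.cls g.cls) = compE f.val g.val :=
  clsE_compClass ((isConduct_arrows A C).wager_ne_top (compE_mem f.val_mem g.val_mem))

end Hom

theorem id_mem_arrows (A : Obj) : EProject.link A.carrier (psi 0) (psi 1) ∈ arrows A A :=
  link_mem_impl A.isConduct.carrier apart_psi_zero_one

theorem id_compE {x : EProject (ℕ × ℕ)} {S T : Finset ℕ} (hx : x.carrier = arrVerts S T) :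
    compE (EProject.link S (psi 0) (psi 1)) x = x := by
  have := link_compE Function.injective_id Function.injective_id hx
  simpa only [Function.comp_id, rel_psi hx] using this

theorem compE_id {x : EProject (ℕ × ℕ)} {S T : Finset ℕ} (hx : x.carrier = arrVerts S T) :
    compE x (EProject.link T (psi 0) (psi 1)) = x := by
  have := compE_link Function.injective_id Function.injective_id hx
  simpa only [Function.comp_id, rel_psi hx] using this

theorem formCategory : FormCategory where
  id_mem A := exists_morphism_iff.2 (by rw [clsE_idClass]; exact id_mem_arrows A)
  comp_defined := by
    intro A B C f hf g hg
    rw [morphisms_eq] at hf hg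
    have := (isConduct_arrows A C).wager_ne_top (compE_mem hf hg)
    rwa [compE, EProject.wager_map] at this
  comp_mem f g := exists_morphism_iff.2 (by
    rw [f.clsE_comp g]
    exact compE_mem f.val_mem g.val_mem)
  id_comp {A B} f := clsE_injective (by
    have h := id_compE f.carrier_val
    have hw : (compE (clsE (idClass A.carrier)) f.val).wager ≠ ⊤ := by
      rw [clsE_idClass, h]
      exact (isConduct_arrows A B).wager_ne_top f.val_mem
    rw [clsE_compClass hw, clsE_idClass]
    exact h)
  comp_id {A B} f := clsE_injective (by
    have h := compE_id f.carrier_val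
    have hw : (compE f.val (clsE (idClass B.carrier))).wager ≠ ⊤ := by
      rw [clsE_idClass, h]
      exact (isConduct_arrows A B).wager_ne_top f.val_mem
    rw [clsE_compClass hw, clsE_idClass]
    exact h)
  assoc {A B C D} f g k := clsE_injective (by
    have h := compE_assoc f.carrier_val g.carrier_val k.carrier_val
    have hfg := compE_mem f.val_mem g.val_mem
    have hgk := compE_mem g.val_mem k.val_mem
    have h1 := (isConduct_arrows A D).wager_ne_top (compE_mem hfg k.val_mem)
    have h2 := (isConduct_arrows A D).wager_ne_top (compE_mem f.val_mem hgk)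
    rw [clsE_compClass (by rw [f.clsE_comp g]; exact h1),
      clsE_compClass (y := compClass g.cls k.cls) (by rw [g.clsE_comp k]; exact h2),
      f.clsE_comp g, g.clsE_comp k]
    exact h)

end GoI

namespace GoI

noncomputable scoped instance category : Category.{1} Obj := conductCategory formCategory

/-! ## The objects -/

/-- The tensor product of objects. -/
noncomputable def tensorOb (A B : Obj) : Obj :=
  Conduct.ofSet _ _ (isConduct_tens_at apart_ev_od A B)

/-- The internal hom. -/
noncomputable def homOb (A B : Obj) : Obj :=
  Conduct.ofSet _ _ (isConduct_impl_at apart_ev_od A B)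

theorem hasCarrier_one {V : Type} : HasCarrier ({1} : Set (EProject V)) ∅ := by
  rintro _ rfl
  rfl

/-! ### The unit and its orthogonal -/

section Units

variable {V W : Type} [DecidableEq V] [DecidableEq W]

theorem perp_one_nonempty : (perp ({1} : Set (EProject V))).Nonempty := by
  refine ⟨⟨1, ⟦WGraph.empty V⟧⟩, ?_⟩
  rintro _ rfl
  refine ⟨rfl, ?_⟩
  rw [EProject.one_mul]
  exact ⟨one_ne_zero, ENNReal.one_ne_top⟩

/-- The empty project has measure 0 against itself; this is what separates 1 from ⊥. -/
theorem one_notMem_perp_one : (1 : EProject V) ∉ perp {1} := fun h => (h 1 rfl).2.1 (by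
  rw [EProject.one_mul]
  rfl)

theorem isConduct_perp_one : IsConduct (perp ({1} : Set (EProject V))) ∅ :=
  isConduct_perp (Set.singleton_nonempty 1) hasCarrier_one perp_one_nonempty

theorem isConduct_perp_perp_one : IsConduct (perp (perp ({1} : Set (EProject V)))) ∅ :=
  isConduct_perp_perp (Set.singleton_nonempty 1) hasCarrier_one perp_one_nonempty

/-- With an empty carrier there is nothing to move, so the units look the same at every place. -/
theorem map_perp_one [Nonempty V] (θ : V → W) : EProject.map θ '' perp {1} = perp {1} := by
  have h := perp_map (θ := θ) (by simp) (hasCarrier_one (V := V)) (Set.singleton_nonempty 1)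
  rwa [Set.image_singleton, EProject.map_one, eq_comm] at h

theorem map_perp_perp_one [Nonempty V] (θ : V → W) :
    EProject.map θ '' perp (perp {1}) = perp (perp {1}) := by
  rw [← perp_map (by simp) isConduct_perp_one.carrier isConduct_perp_one.nonempty, map_perp_one]

theorem prods_one (S : Set (EProject V)) : prods S {1} = S := by
  ext x
  constructor
  · rintro ⟨a, ha, _, rfl, rfl⟩
    change a * 1 ∈ S
    rwa [EProject.mul_one]
  · exact fun hx => ⟨x, hx, 1, rfl, EProject.mul_one x⟩

theorem perp_prods_unit [Infinite V] {S : Set (EProject V)} {X : Finset V} (hS : IsConduct S X) :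
    perp (prods S (perp (perp {1}))) = perp S := by
  rw [perp_prods_biorth_right (Finset.disjoint_empty_right X) hS.carrier hasCarrier_one hS.nonempty
    (Set.singleton_nonempty 1) perp_one_nonempty, prods_one]

theorem tens_unit [Infinite V] {S : Set (EProject V)} {X : Finset V} (hS : IsConduct S X) :
    tens S (perp (perp {1})) = S := by
  rw [tens, perp_prods_unit hS, hS.biorth]

/-- This is the source of the duality: up to relocation, implication into ⊥ is the orthogonal. -/
theorem impl_perp_one [Infinite V] {S : Set (EProject V)} {X : Finset V} (hS : IsConduct S X) :
    impl S (perp {1}) = perp S := by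
  rw [impl_eq (Finset.disjoint_empty_right X) hS.carrier hS.nonempty isConduct_perp_one,
    perp_prods_unit hS]

end Units

/-- The unit. -/
noncomputable def unitOb : Obj := Conduct.ofSet _ _ isConduct_perp_perp_one

/-- The orthogonal of the unit. -/
noncomputable def botOb : Obj := Conduct.ofSet _ _ isConduct_perp_one

section At

variable {V : Type} [DecidableEq V] {θ : ℕ → V}

theorem at_tensorOb (A B : Obj) (hθ : Function.Injective θ) :
    (tensorOb A B).at_ θ = tens (A.at_ (θ ∘ ev)) (B.at_ (θ ∘ od)) := by
  rw [Conduct.at_, tensorOb, Conduct.set_ofSet, ← tens_map (apart_ev_od.disjoint _ _) hθ.injOn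
    (A.isConduct_at apart_ev_od.left) (B.isConduct_at apart_ev_od.right), Conduct.map_at,
    Conduct.map_at]

theorem at_homOb [Infinite V] (A B : Obj) (hθ : Function.Injective θ) :
    (homOb A B).at_ θ = impl (A.at_ (θ ∘ ev)) (B.at_ (θ ∘ od)) := by
  rw [Conduct.at_, homOb, Conduct.set_ofSet, ← impl_map (apart_ev_od.disjoint _ _) hθ.injOn
    (A.isConduct_at apart_ev_od.left) (B.isConduct_at apart_ev_od.right), Conduct.map_at,
    Conduct.map_at]

theorem at_unitOb : unitOb.at_ θ = perp (perp {1}) := by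
  rw [Conduct.at_, unitOb, Conduct.set_ofSet, map_perp_perp_one]

theorem at_botOb : botOb.at_ θ = perp {1} := by
  rw [Conduct.at_, botOb, Conduct.set_ofSet, map_perp_one]

end At

theorem ofProject_unit : EProject.ofProject (Project.unit ℕ) = 1 :=
  EProject.eq_of_carrier_eq_empty rfl

theorem projects_unitOb : unitOb.projects = orth (orth {Project.unit ℕ}) := by
  rw [orth_eq, image_orth (Set.singleton_nonempty _), Set.image_singleton, ofProject_unit]
  rfl

theorem projects_botOb_eq_orth : botOb.projects = orth unitOb.projects := by
  rw [orth_eq]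
  change _ = EProject.ofProject ⁻¹' perp unitOb.set
  rw [unitOb, Conduct.set_ofSet, perp_perp_perp]
  rfl

theorem botOb_ne_unitOb : botOb ≠ unitOb := by
  intro h
  have h1 : botOb.set = unitOb.set := by rw [h]
  rw [botOb, unitOb, Conduct.set_ofSet, Conduct.set_ofSet] at h1
  refine one_notMem_perp_one (V := ℕ) ?_
  rw [h1]
  exact subset_perp_perp {1} rfl

theorem phi_injOn (S T : Finset ℕ) :
    Set.InjOn phi (S.image (psi 0) ∪ T.image (psi 1) : Finset _) := by
  rintro ⟨x, i⟩ hx ⟨y, j⟩ hy hxy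
  simp only [Finset.coe_union, Finset.coe_image, Set.mem_union, Set.mem_image, psi,
    Prod.mk.injEq] at hx hy
  have hi : i = 0 ∨ i = 1 := hx.imp (fun ⟨_, h⟩ => h.2.2.symm) fun ⟨_, h⟩ => h.2.2.symm
  have hj : j = 0 ∨ j = 1 := hy.imp (fun ⟨_, h⟩ => h.2.2.symm) fun ⟨_, h⟩ => h.2.2.symm
  simp only [phi] at hxy
  rw [Prod.mk.injEq]
  omega

theorem projects_tensorOb (A B : Obj) : (tensorOb A B).projects = tensorObjSet A B := by
  have hA := A.isConduct_at (psi_injective 0)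
  have hB := B.isConduct_at (psi_injective 1)
  have hd := apart_psi_zero_one.disjoint A.carrier B.carrier
  rw [tensorObjSet, image_at A (psi_injective 0), image_at B (psi_injective 1),
    tensorSet_eq_preimage hd hA hB, deloc_image (hA.tens hd hB).carrier (phi_injOn _ _),
    ← tens_map hd (phi_injOn _ _) hA hB, Conduct.map_at, Conduct.map_at]
  rfl

theorem projects_homOb (A B : Obj) : (homOb A B).projects = internalHomSet A B := by
  have hA := A.isConduct_at (psi_injective 0)
  have hB := B.isConduct_at (psi_injective 1)
  have hd := apart_psi_zero_one.disjoint A.carrier B.carrier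
  rw [internalHomSet, morphisms_eq, deloc_image (isConduct_arrows A B).carrier (phi_injOn _ _),
    arrows, ← impl_map hd (phi_injOn _ _) hA hB, Conduct.map_at, Conduct.map_at]
  rfl

/-! ## Relocations as morphisms -/

theorem Hom.val_id (A : Obj) : Hom.val (𝟙 A) = EProject.link A.carrier (psi 0) (psi 1) :=
  clsE_idClass _

theorem Hom.val_comp {A B C : Obj} (f : A ⟶ B) (g : B ⟶ C) :
    Hom.val (f ≫ g) = compE (Hom.val f) (Hom.val g) :=
  Hom.clsE_comp f g

/-- A morphism that moves the locations along `θ`. -/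
structure IsReloc {A B : Obj} (f : A ⟶ B) (θ : ℕ → ℕ) : Prop where
  injective : Function.Injective θ
  val_eq : Hom.val f = EProject.link A.carrier (psi 0) (psi 1 ∘ θ)

theorem arrVerts_right_injective {S T T' : Finset ℕ} (h : arrVerts S T = arrVerts S T') :
    T = T' := by
  ext x
  have := Finset.ext_iff.1 h (x, 1)
  simpa [mem_arrVerts] using this

namespace IsReloc

variable {A B C D : Obj} {f : A ⟶ B} {g : B ⟶ C} {θ η : ℕ → ℕ}

theorem carrier_eq (h : IsReloc f θ) : B.carrier = A.carrier.image θ := by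
  have h1 := Hom.carrier_val f
  have h2 := carrier_link_psi A.carrier id θ
  rw [Function.comp_id, ← h.val_eq, h1, Finset.image_id] at h2
  exact arrVerts_right_injective h2

theorem id (A : Obj) : IsReloc (𝟙 A) id := ⟨Function.injective_id, Hom.val_id A⟩

theorem rel_link_right (S : Finset ℕ) (θ : ℕ → ℕ) :
    rel (EProject.link S (psi 0) (psi 1)) (psi 0) (psi 1 ∘ θ) =
      EProject.link S (psi 0) (psi 1 ∘ θ) :=
  rel_link S _root_.id _root_.id (psi 0) (psi 1 ∘ θ)

theorem carrier_link_id (S : Finset ℕ) :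
    (EProject.link S (psi 0) (psi 1)).carrier = arrVerts S S := by
  simpa using carrier_link_psi S _root_.id _root_.id

theorem comp (hf : IsReloc f θ) (hg : IsReloc g η) : IsReloc (f ≫ g) (η ∘ θ) := by
  refine ⟨hg.injective.comp hf.injective, ?_⟩
  rw [Hom.val_comp, hf.val_eq, hg.val_eq, hf.carrier_eq,
    EProject.link_image hf.injective.injOn, ← rel_link_right, ← rel_link_right A.carrier (η ∘ θ)]
  exact compE_link hf.injective (hg.injective.comp hf.injective) (carrier_link_id _)

/-- Relocations are determined by their values on the carrier, so coherence diagrams reduce to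
equalities of functions on ℕ. -/
theorem ext {f g : A ⟶ B} (hf : IsReloc f θ) (hg : IsReloc g η)
    (h : ∀ x ∈ A.carrier, θ x = η x) : f = g := by
  refine Hom.val_injective ?_
  rw [hf.val_eq, hg.val_eq]
  exact EProject.link_congr (fun _ _ => rfl) fun x hx => congrArg (psi 1) (h x hx)

theorem val_comp_right (f : A ⟶ B) (hg : IsReloc g η) :
    Hom.val (f ≫ g) = rel (Hom.val f) (psi 0) (psi 1 ∘ η) := by
  rw [Hom.val_comp, hg.val_eq]
  have h := compE_link Function.injective_id hg.injective (Hom.carrier_val f)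
  simpa only [Function.comp_id, rel_psi (Hom.carrier_val f)] using h

/-- Precomposition with a relocation undoes it on the source, so the composite `x` has to be given
and `g` is compared with its displacement. -/
theorem val_comp_left (hf : IsReloc f θ) {x : EProject (ℕ × ℕ)}
    (hx : x.carrier = arrVerts A.carrier C.carrier)
    (hg : Hom.val g = rel x (psi 0 ∘ θ) (psi 1)) : Hom.val (f ≫ g) = x := by
  rw [Hom.val_comp, hf.val_eq, hg]
  have h := link_compE Function.injective_id hf.injective hx
  simpa only [Function.comp_id, rel_psi hx] using h

/-- The naturality of the relocations. -/
theorem naturality {A A' B B' : Obj} {θ η : ℕ → ℕ} {a : A ⟶ A'} {b : B ⟶ B'} (ha : IsReloc a θ)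
    (hb : IsReloc b η) {f : A ⟶ B} {g : A' ⟶ B'}
    (h : Hom.val g = rel (Hom.val f) (psi 0 ∘ θ) (psi 1 ∘ η)) : f ≫ b = a ≫ g := by
  refine Hom.val_injective ?_
  rw [hb.val_comp_right]
  have hc : (rel (Hom.val f) (psi 0) (psi 1 ∘ η)).carrier = arrVerts A.carrier B'.carrier := by
    rw [← hb.val_comp_right, Hom.carrier_val]
  refine (ha.val_comp_left hc ?_).symm
  rw [h]
  exact (rel_rel (Hom.carrier_val f) _root_.id η (psi 0 ∘ θ) (psi 1)).symm

end IsReloc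

/-! ### Isomorphisms given by relocations -/

section Reloc

variable {A B : Obj} {θ : ℕ → ℕ}

theorem carrier_of_set_eq (h : B.set = A.at_ θ) (hθ : Function.Injective θ) :
    B.carrier = A.carrier.image θ := by
  obtain ⟨b, hb⟩ := B.isConduct.nonempty
  rw [← B.isConduct.carrier b hb]
  rw [h] at hb
  exact (A.isConduct_at hθ).carrier b hb

theorem link_mem_arrows (h : B.set = A.at_ θ) (hθ : Function.Injective θ) :
    EProject.link A.carrier (psi 0) (psi 1 ∘ θ) ∈ arrows A B := by
  have := link_mem_impl A.isConduct.carrier (apart_psi_zero_one.comp Function.injective_id hθ)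
  rw [Function.comp_id] at this
  rw [arrows, Conduct.at_, Conduct.at_, h, Conduct.map_at]
  exact this

theorem link_mem_arrows_inv (h : B.set = A.at_ θ) (hθ : Function.Injective θ) :
    EProject.link A.carrier (psi 0 ∘ θ) (psi 1) ∈ arrows B A := by
  have := link_mem_impl A.isConduct.carrier (apart_psi_zero_one.comp hθ Function.injective_id)
  rw [Function.comp_id] at this
  rw [arrows, Conduct.at_, Conduct.at_, h, Conduct.map_at]
  exact this

/-- The isomorphism given by a relocation. -/
noncomputable def reloc (h : B.set = A.at_ θ) (hθ : Function.Injective θ) : A ≅ B where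
  hom := Hom.mkE _ (link_mem_arrows h hθ)
  inv := Hom.mkE _ (link_mem_arrows_inv h hθ)
  hom_inv_id := Hom.val_injective (by
    rw [Hom.val_comp, Hom.val_id, Hom.val_mkE, Hom.val_mkE, ← IsReloc.rel_link_right]
    have h := compE_link hθ Function.injective_id (IsReloc.carrier_link_id A.carrier)
    simpa only [Function.comp_id, rel_psi (IsReloc.carrier_link_id A.carrier)] using h)
  inv_hom_id := Hom.val_injective (by
    rw [Hom.val_comp, Hom.val_id, Hom.val_mkE, Hom.val_mkE, carrier_of_set_eq h hθ,
      EProject.link_image hθ.injOn]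
    have hc : (EProject.link A.carrier (psi 0) (psi 1 ∘ θ)).carrier =
        arrVerts A.carrier (A.carrier.image θ) := by
      simpa using carrier_link_psi A.carrier _root_.id θ
    have h := link_compE hθ Function.injective_id hc
    simp only [Function.comp_id, rel_psi hc] at h
    rw [h]
    exact rel_link A.carrier _root_.id θ (psi 0 ∘ θ) (psi 1))

theorem isReloc_reloc (h : B.set = A.at_ θ) (hθ : Function.Injective θ) :
    IsReloc (reloc h hθ).hom θ :=
  ⟨hθ, Hom.val_mkE _ (link_mem_arrows h hθ)⟩

/-- This asks for a left inverse of `θ` that is injective on all of ℕ: `asc` has one, `ev` and `od`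
have none. -/
theorem isReloc_reloc_inv (h : B.set = A.at_ θ) (hθ : Function.Injective θ) {η : ℕ → ℕ}
    (hη : Function.Injective η) (hηθ : ∀ x, η (θ x) = x) : IsReloc (reloc h hθ).inv η := by
  refine ⟨hη, (Hom.val_mkE _ (link_mem_arrows_inv h hθ)).trans ?_⟩
  rw [carrier_of_set_eq h hθ, EProject.link_image hθ.injOn]
  exact EProject.link_congr (fun _ _ => rfl) fun x _ => congrArg (psi 1) (hηθ x).symm

end Reloc

end GoI

namespace GoI

/-! ## Functions given on the even and on the odd locations -/

/-- The map that is `a` on the even locations and `b` on the odd locations. -/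
def mix {V : Type} (a b : ℕ → V) (n : ℕ) : V := if n % 2 = 0 then a (n / 2) else b (n / 2)

section Mix

variable {V W : Type} (a b : ℕ → V)

@[simp] theorem mix_ev (n : ℕ) : mix a b (ev n) = a n := by simp [mix, ev]

@[simp] theorem mix_od (n : ℕ) : mix a b (od n) = b n := by
  have h1 : (2 * n + 1) % 2 = 1 := by omega
  have h2 : (2 * n + 1) / 2 = n := by omega
  simp [mix, od, h1, h2]

theorem mix_comp_ev : mix a b ∘ ev = a := funext (mix_ev a b)

theorem mix_comp_od : mix a b ∘ od = b := funext (mix_od a b)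

theorem comp_mix (η : V → W) : η ∘ mix a b = mix (η ∘ a) (η ∘ b) :=
  funext fun _ => apply_ite η _ _ _

theorem exists_ev_or_od (n : ℕ) : ∃ m, n = ev m ∨ n = od m :=
  ⟨n / 2, by simp only [ev, od]; omega⟩

variable {a b}

theorem Apart.mix_injective (h : Apart a b) : Function.Injective (mix a b) := by
  intro m n hmn
  obtain ⟨x, rfl | rfl⟩ := exists_ev_or_od m <;> obtain ⟨y, rfl | rfl⟩ := exists_ev_or_od n <;>
    simp only [mix_ev, mix_od] at hmn
  · rw [h.left hmn]
  · exact (h.ne _ _ hmn).elim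
  · exact (h.ne _ _ hmn.symm).elim
  · rw [h.right hmn]

theorem Apart.mix_left {c : ℕ → V} (h : Apart a b) (ha : Apart a c) (hb : Apart b c) :
    Apart (mix a b) c :=
  ⟨h.mix_injective, ha.right, fun m y => by
    obtain ⟨x, rfl | rfl⟩ := exists_ev_or_od m
    · rw [mix_ev]
      exact ha.ne x y
    · rw [mix_od]
      exact hb.ne x y⟩

end Mix

/-- The map that is `θ` on the even locations and `η` on the odd locations. -/
def join (θ η : ℕ → ℕ) : ℕ → ℕ := mix (ev ∘ θ) (od ∘ η)

@[simp] theorem join_ev (θ η : ℕ → ℕ) (n : ℕ) : join θ η (ev n) = ev (θ n) := mix_ev _ _ n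

@[simp] theorem join_od (θ η : ℕ → ℕ) (n : ℕ) : join θ η (od n) = od (η n) := mix_od _ _ n

theorem join_injective {θ η : ℕ → ℕ} (hθ : Function.Injective θ) (hη : Function.Injective η) :
    Function.Injective (join θ η) :=
  (apart_ev_od.comp hθ hη).mix_injective

theorem apart_od {θ η : ℕ → ℕ} (h : Apart θ η) : Apart (od ∘ θ) (od ∘ η) :=
  h.comp_left apart_ev_od.right

/-- The relocation of the associator. -/
def asc : ℕ → ℕ := mix (mix ev (od ∘ ev)) (od ∘ od)

/-- The relocation of the inverse of the associator. -/
def ascInv : ℕ → ℕ := mix (ev ∘ ev) (mix (ev ∘ od) od)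

/-- The relocation of the braiding. -/
def swp : ℕ → ℕ := mix od ev

@[simp] theorem asc_ev (n : ℕ) : asc (ev n) = mix ev (od ∘ ev) n := mix_ev _ _ n

@[simp] theorem asc_od (n : ℕ) : asc (od n) = od (od n) := mix_od _ _ n

@[simp] theorem ascInv_ev (n : ℕ) : ascInv (ev n) = ev (ev n) := mix_ev _ _ n

@[simp] theorem ascInv_od (n : ℕ) : ascInv (od n) = mix (ev ∘ od) od n := mix_od _ _ n

@[simp] theorem swp_ev (n : ℕ) : swp (ev n) = od n := mix_ev _ _ n

@[simp] theorem swp_od (n : ℕ) : swp (od n) = ev n := mix_od _ _ n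

theorem asc_injective : Function.Injective asc := by
  have h1 : Apart ev (od ∘ ev) := apart_ev_od.comp Function.injective_id apart_ev_od.left
  have h2 : Apart ev (od ∘ od) := apart_ev_od.comp Function.injective_id apart_ev_od.right
  exact (h1.mix_left h2 (apart_od apart_ev_od)).mix_injective

theorem ascInv_asc (n : ℕ) : ascInv (asc n) = n := by
  obtain ⟨n, rfl | rfl⟩ := exists_ev_or_od n
  · obtain ⟨n, rfl | rfl⟩ := exists_ev_or_od n <;> simp
  · simp

theorem asc_ascInv (n : ℕ) : asc (ascInv n) = n := by
  obtain ⟨n, rfl | rfl⟩ := exists_ev_or_od n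
  · simp
  · obtain ⟨n, rfl | rfl⟩ := exists_ev_or_od n <;> simp

theorem ascInv_injective : Function.Injective ascInv :=
  Function.LeftInverse.injective asc_ascInv

theorem swp_injective : Function.Injective swp := apart_ev_od.symm.mix_injective

/-! ## The monoidal structure -/

theorem tensE_mem {A B C D : Obj} {x y : EProject (ℕ × ℕ)} (hx : x ∈ arrows A B)
    (hy : y ∈ arrows C D) : tensE x y ∈ arrows (tensorOb A C) (tensorOb B D) := by
  have he := apart_psi_zero_one.comp apart_ev_od.left apart_ev_od.left
  have ho := apart_psi_zero_one.comp apart_ev_od.right apart_ev_od.right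
  have heo := apart_psi_zero_one.comp apart_ev_od.left apart_ev_od.right
  have hoe := apart_psi_zero_one.comp apart_ev_od.right apart_ev_od.left
  have h0 := apart_ev_od.comp_left (psi_injective 0)
  have h1 := apart_ev_od.comp_left (psi_injective 1)
  rw [arrows, at_tensorOb A C (psi_injective 0), at_tensorOb B D (psi_injective 1)]
  exact prods_mem_impl_tens (h0.disjoint _ _) (he.disjoint _ _) (heo.disjoint _ _)
    (hoe.disjoint _ _) (ho.disjoint _ _) (h1.disjoint _ _) (A.isConduct_at he.left)
    (C.isConduct_at ho.left) (B.isConduct_at he.right) (D.isConduct_at ho.right)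
    (rel_mem he hx) (rel_mem ho hy)

/-- The tensor product of morphisms. -/
noncomputable def tensHom {A B C D : Obj} (f : A ⟶ B) (g : C ⟶ D) :
    tensorOb A C ⟶ tensorOb B D :=
  Hom.mkE (tensE (Hom.val f) (Hom.val g)) (tensE_mem (Hom.val_mem f) (Hom.val_mem g))

theorem val_tensHom {A B C D : Obj} (f : A ⟶ B) (g : C ⟶ D) :
    Hom.val (tensHom f g) = tensE (Hom.val f) (Hom.val g) :=
  Hom.val_mkE _ (tensE_mem (Hom.val_mem f) (Hom.val_mem g))

theorem cls_tensHom {A B C D : Obj} (f : A ⟶ B) (g : C ⟶ D) :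
    Hom.cls (tensHom f g) = tensorHomClass (Hom.cls f) (Hom.cls g) :=
  clsE_injective ((val_tensHom f g).trans
    (clsE_tensorHomClass (Hom.carrier_val f) (Hom.carrier_val g)).symm)

theorem IsReloc.tens {A B C D : Obj} {f : A ⟶ B} {g : C ⟶ D} {θ η : ℕ → ℕ} (hf : IsReloc f θ)
    (hg : IsReloc g η) : IsReloc (tensHom f g) (join θ η) := by
  refine ⟨join_injective hf.injective hg.injective, ?_⟩
  have h1 : EProject.link (A.carrier.image ev) (psi 0) (psi 1 ∘ join θ η) =
      EProject.link A.carrier (psi 0 ∘ ev) ((psi 1 ∘ ev) ∘ θ) := by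
    rw [EProject.link_image apart_ev_od.left.injOn]
    exact EProject.link_congr (fun _ _ => rfl) fun x _ => congrArg (psi 1) (join_ev θ η x)
  have h2 : EProject.link (C.carrier.image od) (psi 0) (psi 1 ∘ join θ η) =
      EProject.link C.carrier (psi 0 ∘ od) ((psi 1 ∘ od) ∘ η) := by
    rw [EProject.link_image apart_ev_od.right.injOn]
    exact EProject.link_congr (fun _ _ => rfl) fun x _ => congrArg (psi 1) (join_od θ η x)
  have e1 := rel_link A.carrier _root_.id θ (psi 0 ∘ ev) (psi 1 ∘ ev)
  have e2 := rel_link C.carrier _root_.id η (psi 0 ∘ od) (psi 1 ∘ od)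
  simp only [Function.comp_id] at e1 e2
  have hd := disjoint_rel_ev_od apart_psi_zero_one (Hom.carrier_val f) (Hom.carrier_val g)
  rw [hf.val_eq, hg.val_eq, e1, e2, ← h1, ← h2] at hd
  rw [val_tensHom, tensE, hf.val_eq, hg.val_eq, e1, e2, ← h1, ← h2]
  exact (EProject.link_union hd).symm

theorem tensHom_comp {A B C A' B' C' : Obj} (f : A ⟶ B) (f' : A' ⟶ B') (g : B ⟶ C)
    (g' : B' ⟶ C') : tensHom f f' ≫ tensHom g g' = tensHom (f ≫ g) (f' ≫ g') :=
  Hom.val_injective (by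
    rw [Hom.val_comp, val_tensHom, val_tensHom, val_tensHom, Hom.val_comp, Hom.val_comp]
    exact compE_tensE (Hom.carrier_val f) (Hom.carrier_val f') (Hom.carrier_val g)
      (Hom.carrier_val g'))

theorem tensHom_id (A B : Obj) : tensHom (𝟙 A) (𝟙 B) = 𝟙 (tensorOb A B) :=
  ((IsReloc.id A).tens (IsReloc.id B)).ext (IsReloc.id _) fun n _ => by
    obtain ⟨n, rfl | rfl⟩ := exists_ev_or_od n <;> simp

theorem set_tensorOb (A B : Obj) : (tensorOb A B).set = tens (A.at_ ev) (B.at_ od) :=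
  Conduct.set_ofSet _ _ _

/-- Both sides have `A`, `B`, `C` at `ev`, `od ∘ ev`, `od ∘ od`; only the brackets differ. -/
theorem set_assoc (A B C : Obj) :
    (tensorOb A (tensorOb B C)).set = (tensorOb (tensorOb A B) C).at_ asc := by
  have h1 : asc ∘ ev = mix ev (od ∘ ev) := funext asc_ev
  have h2 : asc ∘ od = od ∘ od := funext asc_od
  have a1 : Apart ev (od ∘ ev) := apart_ev_od.comp Function.injective_id apart_ev_od.left
  have a2 : Apart ev (od ∘ od) := apart_ev_od.comp Function.injective_id apart_ev_od.right
  have a3 := apart_od apart_ev_od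
  rw [set_tensorOb, at_tensorOb B C apart_ev_od.right,
    at_tensorOb (tensorOb A B) C asc_injective, h1, h2,
    at_tensorOb A B a1.mix_injective, mix_comp_ev, mix_comp_od]
  exact (tens_assoc (a1.disjoint _ _) (a3.disjoint _ _) (a2.disjoint _ _)
    (A.isConduct_at a1.left) (B.isConduct_at a1.right) (C.isConduct_at a2.right)).symm

theorem set_braiding (A B : Obj) : (tensorOb B A).set = (tensorOb A B).at_ swp := by
  have h1 : swp ∘ ev = od := funext swp_ev
  have h2 : swp ∘ od = ev := funext swp_od
  rw [set_tensorOb, at_tensorOb A B swp_injective, h1, h2, tens_comm]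

theorem set_rightUnit (A : Obj) : (tensorOb A unitOb).set = A.at_ ev := by
  rw [set_tensorOb, at_unitOb, tens_unit (A.isConduct_at apart_ev_od.left)]

theorem set_leftUnit (A : Obj) : (tensorOb unitOb A).set = A.at_ od := by
  rw [set_tensorOb, at_unitOb, tens_comm, tens_unit (A.isConduct_at apart_ev_od.right)]

noncomputable scoped instance monoidalCategoryStruct : MonoidalCategoryStruct Obj where
  tensorObj := tensorOb
  whiskerLeft X _ _ f := tensHom (𝟙 X) f
  whiskerRight f Y := tensHom f (𝟙 Y)
  tensorHom := tensHom
  tensorUnit := unitOb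
  associator A B C := reloc (set_assoc A B C) asc_injective
  -- The relocation goes from `A` to its product with the unit, so the unitors are inverses of
  -- relocations. As `od` and `ev` have no injective left inverse, the coherence laws are checked on
  -- the inverse unitors.
  leftUnitor A := (reloc (set_leftUnit A) apart_ev_od.right).symm
  rightUnitor A := (reloc (set_rightUnit A) apart_ev_od.left).symm

theorem isReloc_associator (A B C : Obj) : IsReloc (α_ A B C).hom asc :=
  isReloc_reloc (set_assoc A B C) asc_injective

theorem isReloc_associator_inv (A B C : Obj) : IsReloc (α_ A B C).inv ascInv :=
  isReloc_reloc_inv (set_assoc A B C) asc_injective ascInv_injective ascInv_asc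

theorem isReloc_leftUnitor_inv (A : Obj) : IsReloc (λ_ A).inv od :=
  isReloc_reloc (set_leftUnit A) apart_ev_od.right

theorem isReloc_rightUnitor_inv (A : Obj) : IsReloc (ρ_ A).inv ev :=
  isReloc_reloc (set_rightUnit A) apart_ev_od.left

theorem val_id_unitOb : Hom.val (𝟙 unitOb) = 1 := by
  rw [Hom.val_id]
  exact EProject.link_empty _ _

theorem rel_one {V : Type} [DecidableEq V] (α β : ℕ → V) : rel 1 α β = 1 := EProject.map_one _

/-- After relocation by `asc`, both sides are products of the same three placed arrows, bracketed
differently. -/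
theorem associator_naturality {A B C A' B' C' : Obj} (f : A ⟶ A') (g : B ⟶ B') (h : C ⟶ C') :
    tensHom (tensHom f g) h ≫ (α_ A' B' C').hom = (α_ A B C).hom ≫ tensHom f (tensHom g h) := by
  refine (isReloc_associator A B C).naturality (isReloc_associator A' B' C') ?_
  have cf := Hom.carrier_val f
  have cg := Hom.carrier_val g
  have ch := Hom.carrier_val h
  have a1 : asc ∘ ev ∘ ev = ev := funext fun n => by simp
  have a2 : asc ∘ ev ∘ od = od ∘ ev := funext fun n => by simp
  have a3 : asc ∘ od = od ∘ od := funext fun n => by simp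
  have ha := apart_psi_zero_one.comp asc_injective asc_injective
  have he := apart_psi_zero_one.comp apart_ev_od.left apart_ev_od.left
  have ho := apart_psi_zero_one.comp apart_ev_od.right apart_ev_od.right
  have hd := disjoint_rel_ev_od ho cg ch
  rw [val_tensHom, val_tensHom, val_tensHom, val_tensHom, rel_tensE ha (carrier_tensE cf cg) ch,
    rel_tensE (ha.comp apart_ev_od.left apart_ev_od.left) cf cg, tensE, rel_tensE ho cg ch]
  simp only [Function.comp_assoc, a1, a2, a3] at hd ⊢
  exact (EProject.mul_assoc_of_tri (tri_of_disjoint hd)).symm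

/-- The square is checked for the inverse unitors, which are relocations along `od`, and is then
inverted. -/
theorem leftUnitor_naturality {A B : Obj} (f : A ⟶ B) :
    tensHom (𝟙 unitOb) f ≫ (λ_ B).hom = (λ_ A).hom ≫ f := by
  have h : f ≫ (λ_ B).inv = (λ_ A).inv ≫ tensHom (𝟙 unitOb) f :=
    (isReloc_leftUnitor_inv A).naturality (isReloc_leftUnitor_inv B) (by
      rw [val_tensHom, val_id_unitOb, tensE, rel_one, EProject.one_mul])
  rw [← Iso.eq_comp_inv, Category.assoc, h]
  exact ((λ_ A).hom_inv_id_assoc _).symm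

theorem rightUnitor_naturality {A B : Obj} (f : A ⟶ B) :
    tensHom f (𝟙 unitOb) ≫ (ρ_ B).hom = (ρ_ A).hom ≫ f := by
  have h : f ≫ (ρ_ B).inv = (ρ_ A).inv ≫ tensHom f (𝟙 unitOb) :=
    (isReloc_rightUnitor_inv A).naturality (isReloc_rightUnitor_inv B) (by
      rw [val_tensHom, val_id_unitOb, tensE, rel_one, EProject.mul_one])
  rw [← Iso.eq_comp_inv, Category.assoc, h]
  exact ((ρ_ A).hom_inv_id_assoc _).symm

/-- Both sides are relocations, and their functions are compared on each of the four factors. -/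
theorem pentagon (A B C D : Obj) :
    tensHom (α_ A B C).hom (𝟙 D) ≫ (α_ A (tensorOb B C) D).hom ≫ tensHom (𝟙 A) (α_ B C D).hom =
      (α_ (tensorOb A B) C D).hom ≫ (α_ A B (tensorOb C D)).hom := by
  refine (((isReloc_associator A B C).tens (IsReloc.id D)).comp
    ((isReloc_associator A (tensorOb B C) D).comp
      ((IsReloc.id A).tens (isReloc_associator B C D)))).ext
    ((isReloc_associator (tensorOb A B) C D).comp (isReloc_associator A B (tensorOb C D)))
    fun n _ => ?_
  obtain ⟨n, rfl | rfl⟩ := exists_ev_or_od n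
  · obtain ⟨n, rfl | rfl⟩ := exists_ev_or_od n
    · obtain ⟨n, rfl | rfl⟩ := exists_ev_or_od n <;> simp
    · simp
  · simp

theorem triangle (A B : Obj) :
    (α_ A unitOb B).hom ≫ tensHom (𝟙 A) (λ_ B).hom = tensHom (ρ_ A).hom (𝟙 B) := by
  -- Precomposed with an inverse unitor, the triangle becomes an equality of relocations; the
  -- invertible factors are then cancelled.
  have h : tensHom (ρ_ A).inv (𝟙 B) ≫ (α_ A unitOb B).hom = tensHom (𝟙 A) (λ_ B).inv := by
    refine (((isReloc_rightUnitor_inv A).tens (IsReloc.id B)).comp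
      (isReloc_associator A unitOb B)).ext
      ((IsReloc.id A).tens (isReloc_leftUnitor_inv B)) fun n _ => ?_
    obtain ⟨n, rfl | rfl⟩ := exists_ev_or_od n <;> simp
  have h1 : tensHom (ρ_ A).hom (𝟙 B) ≫ tensHom (ρ_ A).inv (𝟙 B) = 𝟙 _ := by
    rw [tensHom_comp, Iso.hom_inv_id, Category.comp_id]
    exact tensHom_id _ _
  have h2 : tensHom (𝟙 A) (λ_ B).inv ≫ tensHom (𝟙 A) (λ_ B).hom = 𝟙 _ := by
    rw [tensHom_comp, Iso.inv_hom_id, Category.comp_id]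
    exact tensHom_id _ _
  calc (α_ A unitOb B).hom ≫ tensHom (𝟙 A) (λ_ B).hom
      = (tensHom (ρ_ A).hom (𝟙 B) ≫ tensHom (ρ_ A).inv (𝟙 B)) ≫
          (α_ A unitOb B).hom ≫ tensHom (𝟙 A) (λ_ B).hom := by
        rw [h1]
        exact (Category.id_comp _).symm
    _ = tensHom (ρ_ A).hom (𝟙 B) ≫ (tensHom (ρ_ A).inv (𝟙 B) ≫ (α_ A unitOb B).hom) ≫
          tensHom (𝟙 A) (λ_ B).hom := by
        simp only [Category.assoc]
    _ = tensHom (ρ_ A).hom (𝟙 B) := by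
        rw [h, h2]
        exact Category.comp_id _

noncomputable scoped instance monoidalCategory : MonoidalCategory Obj := MonoidalCategory.ofTensorHom
  (id_tensorHom_id := tensHom_id)
  (id_tensorHom := fun _ _ _ _ => rfl)
  (tensorHom_id := fun _ _ => rfl)
  (tensorHom_comp_tensorHom := tensHom_comp)
  (associator_naturality := associator_naturality)
  (leftUnitor_naturality := leftUnitor_naturality)
  (rightUnitor_naturality := rightUnitor_naturality)
  (pentagon := pentagon)
  (triangle := triangle)

/-! ### The symmetry -/

theorem isReloc_braiding (A B : Obj) :
    IsReloc (reloc (set_braiding A B) swp_injective).hom swp :=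
  isReloc_reloc _ _

theorem braiding_naturality {A B A' B' : Obj} (f : A ⟶ A') (g : B ⟶ B') :
    tensHom f g ≫ (reloc (set_braiding A' B') swp_injective).hom =
      (reloc (set_braiding A B) swp_injective).hom ≫ tensHom g f := by
  refine (isReloc_braiding A B).naturality (isReloc_braiding A' B') ?_
  have a1 : swp ∘ ev = od := funext swp_ev
  have a2 : swp ∘ od = ev := funext swp_od
  rw [val_tensHom, val_tensHom, rel_tensE (apart_psi_zero_one.comp swp_injective swp_injective)
    (Hom.carrier_val f) (Hom.carrier_val g), tensE, mul_comm]
  simp only [Function.comp_assoc, a1, a2]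

noncomputable scoped instance symmetricCategory : SymmetricCategory Obj where
  braiding A B := reloc (set_braiding A B) swp_injective
  braiding_naturality_right X _ _ f := braiding_naturality (𝟙 X) f
  braiding_naturality_left f X := braiding_naturality f (𝟙 X)
  hexagon_forward A B C := by
    refine ((isReloc_associator A B C).comp ((isReloc_braiding A (tensorOb B C)).comp
      (isReloc_associator B C A))).ext (((isReloc_braiding A B).tens (IsReloc.id C)).comp
      ((isReloc_associator B A C).comp ((IsReloc.id B).tens (isReloc_braiding A C))))
      fun n _ => ?_
    obtain ⟨n, rfl | rfl⟩ := exists_ev_or_od n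
    · obtain ⟨n, rfl | rfl⟩ := exists_ev_or_od n <;> simp
    · simp
  hexagon_reverse A B C := by
    refine ((isReloc_associator_inv A B C).comp ((isReloc_braiding (tensorOb A B) C).comp
      (isReloc_associator_inv C A B))).ext (((IsReloc.id A).tens (isReloc_braiding B C)).comp
      ((isReloc_associator_inv A C B).comp ((isReloc_braiding A C).tens (IsReloc.id B))))
      fun n _ => ?_
    obtain ⟨n, rfl | rfl⟩ := exists_ev_or_od n
    · simp
    · obtain ⟨n, rfl | rfl⟩ := exists_ev_or_od n <;> simp
  symmetry A B := by
    refine ((isReloc_braiding A B).comp (isReloc_braiding B A)).ext (IsReloc.id _) fun n _ => ?_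
    obtain ⟨n, rfl | rfl⟩ := exists_ev_or_od n <;> simp

theorem isReloc_braiding_hom (A B : Obj) : IsReloc (β_ A B).hom swp :=
  isReloc_reloc (set_braiding A B) swp_injective

end GoI

namespace GoI

/-! ## The closed structure -/

/-- The transpose of an arrow. -/
def curE (x : EProject (ℕ × ℕ)) : EProject (ℕ × ℕ) :=
  rel x (mix (psi 1 ∘ ev) (psi 0)) (psi 1 ∘ od)

theorem apart_curE : Apart (mix (psi 1 ∘ ev) (psi 0)) (psi 1 ∘ od) :=
  (apart_psi_zero_one.symm.comp apart_ev_od.left Function.injective_id).mix_left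
    (apart_ev_od.comp_left (psi_injective 1))
    (apart_psi_zero_one.comp Function.injective_id apart_ev_od.right)

/-- Transposition only moves the locations of `A` from the source to the target; along this
relocation the currying identity `impl_tens` becomes an equality of sets of arrows. -/
theorem image_curE (A B C : Obj) :
    curE '' arrows (tensorOb A B) C = arrows B (homOb A C) := by
  have h1 : Apart (psi 1 ∘ ev) (psi 1 ∘ od) := apart_ev_od.comp_left (psi_injective 1)
  have h2 : Apart (psi 0) (psi 1 ∘ ev) :=
    apart_psi_zero_one.comp Function.injective_id apart_ev_od.left
  have h3 : Apart (psi 0) (psi 1 ∘ od) :=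
    apart_psi_zero_one.comp Function.injective_id apart_ev_od.right
  refine (image_rel apart_curE (tensorOb A B) C).trans ?_
  rw [at_tensorOb A B apart_curE.left, mix_comp_ev, mix_comp_od, tens_comm,
    impl_tens (h2.disjoint _ _) (h1.disjoint _ _) (h3.disjoint _ _) (B.isConduct_at h2.left)
      (A.isConduct_at h1.left) (C.isConduct_at h1.right), arrows,
    at_homOb A C (psi_injective 1)]

theorem curE_mem {A B C : Obj} {x : EProject (ℕ × ℕ)} (hx : x ∈ arrows (tensorOb A B) C) :
    curE x ∈ arrows B (homOb A C) := by
  rw [← image_curE]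
  exact ⟨x, hx, rfl⟩

/-- The transposition of morphisms. -/
noncomputable def curHom {A B C : Obj} (f : tensorOb A B ⟶ C) : B ⟶ homOb A C :=
  Hom.mkE (curE (Hom.val f)) (curE_mem (Hom.val_mem f))

theorem val_curHom {A B C : Obj} (f : tensorOb A B ⟶ C) :
    Hom.val (curHom f) = curE (Hom.val f) :=
  Hom.val_mkE _ (curE_mem (Hom.val_mem f))

theorem curHom_bijective (A B C : Obj) :
    Function.Bijective (curHom : (tensorOb A B ⟶ C) → (B ⟶ homOb A C)) := by
  constructor
  · intro f g hfg
    have h := congrArg Hom.val hfg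
    rw [val_curHom, val_curHom] at h
    exact Hom.val_injective
      (rel_injective apart_curE (Hom.carrier_val f) (Hom.carrier_val g) h)
  · intro g
    have h := Hom.val_mem g
    rw [← image_curE] at h
    obtain ⟨x, hx, hxg⟩ := h
    refine ⟨Hom.mkE x hx, Hom.val_injective ?_⟩
    rw [val_curHom, Hom.val_mkE, hxg]

/-- Absorption of a link that touches only the even half of the source; in `curHom_naturality` it
removes the identity of `A`. -/
theorem link_mul_rel_mix {V : Type} [DecidableEq V] {a a' b c : ℕ → V} {S S' T : Finset ℕ}
    {x : EProject (ℕ × ℕ)} (hx : x.carrier = arrVerts (S.image ev ∪ S'.image od) T)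
    (h1 : Apart a b) (h2 : Apart a c) (h3 : Apart b c) (h4 : Apart a' a) (h5 : Apart a' b)
    (h6 : Apart a' c) :
    EProject.link S a' a * rel x (mix a b) c = rel x (mix a' b) c := by
  have hl : EProject.link S a a' = EProject.link (S.image (psi 0 ∘ ev)) (side (mix a b) c)
      (side (mix a' b) c) := by
    rw [EProject.link_image ((psi_injective 0).comp apart_ev_od.left).injOn]
    exact EProject.link_congr (fun n _ => (mix_ev a b n).symm) fun n _ => (mix_ev a' b n).symm
  rw [mul_comm, EProject.link_comm, hl]
  refine EProject.map_mul_link ?_ ?_ ?_ ?_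
  · rw [hx]
    exact side_injOn (h1.mix_left h2 h3) _ _
  · rw [hx, arrVerts, Finset.image_union, Finset.image_image]
    exact Finset.subset_union_left.trans Finset.subset_union_left
  · intro p hp hp'
    rw [hx, mem_arrVerts] at hp
    rcases hp with ⟨z, hz, rfl⟩ | ⟨z, -, rfl⟩
    · rw [Finset.mem_union, Finset.mem_image, Finset.mem_image] at hz
      rcases hz with ⟨n, hn, rfl⟩ | ⟨n, -, rfl⟩
      · exact absurd (Finset.mem_image_of_mem (psi 0 ∘ ev) hn) hp'
      · exact (mix_od a' b n).trans (mix_od a b n).symm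
    · rfl
  · intro p hp
    obtain ⟨n, -, rfl⟩ := Finset.mem_image.1 hp
    rw [hx, image_side, Finset.image_union, Finset.image_image, Finset.image_image, mix_comp_ev,
      mix_comp_od, Finset.mem_union, Finset.mem_union]
    have e : side (mix a' b) c ((psi 0 ∘ ev) n) = a' n := mix_ev a' b n
    rw [e]
    rintro ((h | h) | h)
    · obtain ⟨m, -, hm⟩ := Finset.mem_image.1 h
      exact h4.ne n m hm.symm
    · obtain ⟨m, -, hm⟩ := Finset.mem_image.1 h
      exact h5.ne n m hm.symm
    · obtain ⟨m, -, hm⟩ := Finset.mem_image.1 h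
      exact h6.ne n m hm.symm

theorem rel_curE {V : Type} [DecidableEq V] {S T : Finset ℕ} {x : EProject (ℕ × ℕ)}
    (hx : x.carrier = arrVerts S T) (α β : ℕ → V) :
    rel (curE x) α β = rel x (mix (β ∘ ev) α) (β ∘ od) := by
  refine (map_rel hx (side α β) _ _).trans ?_
  rw [comp_mix]
  rfl

/-- The source is placed at `psi 0`, `B` at `psi 1` and the internal hom at `psi 2`. The left side
then has one more factor than the right, a link that joins the place `psi 2 ∘ ev` of `A` to the
auxiliary place `psi 3`. Absorbing it gives the right side. -/
theorem curHom_naturality {A B B' C : Obj} (f : B' ⟶ B) (g : tensorOb A B ⟶ C) :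
    curHom (tensHom (𝟙 A) f ≫ g) = f ≫ curHom g := by
  have p : ∀ i j : ℕ, i ≠ j → Apart (psi i) (psi j) := fun i j h => apart_psi h
  have i1 := Function.injective_id (α := ℕ)
  have ie := apart_ev_od.left
  have io := apart_ev_od.right
  have a02 := p 0 2 (by simp)
  have cg := Hom.carrier_val g
  have cf := Hom.carrier_val f
  have ct := Hom.carrier_val (tensHom (𝟙 A) f)
  have cc := Hom.carrier_val (curHom g)
  have h20 := (p 2 0 (by simp)).comp ie i1
  have h31 := p 3 1 (by simp)
  have h32 := (p 3 2 (by simp)).comp i1 io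
  have h12 := (p 1 2 (by simp)).comp i1 io
  have h02 := (p 0 2 (by simp)).comp i1 io
  have h22 := apart_ev_od.comp_left (psi_injective 2)
  have m1 : Apart (mix (psi 2 ∘ ev) (psi 0)) (psi 2 ∘ od) := h20.mix_left h22 h02
  have m2 : Apart (mix (psi 3) (psi 1)) (psi 2 ∘ od) := h31.mix_left h32 h12
  have h23 := (p 2 3 (by simp)).comp ie i1
  have h21 := (p 2 1 (by simp)).comp ie i1
  have h03 := p 0 3 (by simp)
  have h01 := p 0 1 (by simp)
  have m3 : Apart (mix (psi 2 ∘ ev) (psi 0)) (mix (psi 3) (psi 1)) :=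
    h20.mix_left (h31.mix_left h23.symm h21.symm).symm (h31.mix_left h03.symm h01.symm).symm
  refine Hom.val_injective (rel_injective a02 (Hom.carrier_val _) (Hom.carrier_val _) ?_)
  rw [Hom.val_comp, rel_compE (p 0 1 (by simp)) a02 (p 1 2 (by simp)) cf cc, val_curHom,
    val_curHom, rel_curE cg, Hom.val_comp, rel_curE (carrier_compE ct cg)]
  rw [rel_compE m3 m1 m2 ct cg, val_tensHom,
    rel_tensE m3 (Hom.carrier_val (𝟙 A)) cf, mix_comp_ev, mix_comp_od, mix_comp_ev, mix_comp_od,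
    Hom.val_id]
  have hl : rel (EProject.link A.carrier (psi 0) (psi 1)) (psi 2 ∘ ev) (psi 3) =
      EProject.link A.carrier (psi 2 ∘ ev) (psi 3) := rel_link A.carrier id id _ _
  have hd : Disjoint (EProject.link A.carrier (psi 2 ∘ ev) (psi 3)).carrier
      (rel (Hom.val f) (psi 0) (psi 1)).carrier := by
    rw [← hl]
    exact disjoint_rel (IsReloc.carrier_link_id _) cf h20 h21 h03.symm h31
  rw [hl, mul_comm (EProject.link _ _ _), EProject.mul_assoc_of_tri fun v h h' =>
      absurd h (Finset.disjoint_left.1 hd h'),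
    link_mul_rel_mix cg h31 h32 h12 h23 h21 h22]

/-- The transposition is a bijection. -/
noncomputable def curEquiv (A B C : Obj) :
    ((tensorLeft A).obj B ⟶ C) ≃ (B ⟶ homOb A C) :=
  Equiv.ofBijective curHom (curHom_bijective A B C)

noncomputable scoped instance monoidalClosed : MonoidalClosed Obj where
  closed A :=
    { rightAdj := Adjunction.rightAdjointOfEquiv (F := tensorLeft A) (G_obj := homOb A)
        (fun B C => curEquiv A B C) (fun _ _ _ f g => curHom_naturality f g)
      adj := Adjunction.adjunctionOfEquivRight _ _ }

theorem curry_eq_curHom {A B C : Obj} (f : A ⊗ B ⟶ C) : MonoidalClosed.curry f = curHom f := by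
  have h : (Adjunction.adjunctionOfEquivRight (F := tensorLeft A) (fun B C => curEquiv A B C)
      (fun _ _ _ f g => curHom_naturality f g)).homEquiv = fun B C => curEquiv A B C :=
    Adjunction.mkOfHomEquiv_homEquiv _
  exact DFunLike.congr_fun (congrFun (congrFun h B) C) f

/-! ### The double dual -/

theorem set_doubleDual (A : Obj) : (homOb (homOb A botOb) botOb).set = A.at_ (ev ∘ ev) := by
  have hA := A.isConduct_at (apart_ev_od.left.comp apart_ev_od.left)
  -- Each implication into ⊥ is an orthogonal, and the biorthogonal of `A`, moved twice to the even
  -- locations, is `A` moved along `ev ∘ ev`.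
  rw [homOb, Conduct.set_ofSet, at_botOb,
    impl_perp_one ((homOb A botOb).isConduct_at apart_ev_od.left), at_homOb A _ apart_ev_od.left,
    at_botOb, impl_perp_one hA, hA.biorth]

theorem carrier_homOb_botOb (A : Obj) : (homOb A botOb).carrier = A.carrier.image ev :=
  Finset.union_empty _

/-- The evaluation. -/
noncomputable def evalHom (A : Obj) : tensorOb A (homOb A botOb) ⟶ botOb :=
  (ihom.ev A).app botOb

theorem curHom_evalHom (A : Obj) : curHom (evalHom A) = 𝟙 (homOb A botOb) := by
  refine (curry_eq_curHom (evalHom A)).symm.trans ?_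
  change MonoidalClosed.curry ((ihom.ev A).app botOb) = 𝟙 _
  rw [← MonoidalClosed.uncurry_id_eq_ev, MonoidalClosed.curry_uncurry]

/-- The evaluation is determined by its transpose, which is the identity; a link with the two given
ends has the same transpose. -/
theorem val_evalHom (A : Obj) : Hom.val (evalHom A) =
    EProject.link A.carrier (psi 0 ∘ ev) (psi 0 ∘ od ∘ ev) := by
  have hc : (EProject.link A.carrier (psi 0 ∘ ev) (psi 0 ∘ od ∘ ev)).carrier =
      arrVerts (tensorOb A (homOb A botOb)).carrier botOb.carrier := by
    change _ = arrVerts (_ ∪ (homOb A botOb).carrier.image od) ∅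
    rw [carrier_homOb_botOb, EProject.carrier_link, arrVerts, Finset.image_union,
      Finset.image_image, Finset.image_image, Finset.image_image, Finset.image_empty,
      Finset.union_empty]
    rfl
  refine rel_injective apart_curE (Hom.carrier_val _) hc ?_
  change curE _ = _
  rw [← val_curHom, curHom_evalHom, Hom.val_id, carrier_homOb_botOb,
    EProject.link_image apart_ev_od.left.injOn, rel, EProject.map_link, EProject.link_comm]
  exact EProject.link_congr (fun n _ => (mix_ev (psi 1 ∘ ev) (psi 0) n).symm)
    fun n _ => (mix_od (psi 1 ∘ ev) (psi 0) (ev n)).symm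

theorem doubleDual_eq (A : Obj) :
    doubleDual botOb A = curHom ((β_ (homOb A botOb) A).hom ≫ evalHom A) :=
  curry_eq_curHom (A := homOb A botOb) _

/-- The evaluation is a link, and the braiding and the transposition only move its ends, so the
canonical morphism is a link as well. -/
theorem isReloc_doubleDual (A : Obj) :
    IsReloc (B := homOb (homOb A botOb) botOb) (doubleDual botOb A) (ev ∘ ev) := by
  refine ⟨apart_ev_od.left.comp apart_ev_od.left, ?_⟩
  have hv : Hom.val ((β_ (homOb A botOb) A).hom ≫ evalHom A) =
      EProject.link A.carrier (psi 0 ∘ od) (psi 0 ∘ ev ∘ ev) := by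
    refine (isReloc_braiding_hom (homOb A botOb) A).val_comp_left ?_ ?_
    · change _ = arrVerts ((homOb A botOb).carrier.image ev ∪ _) ∅
      rw [carrier_homOb_botOb, EProject.carrier_link, arrVerts, Finset.image_union,
        Finset.image_image, Finset.image_image, Finset.image_image, Finset.image_empty,
        Finset.union_empty, Finset.union_comm]
      rfl
    · rw [val_evalHom, rel, EProject.map_link]
      exact EProject.link_congr (fun n _ => congrArg (psi 0) (swp_od n).symm)
        fun n _ => congrArg (psi 0) (swp_ev (ev n)).symm
  rw [doubleDual_eq]
  refine (val_curHom _).trans ((congrArg curE hv).trans ?_)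
  rw [curE, rel, EProject.map_link]
  exact EProject.link_congr (fun n _ => mix_od _ _ n) fun n _ => mix_ev _ _ (ev n)

theorem isDualizing_botOb : IsDualizing botOb := fun A => by
  have h : doubleDual botOb A =
      (reloc (set_doubleDual A) (apart_ev_od.left.comp apart_ev_od.left)).hom :=
    (isReloc_doubleDual A).ext (isReloc_reloc _ _) fun _ _ => rfl
  rw [h]
  exact Iso.isIso_hom _

end GoI

/-! ### The theorem -/

theorem mainTheorem2 :
    ∃ h : GoI.FormCategory,
      letI : Category.{1} GoI.Obj := GoI.conductCategory h
      ∃ (_ : MonoidalCategory GoI.Obj) (_ : SymmetricCategory GoI.Obj)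
        (_ : MonoidalClosed GoI.Obj),
        (𝟙_ GoI.Obj).projects = GoI.orth (GoI.orth {GoI.Project.unit ℕ}) ∧
        (∀ A B : GoI.Obj, (A ⊗ B).projects = GoI.tensorObjSet A B) ∧
        (∀ (A B C D : GoI.Obj) (f : A ⟶ B) (g : C ⟶ D),
          GoI.Hom.cls (f ⊗ₘ g) = GoI.tensorHomClass (GoI.Hom.cls f) (GoI.Hom.cls g)) ∧
        (∀ A B : GoI.Obj, ((ihom A).obj B).projects = GoI.internalHomSet A B) ∧
        ∃ bot : GoI.Obj, bot.projects = GoI.orth (𝟙_ GoI.Obj).projects ∧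
          GoI.IsDualizing bot ∧ bot ≠ 𝟙_ GoI.Obj := by
  exact ⟨GoI.formCategory, GoI.monoidalCategory,
    GoI.symmetricCategory, GoI.monoidalClosed,
    GoI.projects_unitOb, GoI.projects_tensorOb, fun _ _ _ _ => GoI.cls_tensHom,
    GoI.projects_homOb, GoI.botOb, GoI.projects_botOb_eq_orth, GoI.isDualizing_botOb,
    GoI.botOb_ne_unitOb⟩
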